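/- Conventions. All graphs are finite and simple and have at least one vertex. A class of graphs $\mathcal G$ is a set of graphs on every finite vertex set that is closed under isomorphism; $\mathcal C\subset\mathcal G$ is its subclass of connected graphs, and $\mathcal B\subset\mathcal C$ its subclass of graphs that are 2-connected or consist of two vertices joined by an edge. A block of a graph is a maximal connected subgraph that has no cutvertex of itself. $\mathcal G$ (or $\mathcal C$) is called block-stable if $\mathcal B\neq\emptyset$ and a graph $G$ belongs to $\mathcal G$ if and only if every block of $G$ belongs to $\mathcal B$ or is a single isolated vertex. For a species $\mathcal F$ let $\mathcal F_n$ be the set of its objects with label set $\{1,\dots,n\}$ and $F(z)=\sum_n|\mathcal F_n|z^n/n!$; $\mathcal F^\bullet$ is the species of $\mathcal F$-objects with a distinguished label (series $zF'(z)$), and $\mathcal F'$ the derived species, $\mathcal F'[U]=\mathcal F[U\cup\{*_U\}]$ (series $F'(z)$); $\mathcal F'^\bullet$ means $(\mathcal F')^\bullet$. $\mathcal F$ is analytic if $F(z)$ has positive radius of convergence. If $0<F(x)<\infty$, then $\Gamma F(x)$ denotes a Boltzmann-distributed random object: $\mathbb P(\Gamma F(x)=\gamma)=x^{|\gamma|}/(F(x)\,|\gamma|!)$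 for $\gamma\in\bigcup_n\mathcal F_n$. Series with nonnegative coefficients are evaluated in $[0,\infty]$. Statement. Let $\mathcal C$ be an analytic block-stable class of connected graphs. Let $\rho$ and $\rho_B$ be the radii of convergence of $C(z)$ and $B(z)$, $y=C^\bullet(\rho)$ and $\lambda=B'(y)$. Suppose that $B'^\bullet(\rho_B)\ge 1$ and $B'''(y)<\infty$. Then $\rho$, $y$ and $\lambda$ are finite, $\Gamma C^\bullet(\rho)$ and $\Gamma B'^\bullet(y)$ are well defined, and there is a probability distribution $\xi$ on $\{0,1,2,\dots\}$ with probability generating function $\varphi(z)=\exp(B'(yz)-\lambda)$, $0 \le z \le 1$ (which determines $\xi$); its variance is $\sigma^2=\mathbb E|\Gamma B'^\bullet(y)|<\infty$. Let $d$ be the span of $\xi$, i.e. the greatest common divisor of all differences $k-\ell$ with $\mathbb P(\xi=k)>0$ and $\mathbb P(\xi=\ell)>0$. Then, as $n\equiv 1 \bmod d$ tends to infinity, $$\mathbb P(|\Gamma C^\bullet(\rho)|=n)\sim\frac{d}{\sqrt{2\pi\sigma^2}}\,n^{-3/2}\qquad\text{and}\qquad |\mathcal C_n|\sim\frac{y\,d}{\sqrt{2\pi\sigma^2}}\,n^{-5/2}\rho^{-n}\,n!.$$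 -/

import Mathlib

open Filter Topology MeasureTheory Asymptotics
open scoped NNReal ENNReal Nat

namespace BlockStable

noncomputable section

/-! ### Combinatorial species -/

/-- A combinatorial species: a functor from finite sets with bijections to finite sets. -/
structure Species where
  /-- the set of objects over a finite label set -/
  obj : (U : Type) → [Finite U] → Type
  finite_obj : ∀ (U : Type) [Finite U], Finite (obj U)
  /-- transport along a bijection of label sets -/
  transport : ∀ {U V : Type} [Finite U] [Finite V], (U ≃ V) → obj U → obj V
  transport_refl : ∀ {U : Type} [Finite U] (a : obj U), transport (Equiv.refl U) a = a
  transport_trans : ∀ {U V W : Type} [Finite U] [Finite V] [Finite W]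
    (e : U ≃ V) (f : V ≃ W) (a : obj U), transport (e.trans f) a = transport f (transport e a)

namespace Species

/-- The pointed species: an object together with a distinguished label. -/
def pointed (F : Species) : Species where
  obj U _ := U × F.obj U
  finite_obj U _ := by
    have := F.finite_obj U
    infer_instance
  transport e p := (e p.1, F.transport e p.2)
  transport_refl p := by simp [F.transport_refl]
  transport_trans e f p := by simp [F.transport_trans]

/-- The derived species: `F'[U] = F[U ⊔ {*}]`, where `none : Option U` plays the role of `*`. -/
def derived (F : Species) : Species where
  obj U _ := F.obj (Option U)
  finite_obj U _ := F.finite_obj (Option U)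
  transport e a := F.transport e.optionCongr a
  transport_refl a := by
    rw [show (Equiv.refl _).optionCongr = Equiv.refl (Option _) from Equiv.optionCongr_refl]
    exact F.transport_refl a
  transport_trans e f a := by
    rw [show (e.trans f).optionCongr = e.optionCongr.trans f.optionCongr from
      Equiv.optionCongr_trans e f]
    exact F.transport_trans _ _ a

/-- The number of objects with label set of size `n`. -/
def count (F : Species) (n : ℕ) : ℕ := Nat.card (F.obj (Fin n))

/-- The exponential generating series `∑ |F_n| x ^ n / n!`. -/
def egf (F : Species) : PowerSeries ℝ≥0 := PowerSeries.mk fun n => (F.count n : ℝ≥0) / (n ! : ℝ≥0)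

/-- The sum, in `[0, ∞]`, of the exponential generating series at a point `x` of `[0, ∞]`. -/
def eval (F : Species) (x : ℝ≥0∞) : ℝ≥0∞ :=
  ∑' n : ℕ, ((PowerSeries.coeff n F.egf : ℝ≥0) : ℝ≥0∞) * x ^ n

/-- The radius of convergence of the exponential generating series. -/
def radius (F : Species) : ℝ≥0∞ :=
  (FormalMultilinearSeries.ofScalars ℝ
    (fun n : ℕ => ((PowerSeries.coeff n F.egf : ℝ≥0) : ℝ))).radius

/-- A species is analytic if its exponential generating series has positive radius of
convergence. -/
def IsAnalytic (F : Species) : Prop := 0 < F.radius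

/-- The set `⋃ n, F_n` of all objects with label sets `{1, …, n}` (here `Fin n`). -/
def Labelled (F : Species) : Type := Σ n : ℕ, F.obj (Fin n)

/-- The size of an object. -/
def Labelled.size {F : Species} (γ : F.Labelled) : ℕ := γ.1

instance (F : Species) : MeasurableSpace F.Labelled := ⊤

/-- The Boltzmann distribution with parameter `x` (meaningful when `0 < F(x) < ∞`):
an object `γ` has probability `x ^ |γ| / (F(x) |γ|!)`. -/
def boltzmann (F : Species) (x : ℝ≥0∞) : Measure F.Labelled :=
  Measure.sum fun γ : F.Labelled =>
    (x ^ γ.size / (F.eval x * (γ.size ! : ℝ≥0∞))) • Measure.dirac γ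

/-- The expected size `𝔼 |ΓF(x)|` of a Boltzmann-distributed object, in `[0, ∞]`. -/
def boltzmannMeanSize (F : Species) (x : ℝ≥0∞) : ℝ≥0∞ :=
  ∫⁻ γ, (γ.size : ℝ≥0∞) ∂(F.boltzmann x)

end Species

/-! ### Cutvertices, blocks, 2-connected graphs -/

/-- Deleting the vertex `v` disconnects the graph (used for connected graphs). The empty graph,
left over after deleting the vertex of a one-vertex graph, does not count as disconnected. -/
def IsCutvertex {V : Type} (G : SimpleGraph V) (v : V) : Prop :=
  ¬ (G.induce {w | w ≠ v}).Preconnected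

/-- A graph is 2-connected if it is connected, has at least three vertices and no cutvertex. -/
def IsTwoConnected {V : Type} (G : SimpleGraph V) : Prop :=
  G.Connected ∧ 3 ≤ Nat.card V ∧ ∀ v, ¬ IsCutvertex G v

/-- The graph consists of two vertices joined by an edge. -/
def IsSingleEdge {V : Type} (G : SimpleGraph V) : Prop :=
  Nat.card V = 2 ∧ G = ⊤

/-- A block of `G`: a maximal connected subgraph without a cutvertex (of itself). -/
def IsBlock {V : Type} (G : SimpleGraph V) (H : G.Subgraph) : Prop :=
  Maximal (fun K : G.Subgraph => K.Connected ∧ ∀ v, ¬ IsCutvertex K.coe v) H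

theorem IsCutvertex.of_iso {V W : Type} {G : SimpleGraph V} {H : SimpleGraph W} (e : G ≃g H)
    {v : V} (h : ¬ IsCutvertex G v) : ¬ IsCutvertex H (e v) := by
  unfold IsCutvertex at *
  rw [not_not] at *
  have f : G.induce {w | w ≠ v} ≃g H.induce {w | w ≠ e v} :=
    { toEquiv := e.toEquiv.subtypeEquiv (fun a => by
        show a ≠ v ↔ e a ≠ e v
        exact e.injective.ne_iff.symm)
      map_rel_iff' := by
        intro a b
        exact e.map_rel_iff }
  exact f.preconnected_iff.1 h

theorem IsTwoConnected.of_iso {V W : Type} {G : SimpleGraph V} {H : SimpleGraph W} (e : G ≃g H)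
    (h : IsTwoConnected G) : IsTwoConnected H := by
  refine ⟨e.connected_iff.1 h.1, Nat.card_congr e.toEquiv ▸ h.2.1, fun w => ?_⟩
  have := IsCutvertex.of_iso e (h.2.2 (e.symm w))
  simpa using this

theorem IsSingleEdge.of_iso {V W : Type} {G : SimpleGraph V} {H : SimpleGraph W} (e : G ≃g H)
    (h : IsSingleEdge G) : IsSingleEdge H := by
  refine ⟨Nat.card_congr e.toEquiv ▸ h.1, ?_⟩
  obtain ⟨-, rfl⟩ := h
  ext a b
  rw [← e.symm.map_adj_iff]
  simp

/-! ### Classes of graphs -/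

/-- A class of (finite simple) graphs: a subspecies of the species of graphs, i.e. a set of graphs
on every finite vertex set, closed under isomorphism. -/
structure GraphClass where
  /-- the graphs of the class with vertex set `U` -/
  graphs : (U : Type) → [Finite U] → Set (SimpleGraph U)
  iso_mem : ∀ {U V : Type} [Finite U] [Finite V] {G : SimpleGraph U} {H : SimpleGraph V},
    G ≃g H → G ∈ graphs U → H ∈ graphs V

namespace GraphClass

/-- A class of graphs as a species; transport is relabelling of the vertices. -/
def toSpecies (𝒢 : GraphClass) : Species where
  obj U _ := {G : SimpleGraph U // G ∈ 𝒢.graphs U}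
  finite_obj U _ := by
    infer_instance
  transport e G := ⟨G.1.map e.toEmbedding, 𝒢.iso_mem (SimpleGraph.Iso.map e G.1) G.2⟩
  transport_refl G := by
    apply Subtype.ext
    exact SimpleGraph.map_id G.1
  transport_trans e f G := by
    apply Subtype.ext
    exact (SimpleGraph.map_map G.1 e.toEmbedding f.toEmbedding).symm

/-- The subclass `𝒞` of the connected graphs (with non-empty vertex set) of a class. -/
def connectedPart (𝒢 : GraphClass) : GraphClass where
  graphs U _ := {G | G ∈ 𝒢.graphs U ∧ G.Connected}
  iso_mem e h := ⟨𝒢.iso_mem e h.1, e.connected_iff.1 h.2⟩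

/-- The subclass `ℬ` of the connected graphs of the class that are 2-connected or consist of
two vertices joined by an edge. -/
def blockPart (𝒢 : GraphClass) : GraphClass where
  graphs U _ := {G | G ∈ 𝒢.connectedPart.graphs U ∧ (IsTwoConnected G ∨ IsSingleEdge G)}
  iso_mem e h := ⟨𝒢.connectedPart.iso_mem e h.1,
    h.2.imp (IsTwoConnected.of_iso e) (IsSingleEdge.of_iso e)⟩

/-- A class `𝒢` of graphs is block-stable if `ℬ` is non-empty and a graph belongs to `𝒢` if and
only if each of its blocks belongs to `ℬ` or is a single isolated vertex. (A block with only one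
vertex is automatically an isolated vertex, by maximality; graphs have at least one vertex.) -/
def IsBlockStable (𝒢 : GraphClass) : Prop :=
  (∃ n : ℕ, (𝒢.blockPart.graphs (Fin n)).Nonempty) ∧
  ∀ (U : Type) [Finite U] [Nonempty U] (G : SimpleGraph U),
    G ∈ 𝒢.graphs U ↔ ∀ H : G.Subgraph, IsBlock G H →
      H.coe ∈ 𝒢.blockPart.graphs H.verts ∨ Nat.card H.verts = 1

/-- The species `𝒞` of connected graphs of the class. -/
abbrev C (𝒢 : GraphClass) : Species := 𝒢.connectedPart.toSpecies

/-- The species `ℬ` of blocks of the class. -/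
abbrev B (𝒢 : GraphClass) : Species := 𝒢.blockPart.toSpecies

/-- `ρ`, the radius of convergence of `C(z)`. -/
def rho (𝒢 : GraphClass) : ℝ≥0∞ := 𝒢.C.radius

/-- `ρ_B`, the radius of convergence of `B(z)`. -/
def rhoB (𝒢 : GraphClass) : ℝ≥0∞ := 𝒢.B.radius

/-- `y = C^•(ρ)`. -/
def y (𝒢 : GraphClass) : ℝ≥0∞ := 𝒢.C.pointed.eval 𝒢.rho

/-- `λ = B'(y)`. -/
def lam (𝒢 : GraphClass) : ℝ≥0∞ := 𝒢.B.derived.eval 𝒢.y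

/-- `ξ` has the probability generating function `φ(z) = exp(B'(yz) - λ)`. This determines `ξ`. -/
def IsOffspringLaw (𝒢 : GraphClass) (ξ : PMF ℕ) : Prop :=
  ∀ z : ℝ≥0, z ≤ 1 → HasSum (fun k : ℕ => (ξ k).toReal * (z : ℝ) ^ k)
    (Real.exp ((𝒢.B.derived.eval (𝒢.y * z)).toReal - 𝒢.lam.toReal))

end GraphClass

/-- The span of a distribution on `ℕ`: the greatest common divisor of the differences of elements
of its support. -/
def span (ξ : PMF ℕ) : ℕ :=
  sSup {m : ℕ | ∀ k ∈ ξ.support, ∀ l ∈ ξ.support, (m : ℤ) ∣ (k : ℤ) - (l : ℤ)}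

/-- The filter "`n → ∞` with `n ≡ 1 mod d`". -/
def atTopOneMod (d : ℕ) : Filter ℕ := atTop ⊓ 𝓟 {n : ℕ | n ≡ 1 [MOD d]}

end

end BlockStable

/-!
The proof combines an identity for generating series, the location of the dominant singularity,
and a local limit theorem.

*The functional equation* `C^•(z) = z exp(B'(C^•(z)))` (`serT_functional_equation`). In a connected
graph with `n` vertices the numbers `|b| - 1`, over all blocks `b`, add up to `n - 1`
(`sum_isBlockSet`). A connected graph with a distinguished block `b` is the same as a graph on `b`
together with a rooted connected graph for each vertex of `b`, glued on at its root, and block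
stability says that the whole belongs to the class if and only if all the parts do
(`glueMap_bijective`). Counting graphs with a distinguished block, weighted by `|b| - 1`, in two
ways yields `C^• - C = (z B' - B)(C^•)` (`serT_sub_serC`). Differentiating this gives a linear
differential equation, `C'' = (B'(C^•))' C'`, whose solution is `C' = exp(B'(C^•))`.

*The critical point.* As `B'^•(ρ_B) ≥ 1`, there is `τ > 0` with `B'^•(τ) = τ B''(τ) = 1`. The function
`w exp(-B'(w))` has its maximum `r = τ exp(-B'(τ))` at `τ`: this is the tangent inequality
`B'(w) ≥ B'(τ) + (w / τ - 1)` together with `1 + t ≤ exp t`. Since `x = w exp(-B'(w))` for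
`w = C^•(x)`, the series `C^•` diverges beyond `r` (`le_of_evE_ne_top`). The truncations of
`C^•(r)` are at most `τ` by induction, and `τ` is the only solution of the equation at `r`, so
`C^•(r) = τ` (`evE_critical`). Hence `ρ = r`, `y = τ`, `λ = B'(τ)`.

*From coefficients to probabilities.* By Lagrange inversion, `n [zⁿ] C^• = [wⁿ⁻¹] exp(n B'(w))`, which
says that `ℙ(|ΓC^•(ρ)| = n) = ℙ(S_n = n - 1) / n` for a sum `S_n` of `n` independent variables with
distribution `ξ` (`coeff_serT_mul_pow`). The distribution `ξ` is compound Poisson with jump rates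
`c_k = [w^k] B'(w) · y^k`; the recursion `k ξ_k = ∑ i c_i ξ_j` over `i + j = k` gives mean
`∑ k c_k = 1` and variance `∑ k² c_k = 𝔼|ΓB'^•(y)|`, and shows that the span of `ξ` is the greatest
common divisor of the `k` with `c_k ≠ 0` (`span_spec`).

*The local limit theorem* (`local_limit`) is Fourier inversion and Laplace's method. For
`n ≡ 1 mod d` the integrand has period `2π / d`, and on one period the characteristic function is
dominated by a Gaussian (`exists_re_logChar_le`), so that `√n ℙ(S_n = n - 1)` tends to `d / √(2πσ²)`
by dominated convergence.
-/

namespace BlockStable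

/-! ### Connectivity and blocks in terms of vertex sets -/

section BlockSets

variable {V W : Type} {G K : SimpleGraph V} {A A' S S' : Set V} {x y z u v r : V}

/-- `y` can be reached from `x` by a walk in `G` all of whose edges lie inside the vertex set
`A`. -/
def ReachIn (G : SimpleGraph V) (A : Set V) : V → V → Prop :=
  Relation.ReflTransGen fun a b => G.Adj a b ∧ a ∈ A ∧ b ∈ A

/-- The vertex set `A` induces a (possibly empty) connected subgraph of `G`. -/
def ConnOn (G : SimpleGraph V) (A : Set V) : Prop := ∀ x ∈ A, ∀ y ∈ A, ReachIn G A x y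

/-- The vertex set `S` induces a connected subgraph of `G` without a cutvertex. -/
def Bic (G : SimpleGraph V) (S : Set V) : Prop :=
  S.Nonempty ∧ ConnOn G S ∧ ∀ v, ConnOn G (S \ {v})

/-- The vertex sets of the blocks of `G`. As blocks are induced subgraphs, the vertex set determines
the block. -/
def IsBlockSet (G : SimpleGraph V) (S : Set V) : Prop := Maximal (Bic G) S

/-- The graph `G` without the edges inside the vertex set `S`. -/
def cutG (G : SimpleGraph V) (S : Set V) : SimpleGraph V where
  Adj a b := G.Adj a b ∧ ¬ (a ∈ S ∧ b ∈ S)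
  symm := ⟨fun _ _ h => ⟨h.1.symm, fun h' => h.2 h'.symm⟩⟩
  loopless := ⟨fun _ h => h.1.ne rfl⟩

theorem cutG_le : cutG G S ≤ G := fun _ _ h => h.1

theorem ReachIn.mono (hG : G ≤ K) (hA : A ⊆ A') (h : ReachIn G A x y) : ReachIn K A' x y :=
  Relation.ReflTransGen.mono (fun _ _ h => ⟨hG h.1, hA h.2.1, hA h.2.2⟩) _ _ h

theorem ReachIn.symm (h : ReachIn G A x y) : ReachIn G A y x := by
  induction h with
  | refl => exact .refl
  | tail _ hbc ih => exact Relation.ReflTransGen.head ⟨hbc.1.symm, hbc.2.2, hbc.2.1⟩ ih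

theorem ReachIn.trans (h : ReachIn G A x y) (h' : ReachIn G A y z) : ReachIn G A x z :=
  Relation.ReflTransGen.trans h h'

theorem ReachIn.reachable (h : ReachIn G A x y) : G.Reachable x y := by
  induction h with
  | refl => exact .refl _
  | tail _ hbc ih => exact ih.trans hbc.1.reachable

theorem reachIn_of_walk {a b : V} (p : K.Walk a b) (hK : K ≤ G) (h : ∀ x ∈ p.support, x ∈ A) :
    ReachIn G A a b := by
  induction p with
  | nil => exact .refl
  | cons hab q ih =>
    simp only [SimpleGraph.Walk.support_cons, List.mem_cons, forall_eq_or_imp] at h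
    exact Relation.ReflTransGen.head ⟨hK hab, h.1, h.2 _ q.start_mem_support⟩ (ih h.2)

theorem reachIn_iff_induce {x y : A} :
    ReachIn G A x y ↔ (G.induce A).Reachable x y := by
  constructor
  · intro h
    obtain ⟨x, hx⟩ := x
    obtain ⟨y, hy⟩ := y
    change ReachIn G A x y at h
    induction h with
    | refl => exact .refl _
    | tail _ hbc ih =>
      exact (ih hbc.2.1).trans (SimpleGraph.Adj.reachable (by simpa using hbc.1))
  · rintro ⟨p⟩
    induction p with
    | nil => exact .refl
    | @cons a b c hab q ih => exact Relation.ReflTransGen.head ⟨hab, a.2, b.2⟩ ih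

theorem connOn_iff : ConnOn G A ↔ (G.induce A).Preconnected :=
  ⟨fun h x y => reachIn_iff_induce.1 (h x x.2 y y.2),
    fun h x hx y hy => (reachIn_iff_induce (x := ⟨x, hx⟩) (y := ⟨y, hy⟩)).2 (h _ _)⟩

theorem ConnOn.union (hA : ConnOn G A) (hA' : ConnOn G A') (hz : z ∈ A) (hz' : z ∈ A') :
    ConnOn G (A ∪ A') := by
  have key : ∀ x ∈ A ∪ A', ReachIn G (A ∪ A') x z := by
    rintro x (hx | hx)
    · exact (hA x hx z hz).mono le_rfl Set.subset_union_left
    · exact (hA' x hx z hz').mono le_rfl Set.subset_union_right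
  exact fun x hx y hy => (key x hx).trans (key y hy).symm

/-- Two such sets with two common vertices: deleting any vertex leaves one of the two. -/
theorem Bic.union (h : Bic G S) (h' : Bic G S') (hne : u ≠ v) (hu : u ∈ S) (hv : v ∈ S)
    (hu' : u ∈ S') (hv' : v ∈ S') : Bic G (S ∪ S') := by
  refine ⟨h.1.mono Set.subset_union_left, h.2.1.union h'.2.1 hu hu', fun w => ?_⟩
  rw [Set.union_sdiff_distrib]
  by_cases hw : u = w
  · have hvw : v ≠ w := fun h => hne (hw.trans h.symm)
    exact (h.2.2 w).union (h'.2.2 w) (z := v) ⟨hv, hvw⟩ ⟨hv', hvw⟩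
  · exact (h.2.2 w).union (h'.2.2 w) (z := u) ⟨hu, hw⟩ ⟨hu', hw⟩

theorem IsBlockSet.eq_of_two_mem (h : IsBlockSet G S) (h' : IsBlockSet G S') (hne : u ≠ v)
    (hu : u ∈ S) (hv : v ∈ S) (hu' : u ∈ S') (hv' : v ∈ S') : S = S' :=
  have hb := h.1.union h'.1 hne hu hv hu' hv'
  (h.eq_of_le hb Set.subset_union_left).trans (h'.eq_of_le hb Set.subset_union_right).symm

theorem Bic.exists_isBlockSet [Finite V] (h : Bic G S) : ∃ S', S ⊆ S' ∧ IsBlockSet G S' :=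
  Finite.exists_le_maximal h

theorem bic_pair (h : G.Adj u v) : Bic G {u, v} := by
  have h0 : ConnOn G {u, v} := by
    have huv : ReachIn G {u, v} u v :=
      Relation.ReflTransGen.single ⟨h, by simp, by simp⟩
    rintro x (rfl | rfl) y (rfl | rfl)
    exacts [.refl, huv, huv.symm, .refl]
  refine ⟨⟨u, by simp⟩, h0, fun w x hx y hy => ?_⟩
  by_cases hxy : x = y
  · subst hxy; exact .refl
  · -- Only one of the two vertices can be deleted, so two distinct remaining ones are `u` and `v`.
    have hw : ({u, v} : Set V) \ {w} = {u, v} := by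
      apply Set.sdiff_singleton_eq_self
      rintro (rfl | rfl) <;> simp at hx hy <;> grind
    rw [hw] at hx hy ⊢
    exact h0 x hx y hy

/-- Attaching to a block a path with two distinct ends in the block gives no cutvertex; by
maximality the path was inside the block. So distinct vertices of a block lie in different
components once the edges of the block are deleted. -/
theorem IsBlockSet.eq_of_reachable_cutG (h : IsBlockSet G S) (hu : u ∈ S) (hv : v ∈ S)
    (huv : (cutG G S).Reachable u v) : u = v := by
  classical
  by_contra hne
  obtain ⟨q⟩ := huv
  obtain ⟨p, hp⟩ : ∃ p : (cutG G S).Walk u v, p.IsPath := ⟨q.bypass, q.bypass_isPath⟩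
  set X : Set V := S ∪ {x | x ∈ p.support} with hX
  -- From a vertex `x` of the path, one of the two directions along it reaches `S` avoiding `w`.
  have hux : ∀ x ∈ p.support, ∀ w, x ≠ w → ∃ s ∈ S, s ≠ w ∧ ReachIn G (X \ {w}) s x := by
    intro x hx w hxw
    have hdisj : ∀ z ∈ (p.takeUntil x hx).support, z ∈ (p.dropUntil x hx).support → x ≠ z →
        False := by
      intro z hz hz' hxz
      have hp' := hp
      rw [← p.take_spec hx] at hp'
      exact hp'.ne_of_mem_support_of_append hxz.symm hz hz' rfl
    by_cases hw : w ∈ (p.takeUntil x hx).support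
    · refine ⟨v, hv, ?_, (reachIn_of_walk (p.dropUntil x hx) cutG_le ?_).symm⟩
      · rintro rfl
        exact hdisj _ hw (SimpleGraph.Walk.end_mem_support _) hxw
      · intro z hz
        refine ⟨Or.inr (p.support_dropUntil_subset_support hx hz), ?_⟩
        rintro rfl
        exact hdisj _ hw hz hxw
    · refine ⟨u, hu, ?_, reachIn_of_walk (p.takeUntil x hx) cutG_le ?_⟩
      · rintro rfl
        exact hw (SimpleGraph.Walk.start_mem_support _)
      · intro z hz
        refine ⟨Or.inr (p.support_takeUntil_subset_support hx hz), ?_⟩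
        rintro rfl
        exact hw hz
  have hdel : ∀ w, ConnOn G (X \ {w}) := by
    intro w
    have key : ∀ x ∈ X \ {w}, ∃ s ∈ S \ {w}, ReachIn G (X \ {w}) x s := by
      rintro x ⟨hx | hx, hxw⟩
      · exact ⟨x, ⟨hx, hxw⟩, .refl⟩
      · obtain ⟨s, hs, hsw, hr⟩ := hux x hx w hxw
        exact ⟨s, ⟨hs, hsw⟩, hr.symm⟩
    intro x hx y hy
    obtain ⟨s, hs, hxs⟩ := key x hx
    obtain ⟨t, ht, hyt⟩ := key y hy
    exact (hxs.trans ((h.1.2.2 w s hs t ht).mono le_rfl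
      (Set.sdiff_subset_sdiff_left Set.subset_union_left))).trans hyt.symm
  have hconn : ConnOn G X := by
    apply h.1.2.1.union _ hu (by simp : u ∈ {x | x ∈ p.support})
    have key : ∀ x ∈ {x | x ∈ p.support}, ReachIn G {x | x ∈ p.support} u x := fun x hx =>
      reachIn_of_walk (p.takeUntil x hx) cutG_le fun z hz => p.support_takeUntil_subset_support hx hz
    exact fun x hx y hy => (key x hx).symm.trans (key y hy)
  have hXS : S = X := h.eq_of_le ⟨⟨u, Or.inl hu⟩, hconn, hdel⟩ Set.subset_union_left
  -- The first edge of the path is not inside `S`, yet all vertices of the path are in `S`.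
  cases p with
  | nil => exact hne rfl
  | @cons _ b _ hub p' =>
    refine hub.2 ⟨hu, ?_⟩
    rw [hXS, hX]
    exact Or.inr (by simp)

/-- Following a walk in `A` to its first vertex in `S` uses no edges inside `S`. -/
theorem ReachIn.exists_gate (h : ReachIn G A x y) (hx : x ∈ A) (hy : y ∈ S) :
    ∃ u ∈ S ∩ A, (cutG G S).Reachable x u := by
  induction h using Relation.ReflTransGen.head_induction_on with
  | refl => exact ⟨y, ⟨hy, hx⟩, .refl _⟩
  | @head a b hab _ ih =>
    by_cases ha : a ∈ S
    · exact ⟨a, ⟨ha, hx⟩, .refl _⟩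
    · obtain ⟨u, hu, hbu⟩ := ih hab.2.2
      exact ⟨u, hu, (SimpleGraph.Adj.reachable (G := cutG G S)
        ⟨hab.1, fun h => ha h.1⟩).trans hbu⟩

theorem reachIn_univ (h : G.Reachable x y) : ReachIn G Set.univ x y := by
  obtain ⟨p⟩ := h
  exact reachIn_of_walk p le_rfl (by simp)

theorem exists_gate (hG : G.Preconnected) (hS : S.Nonempty) (x : V) :
    ∃ u ∈ S, (cutG G S).Reachable x u := by
  obtain ⟨s, hs⟩ := hS
  obtain ⟨u, hu, h⟩ := (reachIn_univ (hG x s)).exists_gate trivial hs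
  exact ⟨u, hu.1, h⟩

/-- A walk witnessing `K.Reachable x y` stays in the `K`-component of `x`. -/
theorem reachIn_of_reachable (hK : K ≤ G) (hA : ∀ z, K.Reachable x z → z ∈ A)
    (h : K.Reachable x y) : ReachIn G A x y := by
  classical
  obtain ⟨p⟩ := h
  exact reachIn_of_walk p hK fun z hz => hA z (p.takeUntil z hz).reachable

/-- For `r ≠ v` in a connected graph, there is exactly one block at `v` that leads
towards `r`. -/
theorem existsUnique_block_towards [Finite V] (hG : G.Preconnected) (hrv : r ≠ v) :
    ∃! S, IsBlockSet G S ∧ v ∈ S ∧ ¬ (cutG G S).Reachable r v := by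
  classical
  obtain ⟨q⟩ := hG v r
  obtain ⟨p, hp⟩ : ∃ p : G.Walk v r, p.IsPath := ⟨q.bypass, q.bypass_isPath⟩
  cases p with
  | nil => exact absurd rfl hrv
  | @cons _ w _ hvw p =>
    rw [SimpleGraph.Walk.cons_isPath_iff] at hp
    obtain ⟨S, hS, hSb⟩ := (bic_pair hvw).exists_isBlockSet
    have hvS : v ∈ S := hS (by simp)
    refine ⟨S, ⟨hSb, hvS, fun hr => ?_⟩, ?_⟩
    · -- Going backwards along the path, which avoids `v`, reaches `S` at a vertex other than `v`.
      have h1 : ReachIn G {z | z ≠ v} w r := reachIn_of_walk p le_rfl fun z hz => by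
        rintro rfl
        exact hp.2 hz
      obtain ⟨u, hu, hur⟩ := h1.symm.exists_gate hrv (hS (by simp : w ∈ ({v, w} : Set V)))
      exact hu.2 (hSb.eq_of_reachable_cutG hu.1 hvS (hur.symm.trans hr))
    · rintro S' ⟨hSb', hvS', hr'⟩
      by_contra hne
      -- Both blocks lead to `r` in `G - v`, through vertices `u'` of `S'` and `w` of `S`.
      obtain ⟨u', hu', hru'⟩ := exists_gate hG hSb'.1.1 r
      have huv' : u' ≠ v := by rintro rfl; exact hr' hru'
      have h1 : ReachIn G {z | z ≠ v} u' r := by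
        refine reachIn_of_reachable cutG_le ?_ hru'.symm
        rintro z hz rfl
        exact hr' (hru'.trans hz)
      have h2 : ReachIn G {z | z ≠ v} r w := (reachIn_of_walk p le_rfl fun z hz => by
        rintro rfl
        exact hp.2 hz).symm
      obtain ⟨u, hu, huu'⟩ :=
        (h1.trans h2).exists_gate huv' (hS (by simp : w ∈ ({v, w} : Set V)))
      have h3 : (cutG G S).Reachable u' v := by
        refine (ReachIn.reachable (A := S') (Relation.ReflTransGen.mono ?_ _ _
          (hSb'.1.2.1 u' hu' v hvS')))
        exact fun a b hab => ⟨⟨hab.1, fun h => hne (hSb'.eq_of_two_mem hSb hab.1.ne hab.2.1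
          hab.2.2 h.1 h.2)⟩, hab.2⟩
      exact hu.2 (hSb.eq_of_reachable_cutG hu.1 hvS (huu'.symm.trans h3))

end BlockSets

/-! ### The sum of block sizes, and blocks under embeddings -/

section BlockSum

variable {V W : Type} {G : SimpleGraph V} {Γ : SimpleGraph W}

open Classical in
/-- In a connected graph the numbers `|b| - 1`, over all blocks `b`, add up to the number of
vertices minus one: after fixing a vertex `r`, every other vertex belongs to exactly one block in
which it is not the vertex closest to `r`. -/
theorem sum_isBlockSet [Fintype V] (hG : G.Connected) :
    ∑ S : Set V with IsBlockSet G S, (S.ncard - 1) = Fintype.card V - 1 := by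
  obtain ⟨r⟩ := hG.nonempty
  have h1 : ∀ S ∈ Finset.univ.filter (IsBlockSet G), S.ncard - 1
      = ∑ v : V, if v ∈ S ∧ ¬ (cutG G S).Reachable r v then 1 else 0 := by
    intro S hS
    have hS : IsBlockSet G S := by simpa using hS
    obtain ⟨u, hu, hru⟩ := exists_gate hG.preconnected hS.1.1 r
    rw [← Set.ncard_sdiff_singleton_of_mem hu, Finset.sum_boole, Set.ncard_eq_toFinset_card']
    simp only [Nat.cast_id]
    congr 1
    ext v
    simp only [Set.mem_toFinset, Set.mem_sdiff, Set.mem_singleton_iff, Finset.mem_filter,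
      Finset.mem_univ, true_and]
    refine and_congr_right fun hv => not_congr ⟨?_, ?_⟩
    · rintro rfl
      exact hru
    · exact fun h => hS.eq_of_reachable_cutG hv hu (h.symm.trans hru)
  rw [Finset.sum_congr rfl h1, Finset.sum_comm]
  have h2 : ∀ v : V, (∑ S : Set V with IsBlockSet G S,
      if v ∈ S ∧ ¬ (cutG G S).Reachable r v then 1 else 0) = if v ≠ r then 1 else 0 := by
    intro v
    rw [Finset.sum_boole, Finset.filter_filter]
    split_ifs with hv
    · obtain ⟨S, hS, huniq⟩ := existsUnique_block_towards hG.preconnected (Ne.symm hv)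
      rw [Nat.cast_id, Finset.card_eq_one]
      refine ⟨S, Finset.ext fun S' => ?_⟩
      simp only [Finset.mem_filter, Finset.mem_univ, true_and, Finset.mem_singleton]
      exact ⟨huniq S', by rintro rfl; exact hS⟩
    · rw [not_not] at hv
      subst hv
      simp
  rw [Finset.sum_congr rfl fun v _ => h2 v, Finset.sum_boole, Finset.filter_ne',
    Finset.card_erase_of_mem (Finset.mem_univ _), Nat.cast_id, Finset.card_univ]

theorem ReachIn.map (f : Γ →g G) {A : Set W} {x y : W} (h : ReachIn Γ A x y) :
    ReachIn G (f '' A) (f x) (f y) := by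
  induction h with
  | refl => exact .refl
  | tail _ hbc ih =>
    exact ih.tail ⟨f.map_adj hbc.1, Set.mem_image_of_mem f hbc.2.1, Set.mem_image_of_mem f hbc.2.2⟩

theorem ConnOn.map (f : Γ →g G) {A : Set W} (h : ConnOn Γ A) : ConnOn G (f '' A) := by
  rintro _ ⟨x, hx, rfl⟩ _ ⟨y, hy, rfl⟩
  exact (h x hx y hy).map f

theorem ReachIn.of_embedding (f : Γ ↪g G) {A : Set W} {a b : V}
    (h : ReachIn G (f '' A) a b) : ∀ x, f x = a → ∃ y, f y = b ∧ ReachIn Γ A x y := by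
  induction h with
  | refl => exact fun x hx => ⟨x, hx, .refl⟩
  | tail _ hbc ih =>
    intro x hx
    obtain ⟨y, rfl, hxy⟩ := ih x hx
    obtain ⟨y', hy', hyy'⟩ := hbc.2.1
    obtain ⟨z, hz, rfl⟩ := hbc.2.2
    obtain rfl := f.injective hyy'
    exact ⟨z, rfl, hxy.tail ⟨f.map_adj_iff.1 hbc.1, hy', hz⟩⟩

theorem connOn_image_iff (f : Γ ↪g G) {A : Set W} : ConnOn G (f '' A) ↔ ConnOn Γ A := by
  refine ⟨fun h x hx y hy => ?_, fun h => h.map f.toHom⟩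
  obtain ⟨z, hz, hxz⟩ := (h _ (Set.mem_image_of_mem f hx) _
    (Set.mem_image_of_mem f hy)).of_embedding f x rfl
  rwa [f.injective hz] at hxz

theorem Bic.map (f : Γ →g G) (hf : Function.Injective f) {A : Set W} (h : Bic Γ A) :
    Bic G (f '' A) := by
  refine ⟨h.1.image f, h.2.1.map f, fun v => ?_⟩
  by_cases hv : ∃ w, f w = v
  · obtain ⟨w, rfl⟩ := hv
    rw [← Set.image_singleton, ← Set.image_sdiff hf]
    exact (h.2.2 w).map f
  · rw [Set.sdiff_singleton_eq_self]
    · exact h.2.1.map f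
    · rintro ⟨w, -, hw⟩
      exact hv ⟨w, hw⟩

theorem bic_image_iff (f : Γ ↪g G) {A : Set W} : Bic G (f '' A) ↔ Bic Γ A := by
  refine ⟨fun h => ⟨h.1.of_image, (connOn_image_iff f).1 h.2.1, fun w => ?_⟩,
    fun h => h.map f.toHom f.injective⟩
  have := h.2.2 (f w)
  rw [← Set.image_singleton, ← Set.image_sdiff f.injective] at this
  exact (connOn_image_iff f).1 this

/-- A block of `G` contained in the range of an embedding is a block of the embedded graph. -/
theorem IsBlockSet.of_image (f : Γ ↪g G) {A : Set W} (h : IsBlockSet G (f '' A)) :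
    IsBlockSet Γ A :=
  ⟨(bic_image_iff f).1 h.1, fun _ hA hle =>
    (Set.image_subset_image_iff f.injective).1
      (h.2 ((bic_image_iff f).2 hA) (Set.image_mono hle))⟩

theorem bic_univ_iff : Bic G Set.univ ↔ G.Connected ∧ ∀ v, ¬ IsCutvertex G v := by
  have h1 : ConnOn G Set.univ ↔ G.Preconnected := by
    refine ⟨fun h x y => (h x trivial y trivial).reachable, fun h x _ y _ => reachIn_univ (h x y)⟩
  have h2 : ∀ v : V, (Set.univ \ {v} : Set V) = {w | w ≠ v} := fun v => by ext; simp
  simp only [Bic, h1, h2, IsCutvertex, not_not, connOn_iff, Set.nonempty_iff_univ_nonempty.symm,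
    SimpleGraph.connected_iff]
  tauto

theorem bic_range_iff (f : Γ ↪g G) :
    Bic G (Set.range f) ↔ Γ.Connected ∧ ∀ v, ¬ IsCutvertex Γ v := by
  rw [← Set.image_univ, bic_image_iff, bic_univ_iff]

theorem bic_iff_induce {S : Set V} :
    Bic G S ↔ (G.induce S).Connected ∧ ∀ v, ¬ IsCutvertex (G.induce S) v := by
  rw [← bic_range_iff (SimpleGraph.Embedding.induce S),
    show Set.range (SimpleGraph.Embedding.induce (G := G) S) = S from Subtype.range_coe]

theorem bic_of_subgraph (H : G.Subgraph) (h : H.Connected) (h' : ∀ v, ¬ IsCutvertex H.coe v) :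
    Bic G H.verts := by
  have := (bic_univ_iff.2 ⟨h.coe, h'⟩).map H.hom H.hom_injective
  simpa using this

theorem subgraph_of_bic {S : Set V} (h : Bic G S) : ((⊤ : G.Subgraph).induce S).Connected ∧
    ∀ v, ¬ IsCutvertex ((⊤ : G.Subgraph).induce S).coe v := by
  rw [bic_iff_induce, SimpleGraph.induce_eq_coe_induce_top] at h
  exact ⟨⟨h.1⟩, h.2⟩

/-- Blocks are induced subgraphs, so they correspond to their vertex sets. -/
theorem isBlock_iff {H : G.Subgraph} :
    IsBlock G H ↔ IsBlockSet G H.verts ∧ H = (⊤ : G.Subgraph).induce H.verts := by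
  constructor
  · intro h
    have hb := bic_of_subgraph H h.1.1 h.1.2
    refine ⟨⟨hb, fun S hS hle => ?_⟩, h.eq_of_le (subgraph_of_bic hb)
      SimpleGraph.Subgraph.le_induce_top_verts⟩
    exact (h.2 (subgraph_of_bic hS) (SimpleGraph.Subgraph.le_induce_top_verts.trans
      (SimpleGraph.Subgraph.induce_mono_right hle))).1
  · rintro ⟨h, hH⟩
    refine ⟨?_, fun K hK hle => ?_⟩
    · have := subgraph_of_bic h.1
      rwa [← hH] at this
    · have h1 : K.verts ≤ H.verts := h.2 (bic_of_subgraph K hK.1 hK.2) hle.1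
      rw [hH]
      exact SimpleGraph.Subgraph.le_induce_top_verts.trans
        (SimpleGraph.Subgraph.induce_mono_right h1)

end BlockSum

namespace GraphClass

variable {V W : Type} [Finite V] [Finite W] {G : SimpleGraph V} {Γ : SimpleGraph W}

/-- The vertex set `S` induces in `G` a member of `ℬ` or a single vertex. -/
def BlockOK (𝒢 : GraphClass) (G : SimpleGraph V) (S : Set V) : Prop :=
  G.induce S ∈ 𝒢.blockPart.graphs S ∨ Nat.card S = 1

theorem blockOK_image_iff (𝒢 : GraphClass) (f : Γ ↪g G) {A : Set W} :
    𝒢.BlockOK G (f '' A) ↔ 𝒢.BlockOK Γ A := by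
  have e : Γ.induce A ≃g G.induce (f '' A) :=
    ⟨Equiv.Set.image f A f.injective, by
      intro a b
      simp⟩
  unfold BlockOK
  rw [Nat.card_image_of_injective f.injective]
  exact or_congr_left ⟨𝒢.blockPart.iso_mem e.symm, 𝒢.blockPart.iso_mem e⟩

/-- Block stability in terms of vertex sets of blocks. -/
theorem IsBlockStable.mem_iff {𝒢 : GraphClass} (h : 𝒢.IsBlockStable) [Nonempty V] :
    G ∈ 𝒢.graphs V ↔ ∀ S, IsBlockSet G S → 𝒢.BlockOK G S := by
  rw [h.2]
  constructor
  · intro hG S hS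
    have := hG ((⊤ : G.Subgraph).induce S) (isBlock_iff.2 ⟨hS, rfl⟩)
    rw [BlockOK, SimpleGraph.induce_eq_coe_induce_top]
    exact this
  · intro hG H hH
    obtain ⟨h1, h2⟩ := isBlock_iff.1 hH
    have := hG _ h1
    rw [BlockOK, SimpleGraph.induce_eq_coe_induce_top] at this
    rw [h2]
    exact this

theorem bic_of_mem_blockPart {𝒢 : GraphClass} (h : G ∈ 𝒢.blockPart.graphs V) :
    Bic G Set.univ ∧ Nontrivial V := by
  obtain ⟨⟨-, hc⟩, h | h⟩ := h
  · refine ⟨bic_univ_iff.2 ⟨h.1, h.2.2⟩, ?_⟩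
    have := h.2.1
    rw [← Finite.one_lt_card_iff_nontrivial]
    omega
  · have hnt : Nontrivial V := by
      rw [← Finite.one_lt_card_iff_nontrivial, h.1]
      norm_num
    refine ⟨?_, hnt⟩
    obtain ⟨u, v, huv, huniv⟩ := Nat.card_eq_two_iff.1 h.1
    rw [← huniv]
    refine bic_pair ?_
    rw [h.2]
    exact huv

end GraphClass

/-! ### Gluing rooted graphs to the vertices of a block -/

section Glue

variable {V I : Type} {p : V → I} {root : I → V} {K : SimpleGraph V} {H : SimpleGraph I}

/-- The graph obtained from a graph `K`, thought of as a disjoint union of graphs indexed by `I`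
with roots `root i`, by adding a copy of the graph `H` on the roots. -/
def glue (root : I → V) (K : SimpleGraph V) (H : SimpleGraph I) : SimpleGraph V := K ⊔ H.map root

/-- The edges of `K` stay within the fibres of `p`, each fibre is connected, and `root` selects a
vertex of each fibre. -/
structure IsRooted (p : V → I) (root : I → V) (K : SimpleGraph V) : Prop where
  proj_root : ∀ i, p (root i) = i
  proj_adj : ∀ x y, K.Adj x y → p x = p y
  conn : ∀ i, ConnOn K (p ⁻¹' {i})

namespace IsRooted

variable (h : IsRooted p root K)
include h

theorem root_injective : Function.Injective root := fun i j hij => by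
  rw [← h.proj_root i, hij, h.proj_root]

theorem proj_reachable {x y : V} (hxy : K.Reachable x y) : p x = p y := by
  obtain ⟨q⟩ := hxy
  induction q with
  | nil => rfl
  | cons hab _ ih => exact (h.proj_adj _ _ hab).trans ih

theorem reachable_root (x : V) : K.Reachable x (root (p x)) :=
  (h.conn (p x) x rfl (root (p x)) (h.proj_root _)).reachable

theorem glue_adj {x y : V} : (glue root K H).Adj x y ↔
    K.Adj x y ∨ ∃ i j, H.Adj i j ∧ root i = x ∧ root j = y := by
  simp only [glue, SimpleGraph.sup_adj, SimpleGraph.map_adj']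
  refine or_congr_right ⟨fun h => h.2, fun h' => ⟨?_, h'⟩⟩
  obtain ⟨i, j, hij, rfl, rfl⟩ := h'
  exact fun h' => hij.ne (h.root_injective h')

theorem comap_glue : (glue root K H).comap root = H := by
  ext i j
  rw [SimpleGraph.comap_adj, h.glue_adj]
  constructor
  · rintro (hK | ⟨i', j', hij, hi, hj⟩)
    · have := h.proj_adj _ _ hK
      rw [h.proj_root, h.proj_root] at this
      subst this
      exact absurd rfl hK.ne
    · rwa [← h.root_injective hi, ← h.root_injective hj]
  · exact fun hij => Or.inr ⟨i, j, hij, rfl, rfl⟩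

/-- The inclusion of the glued-in graph. -/
def rootEmb (H : SimpleGraph I) : H ↪g glue root K H where
  toFun := root
  inj' := h.root_injective
  map_rel_iff' := by
    intro i j
    conv_rhs => rw [← h.comap_glue (H := H)]
    rfl

theorem glue_adj_iff_of_proj_eq {x y : V} (hxy : p x = p y) :
    (glue root K H).Adj x y ↔ K.Adj x y := by
  rw [h.glue_adj, or_iff_left]
  rintro ⟨i, j, hij, rfl, rfl⟩
  rw [h.proj_root, h.proj_root] at hxy
  exact hij.ne hxy

theorem cutG_glue : cutG (glue root K H) (Set.range root) = K := by
  ext x y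
  constructor
  · rintro ⟨hxy, hS⟩
    obtain hK | ⟨i, j, hij, rfl, rfl⟩ := h.glue_adj.1 hxy
    · exact hK
    · exact absurd ⟨⟨i, rfl⟩, ⟨j, rfl⟩⟩ hS
  · refine fun hK => ⟨h.glue_adj.2 (Or.inl hK), ?_⟩
    rintro ⟨⟨i, rfl⟩, ⟨j, rfl⟩⟩
    have := h.proj_adj _ _ hK
    rw [h.proj_root, h.proj_root] at this
    subst this
    exact absurd rfl hK.ne

theorem connected_glue (hH : H.Connected) : (glue root K H).Connected := by
  have hroot : ∀ i j, (glue root K H).Reachable (root i) (root j) := fun i j =>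
    (hH.preconnected i j).map (h.rootEmb H).toHom
  have hx : ∀ x, (glue root K H).Reachable x (root (p x)) := fun x =>
    (h.reachable_root x).mono le_sup_left
  have : Nonempty V := hH.nonempty.map root
  exact ⟨fun x y => ((hx x).trans (hroot _ _)).trans (hx y).symm⟩

/-- The only way out of a fibre is through its root. -/
theorem proj_eq_of_reachIn {i : I} {x y : V} (hx : p x = i)
    (hxy : ReachIn (glue root K H) {z | z ≠ root i} x y) : p y = i := by
  induction hxy with
  | refl => exact hx
  | @tail b c _ hbc ih =>
    obtain hK | ⟨j, k, hjk, rfl, rfl⟩ := h.glue_adj.1 hbc.1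
    · rw [← h.proj_adj _ _ hK, ih]
    · rw [h.proj_root] at ih
      exact absurd (congrArg root ih) hbc.2.1

/-- The glued-in graph is a block: deleting its vertex `root i` cuts off the rest of the fibre over
`i`, so nothing in that fibre can be added to it. -/
theorem isBlockSet_range [Nontrivial I] (hH : Bic H Set.univ) :
    IsBlockSet (glue root K H) (Set.range root) := by
  refine ⟨?_, fun X hX hle x hx => ?_⟩
  · have := (bic_image_iff (h.rootEmb H)).2 hH
    rw [Set.image_univ] at this
    exact this
  · by_contra hxr
    obtain ⟨j, hj⟩ := exists_ne (p x)
    have hne : x ≠ root (p x) := fun h' => hxr ⟨_, h'.symm⟩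
    have hr := (hX.2.2 (root (p x))) x ⟨hx, hne⟩ (root j)
      ⟨hle ⟨j, rfl⟩, fun h' => hj (h.root_injective h')⟩
    refine hj ?_
    rw [← h.proj_eq_of_reachIn rfl (hr.mono le_rfl fun z hz => hz.2), h.proj_root]

/-- A block other than the glued-in one lies in a single fibre. -/
theorem exists_subset_fibre (hb : IsBlockSet (glue root K H) (Set.range root))
    {X : Set V} (hX : IsBlockSet (glue root K H) X) (hne : X ≠ Set.range root) :
    ∃ i, X ⊆ p ⁻¹' {i} := by
  obtain ⟨x, hx⟩ := hX.1.1
  refine ⟨p x, fun y hy => ?_⟩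
  have h1 : ReachIn K X y x := Relation.ReflTransGen.mono (fun a b hab => ⟨by
    rw [← h.cutG_glue (H := H)]
    exact ⟨hab.1, fun hS => hne (hX.eq_of_two_mem hb hab.1.ne hab.2.1 hab.2.2 hS.1 hS.2)⟩,
    hab.2⟩) _ _ (hX.1.2.1 y hy x hx)
  exact h.proj_reachable h1.reachable

/-- The inclusion of a fibre. -/
def fibreEmb (H : SimpleGraph I) (i : I) : K.induce (p ⁻¹' {i}) ↪g glue root K H where
  toFun := Subtype.val
  inj' := Subtype.val_injective
  map_rel_iff' := by
    intro x y
    have hx : p x = i := x.2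
    have hy : p y = i := y.2
    exact h.glue_adj_iff_of_proj_eq (hx.trans hy.symm)

theorem image_fibreEmb {i : I} {X : Set V} (hX : X ⊆ p ⁻¹' {i}) :
    h.fibreEmb H i '' (Subtype.val ⁻¹' X) = X :=
  (Subtype.image_preimage_coe _ _).trans (Set.inter_eq_right.2 hX)

variable [Finite V] [Finite I] {𝒢 : GraphClass}

theorem glue_mem (h𝒢 : 𝒢.IsBlockStable) (hH : H ∈ 𝒢.blockPart.graphs I)
    (hK : ∀ i, K.induce (p ⁻¹' {i}) ∈ 𝒢.graphs _) :
    glue root K H ∈ 𝒢.connectedPart.graphs V ∧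
      IsBlockSet (glue root K H) (Set.range root) := by
  obtain ⟨hbic, hnt⟩ := GraphClass.bic_of_mem_blockPart hH
  have hc := h.connected_glue hH.1.2
  have hne : Nonempty V := hc.nonempty
  have hb := h.isBlockSet_range hbic
  refine ⟨⟨h𝒢.mem_iff.2 fun X hX => ?_, hc⟩, hb⟩
  by_cases hXS : X = Set.range root
  · have hok : 𝒢.BlockOK H Set.univ := by
      refine Or.inl (𝒢.blockPart.iso_mem (G := H) ?_ hH)
      exact (SimpleGraph.induceUnivIso H).symm
    rw [hXS, ← Set.image_univ]
    exact (𝒢.blockOK_image_iff (h.rootEmb H)).2 hok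
  · obtain ⟨i, hi⟩ := h.exists_subset_fibre hb hX hXS
    have : Nonempty (p ⁻¹' {i}) := ⟨⟨root i, h.proj_root i⟩⟩
    rw [← h.image_fibreEmb (H := H) hi] at hX ⊢
    exact (𝒢.blockOK_image_iff _).2 (h𝒢.mem_iff.1 (hK i) _ hX.of_image)

/-- Every block of a fibre extends to a block of the glued graph, which lies in the same fibre. -/
theorem mem_of_glue_mem (h𝒢 : 𝒢.IsBlockStable) [Nontrivial I]
    (hG : glue root K H ∈ 𝒢.graphs V)
    (hb : IsBlockSet (glue root K H) (Set.range root)) :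
    H ∈ 𝒢.blockPart.graphs I ∧
      ∀ i, K.induce (p ⁻¹' {i}) ∈ 𝒢.connectedPart.graphs _ := by
  have hnI : Nonempty I := inferInstance
  have : Nonempty V := hnI.map root
  have hok := h𝒢.mem_iff.1 hG
  constructor
  · have h1 := hok _ hb
    rw [← Set.image_univ] at h1
    obtain h2 | h2 := (𝒢.blockOK_image_iff (h.rootEmb H)).1 h1
    · exact 𝒢.blockPart.iso_mem (SimpleGraph.induceUnivIso H) h2
    · rw [Nat.card_congr (Equiv.Set.univ I)] at h2
      have := Finite.one_lt_card (α := I)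
      omega
  · intro i
    have : Nonempty (p ⁻¹' {i}) := ⟨⟨root i, h.proj_root i⟩⟩
    refine ⟨h𝒢.mem_iff.2 fun A hA => ?_, ⟨connOn_iff.1 (h.conn i)⟩⟩
    by_cases hA1 : Nat.card A = 1
    · exact Or.inr hA1
    obtain ⟨X, hAX, hX⟩ := ((bic_image_iff (h.fibreEmb H i)).2 hA.1).exists_isBlockSet
    have hnt : A.Nontrivial := by
      by_contra hnt
      obtain ⟨a, ha⟩ := hA.1.1
      apply hA1
      rw [(Set.not_nontrivial_iff.1 hnt).eq_singleton_of_mem ha]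
      simp
    obtain ⟨a, ha, b, hbA, hab⟩ := hnt
    have hpa : p a = i := a.2
    have hpb : p b = i := b.2
    have haX : (a : V) ∈ X := hAX ⟨a, ha, rfl⟩
    have hbX : (b : V) ∈ X := hAX ⟨b, hbA, rfl⟩
    have hXS : X ≠ Set.range root := by
      rintro rfl
      obtain ⟨j, hj⟩ := haX
      obtain ⟨k, hk⟩ := hbX
      have h1 := h.proj_root j
      have h2 := h.proj_root k
      rw [hj, hpa] at h1
      rw [hk, hpb] at h2
      exact hab (Subtype.ext (by rw [← hj, ← hk, ← h1, ← h2]))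
    obtain ⟨j, hj⟩ := h.exists_subset_fibre hb hX hXS
    have hji : j = i := (hj haX).symm.trans hpa
    subst hji
    have hokX := hok X hX
    rw [← h.image_fibreEmb (H := H) hj] at hX hokX hAX
    rw [hA.eq_of_le hX.of_image.1 ((Set.image_subset_image_iff (h.fibreEmb H j).injective).1 hAX)]
    exact (𝒢.blockOK_image_iff _).1 hokX

end IsRooted

/-- Every connected graph arises from each of its blocks by gluing. -/
theorem exists_isRooted {G : SimpleGraph V} (hG : G.Connected) (hinj : Function.Injective root)
    (hb : IsBlockSet G (Set.range root)) :
    ∃ p : V → I, IsRooted p root (cutG G (Set.range root)) ∧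
      glue root (cutG G (Set.range root)) (G.comap root) = G := by
  have hgate : ∀ x, ∃ i, (cutG G (Set.range root)).Reachable x (root i) := fun x => by
    obtain ⟨_, ⟨i, rfl⟩, hi⟩ := exists_gate hG.preconnected hb.1.1 x
    exact ⟨i, hi⟩
  choose p hp using hgate
  have huniq : ∀ x i, (cutG G (Set.range root)).Reachable x (root i) → p x = i := fun x i hi =>
    hinj (hb.eq_of_reachable_cutG ⟨_, rfl⟩ ⟨_, rfl⟩ ((hp x).symm.trans hi))
  refine ⟨p, ⟨fun i => huniq _ _ (.refl _), fun x y hxy => huniq _ _ (hxy.reachable.trans (hp y)),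
    ?_⟩, ?_⟩
  · rintro _ x rfl y hy
    have hy : p y = p x := hy
    refine reachIn_of_reachable le_rfl (fun z hz => huniq _ _ (hz.symm.trans (hp x))) ?_
    refine (hp x).trans ?_
    rw [← hy]
    exact (hp y).symm
  · ext x y
    simp only [glue, SimpleGraph.sup_adj, SimpleGraph.map_adj', SimpleGraph.comap_adj]
    constructor
    · rintro (h | ⟨-, i, j, hij, rfl, rfl⟩)
      exacts [h.1, hij]
    · intro hxy
      by_cases hS : x ∈ Set.range root ∧ y ∈ Set.range root
      · obtain ⟨⟨i, rfl⟩, ⟨j, rfl⟩⟩ := hS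
        exact Or.inr ⟨hxy.ne, i, j, hxy, rfl, rfl⟩
      · exact Or.inl ⟨hxy, hS⟩

end Glue

/-! ### Counting graphs with a distinguished block -/

theorem Species.card_obj (F : Species) (U : Type) [Finite U] :
    Nat.card (F.obj U) = F.count (Nat.card U) := by
  let e : U ≃ Fin (Nat.card U) := Finite.equivFin U
  refine Nat.card_congr ⟨F.transport e, F.transport e.symm, fun a => ?_, fun a => ?_⟩
  · rw [← F.transport_trans, Equiv.self_trans_symm, F.transport_refl]
  · rw [← F.transport_trans, Equiv.symm_trans_self, F.transport_refl]

namespace GraphClass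

variable {V I : Type} [Finite V] {𝒢 : GraphClass}

/-- The graphs on `V` all of whose edges lie in fibres of `p`, with fibres in `𝒞`. -/
def FibreGraphs (𝒢 : GraphClass) (p : V → I) : Set (SimpleGraph V) :=
  {K | (∀ x y, K.Adj x y → p x = p y) ∧
    ∀ i, K.induce (p ⁻¹' {i}) ∈ 𝒢.connectedPart.graphs (p ⁻¹' {i})}

/-- The graphs in `𝒞` on `V` with an injection of `I` onto a block. -/
def BlockMarked (𝒢 : GraphClass) (V I : Type) [Finite V] : Set (SimpleGraph V × (I → V)) :=
  {q | q.1 ∈ 𝒢.connectedPart.graphs V ∧ Function.Injective q.2 ∧ IsBlockSet q.1 (Set.range q.2)}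

/-- A graph whose edges lie in the fibres of `p` amounts to a graph on each fibre. -/
def fibreGraphsEquiv (𝒢 : GraphClass) (p : V → I) :
    𝒢.FibreGraphs p ≃ ∀ i, 𝒢.C.obj (p ⁻¹' {i}) where
  toFun K i := ⟨K.1.induce (p ⁻¹' {i}), K.2.2 i⟩
  invFun L := ⟨{ Adj := fun x y => ∃ h : p x = p y, (L (p y)).1.Adj ⟨x, h⟩ ⟨y, rfl⟩
                 symm := ⟨by
                  rintro x y ⟨h, hxy⟩
                  refine ⟨h.symm, ?_⟩
                  have key : ∀ (i : I) (hx : p x = i) (hy : p y = i),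
                      (L i).1.Adj ⟨x, hx⟩ ⟨y, hy⟩ → ∀ (j : I) (hj : j = i),
                      (L j).1.Adj ⟨y, hy.trans hj.symm⟩ ⟨x, hx.trans hj.symm⟩ := by
                    rintro i hx hy hadj j rfl
                    exact hadj.symm
                  exact key _ h rfl hxy _ h⟩
                 loopless := ⟨by
                  rintro x ⟨_, hxx⟩
                  exact hxx.ne rfl⟩ }, by
    refine ⟨fun x y hxy => hxy.1, fun i => ?_⟩
    convert (L i).2
    ext ⟨x, hx⟩ ⟨y, hy⟩
    obtain rfl : p y = i := hy
    exact ⟨fun h => h.2, fun h => ⟨hx, h⟩⟩⟩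
  left_inv K := by
    apply Subtype.ext
    ext x y
    exact ⟨fun h => h.2, fun h => ⟨K.2.1 _ _ h, h⟩⟩
  right_inv L := by
    funext i
    apply Subtype.ext
    ext ⟨x, hx⟩ ⟨y, hy⟩
    obtain rfl : p y = i := hy
    exact ⟨fun h => h.2, fun h => ⟨hx, h⟩⟩

theorem isRooted {p : V → I} {root : I → V} {K : SimpleGraph V} (hr : ∀ i, p (root i) = i)
    (hK : K ∈ 𝒢.FibreGraphs p) : IsRooted p root K :=
  ⟨hr, hK.1, fun i => connOn_iff.2 (hK.2 i).2.preconnected⟩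

/-- Gluing: a map `p : V → I`, a root in each fibre, a graph of `𝒞` on each fibre and a graph of
`ℬ` on `I` give a graph of `𝒞` on `V` with an injection of `I` onto a block. -/
def glueMap [Finite I] (h𝒢 : 𝒢.IsBlockStable)
    (d : Σ p : V → I, (∀ i, {x // p x = i}) × 𝒢.FibreGraphs p × 𝒢.B.obj I) :
    𝒢.BlockMarked V I :=
  ⟨(glue (fun i => (d.2.1 i).1) d.2.2.1.1 d.2.2.2.1, fun i => (d.2.1 i).1), by
    have h := isRooted (fun i => (d.2.1 i).2) d.2.2.1.2
    have := h.glue_mem h𝒢 d.2.2.2.2 fun i => (d.2.2.1.2.2 i).1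
    exact ⟨this.1, h.root_injective, this.2⟩⟩

/-- Deleting the edges inside the marked block recovers the graphs on the fibres, and the fibres are
the components of what is left. -/
theorem glueMap_bijective [Finite I] (h𝒢 : 𝒢.IsBlockStable) [Nontrivial I] :
    Function.Bijective (glueMap (V := V) (I := I) h𝒢) := by
  constructor
  · rintro ⟨p, R, ⟨K, hK⟩, ⟨H, hH⟩⟩ ⟨p', R', ⟨K', hK'⟩, ⟨H', hH'⟩⟩ heq
    have h := isRooted (fun i => (R i).2) hK
    have h' := isRooted (fun i => (R' i).2) hK'
    have heq' := congrArg Subtype.val heq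
    simp only [glueMap, Prod.mk.injEq] at heq'
    obtain ⟨hG, hroot⟩ := heq'
    have hKK : K = K' := by
      rw [← h.cutG_glue (H := H), ← h'.cutG_glue (H := H'), hG, hroot]
    have hHH : H = H' := by
      rw [← h.comap_glue (H := H), ← h'.comap_glue (H := H'), hG, hroot]
    subst hKK hHH
    obtain rfl : p = p' := by
      funext x
      have h1 := h'.proj_reachable (h.reachable_root x)
      have h2 := congrFun hroot (p x)
      change (R (p x)).1 = (R' (p x)).1 at h2
      rw [h2, h'.proj_root] at h1
      exact h1.symm
    obtain rfl : R = R' := by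
      funext i
      exact Subtype.ext (congrFun hroot i)
    rfl
  · rintro ⟨⟨G, root⟩, hG, hinj, hb⟩
    obtain ⟨p, hp, hglue⟩ := exists_isRooted hG.2 hinj hb
    have hmem := hp.mem_of_glue_mem (H := G.comap root) (𝒢 := 𝒢) h𝒢
      (by rw [hglue]; exact hG.1) (by rw [hglue]; exact hb)
    exact ⟨⟨p, fun i => ⟨root i, hp.proj_root i⟩, ⟨_, hp.proj_adj, hmem.2⟩, ⟨_, hmem.1⟩⟩,
      Subtype.ext (Prod.ext hglue rfl)⟩

theorem card_blockMarked (h𝒢 : 𝒢.IsBlockStable) [Nontrivial I] [Fintype V] [Fintype I]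
    [DecidableEq V] [DecidableEq I] :
    Nat.card (𝒢.BlockMarked V I) = (∑ p : V → I, ∏ i,
      (Nat.card (p ⁻¹' {i}) * 𝒢.C.count (Nat.card (p ⁻¹' {i})))) *
        𝒢.B.count (Nat.card I) := by
  have : Finite (𝒢.B.obj I) := 𝒢.B.finite_obj I
  rw [← Nat.card_congr (Equiv.ofBijective _ (glueMap_bijective (V := V) (I := I) h𝒢)),
    Nat.card_sigma, Finset.sum_mul]
  refine Finset.sum_congr rfl fun p _ => ?_
  rw [Nat.card_prod, Nat.card_prod, Species.card_obj, Nat.card_pi,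
    Nat.card_congr (𝒢.fibreGraphsEquiv p), Nat.card_pi, ← mul_assoc, ← Finset.prod_mul_distrib]
  congr 1
  refine Finset.prod_congr rfl fun i _ => ?_
  rw [Species.card_obj]
  rfl

open Classical in
/-- Marking a block by a bijection with `I` multiplies the number of possibilities by `|I|!`. -/
theorem card_blockMarked_eq [Fintype V] [Fintype I] :
    Nat.card (𝒢.BlockMarked V I) = (Fintype.card I)! *
      ∑ G : SimpleGraph V with G ∈ 𝒢.connectedPart.graphs V,
        (Finset.univ.filter fun S : Set V => IsBlockSet G S ∧ S.ncard = Fintype.card I).card := by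
  have hrange : ∀ (S : Set V) (e : I ≃ S), Set.range (fun i => (e i).1) = S := by
    intro S e
    ext x
    refine ⟨?_, fun hx => ⟨e.symm ⟨x, hx⟩, by simp⟩⟩
    rintro ⟨i, rfl⟩
    exact (e i).2
  let f : (Σ q : (Σ G : 𝒢.C.obj V, {S : Set V // IsBlockSet G.1 S}), I ≃ q.2.1) →
      𝒢.BlockMarked V I := fun s => ⟨(s.1.1.1, fun i => (s.2 i).1), s.1.1.2,
        Subtype.val_injective.comp s.2.injective, by
          simp only
          rw [hrange]
          exact s.1.2.2⟩
  have hf : Function.Bijective f := by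
    constructor
    · rintro ⟨⟨G, S, hS⟩, e⟩ ⟨⟨G', S', hS'⟩, e'⟩ heq
      have heq' := congrArg Subtype.val heq
      simp only [f, Prod.mk.injEq] at heq'
      obtain ⟨h1, h2⟩ := heq'
      obtain rfl : G = G' := Subtype.ext h1
      obtain rfl : S = S' := by rw [← hrange S e, ← hrange S' e', h2]
      obtain rfl : e = e' := Equiv.ext fun i => Subtype.ext (congrFun h2 i)
      rfl
    · rintro ⟨⟨G, root⟩, hG, hinj, hb⟩
      exact ⟨⟨⟨⟨G, hG⟩, ⟨_, hb⟩⟩, Equiv.ofInjective _ hinj⟩, rfl⟩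
  have hfin : Finite (𝒢.C.obj V) := 𝒢.C.finite_obj V
  have : Fintype (𝒢.C.obj V) := Fintype.ofFinite _
  rw [← Nat.card_congr (Equiv.ofBijective f hf), Nat.card_sigma, Fintype.sum_sigma, Finset.mul_sum]
  have hsub : ∀ f : SimpleGraph V → ℕ, ∑ G : 𝒢.C.obj V, f G.1 =
      ∑ G : SimpleGraph V with G ∈ 𝒢.connectedPart.graphs V, f G := fun f => by
    exact (Finset.sum_subtype _ (p := fun G => G ∈ 𝒢.connectedPart.graphs V)
      (fun G => by simp) f).symm
  rw [← hsub]
  refine Finset.sum_congr rfl fun G _ => ?_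
  rw [Finset.card_filter, Finset.mul_sum]
  rw [← Finset.sum_subtype (Finset.univ.filter (IsBlockSet G.1)) (fun S => by simp)
    (fun S => Nat.card (I ≃ S)), Finset.sum_filter]
  refine Finset.sum_congr rfl fun S _ => ?_
  by_cases hS : IsBlockSet G.1 S
  · simp only [hS, if_true, true_and]
    split_ifs with hc
    · have hcard : Nat.card I = Nat.card S := by
        rw [Nat.card_eq_fintype_card, ← hc, Nat.card_coe_set_eq]
      have : Fintype S := Fintype.ofFinite _
      obtain ⟨e⟩ : Nonempty (I ≃ S) := Fintype.card_eq.1 (by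
        rw [← Nat.card_eq_fintype_card, hcard, Nat.card_eq_fintype_card])
      rw [Nat.card_congr (Equiv.equivCongr (Equiv.refl I) e.symm), Nat.card_perm,
        Nat.card_eq_fintype_card, mul_one]
    · have : IsEmpty (I ≃ S) := ⟨fun e => hc (by
        rw [← Nat.card_eq_fintype_card, Nat.card_congr e, Nat.card_coe_set_eq])⟩
      simp
  · simp [hS]

open Classical in
/-- The block sum identity, summed over all graphs of `𝒞` and sorted by block size `m`. -/
theorem card_sub_one_mul_count (V : Type) [Fintype V] :
    (Fintype.card V - 1) * 𝒢.C.count (Fintype.card V) =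
      ∑ m ∈ Finset.range (Fintype.card V + 1), (m - 1) *
        ∑ G : SimpleGraph V with G ∈ 𝒢.connectedPart.graphs V,
          (Finset.univ.filter fun S : Set V => IsBlockSet G S ∧ S.ncard = m).card := by
  have h1 : (Fintype.card V - 1) * 𝒢.C.count (Fintype.card V) =
      ∑ G : SimpleGraph V with G ∈ 𝒢.connectedPart.graphs V, (Fintype.card V - 1) := by
    rw [Finset.sum_const, smul_eq_mul, mul_comm, ← Nat.card_eq_fintype_card (α := V),
      ← Species.card_obj]
    congr 1
    exact (Nat.card_eq_fintype_card (α := {G // G ∈ 𝒢.connectedPart.graphs V})).trans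
      (Fintype.card_subtype _)
  simp_rw [Finset.mul_sum]
  rw [h1, Finset.sum_comm]
  refine Finset.sum_congr rfl fun G hG => ?_
  have hc : G.Connected := ((Finset.mem_filter.1 hG).2).2
  rw [← sum_isBlockSet hc, ← Finset.sum_fiberwise_of_maps_to (g := fun S : Set V => S.ncard)
    (t := Finset.range (Fintype.card V + 1))]
  · refine Finset.sum_congr rfl fun m _ => ?_
    rw [Finset.filter_filter, Finset.sum_congr rfl (g := fun _ => m - 1), Finset.sum_const,
      smul_eq_mul, mul_comm]
    intro S hS
    rw [((Finset.mem_filter.1 hS).2).2]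
  · intro S _
    rw [Finset.mem_range, ← Nat.card_eq_fintype_card]
    exact Nat.lt_succ_of_le (Set.ncard_le_card S)

end GraphClass

/-! ### Products of exponential generating series -/

/-- The exponential generating series of `a : ℕ → ℝ`. -/
noncomputable def egs (a : ℕ → ℝ) : PowerSeries ℝ := PowerSeries.mk fun n => a n / n !

theorem coeff_egs (a : ℕ → ℝ) (n : ℕ) : PowerSeries.coeff n (egs a) = a n / n ! :=
  PowerSeries.coeff_mk _ _

theorem derivative_egs (a : ℕ → ℝ) :
    PowerSeries.derivative ℝ (egs a) = egs fun n => a (n + 1) := by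
  ext n
  rw [PowerSeries.coeff_derivative, coeff_egs, coeff_egs, Nat.factorial_succ]
  push_cast
  have : (n : ℝ) + 1 ≠ 0 := by positivity
  field_simp

theorem derivative_prod {I : Type} [DecidableEq I] (s : Finset I) (f : I → PowerSeries ℝ) :
    PowerSeries.derivative ℝ (∏ i ∈ s, f i)
      = ∑ j ∈ s, ∏ i ∈ s, Function.update f j (PowerSeries.derivative ℝ (f j)) i := by
  induction s using Finset.induction_on with
  | empty => simp
  | insert k s hk ih =>
    rw [Finset.prod_insert hk, Derivation.leibniz, ih, Finset.sum_insert hk, Finset.prod_insert hk,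
      Function.update_self, add_comm, smul_eq_mul, smul_eq_mul, Finset.mul_sum]
    congr 1
    · rw [mul_comm]
      congr 1
      exact Finset.prod_congr rfl fun i hi => by
        rw [Function.update_of_ne (ne_of_mem_of_not_mem hi hk)]
    · refine Finset.sum_congr rfl fun j hj => ?_
      rw [Finset.prod_insert hk, Function.update_of_ne (ne_of_mem_of_not_mem hj hk).symm]

/-- Families of structures on the fibres of a map to `I` are counted by the product of the
exponential generating series. Removing one label differentiates one of the factors. -/
theorem sum_prod_fibres {I : Type} [Fintype I] [DecidableEq I] (n : ℕ) (a : I → ℕ → ℝ) :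
    ∑ p : Fin n → I, ∏ i, a i (Finset.univ.filter fun x => p x = i).card
      = n ! * PowerSeries.coeff n (∏ i, egs (a i)) := by
  induction n generalizing a with
  | zero =>
    simp [coeff_egs, map_prod, ← PowerSeries.coeff_zero_eq_constantCoeff_apply]
  | succ n ih =>
    have h1 : ((n + 1)! : ℝ) * PowerSeries.coeff (n + 1) (∏ i, egs (a i))
        = n ! * PowerSeries.coeff n (PowerSeries.derivative ℝ (∏ i, egs (a i))) := by
      rw [PowerSeries.coeff_derivative, Nat.factorial_succ]
      push_cast
      ring
    rw [h1, derivative_prod, map_sum, Finset.mul_sum, ← (Fin.consEquiv fun _ => I).sum_comp,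
      Fintype.sum_prod_type]
    refine Finset.sum_congr rfl fun j _ => ?_
    have h2 : ∀ i, Function.update (fun i => egs (a i)) j
        (PowerSeries.derivative ℝ (egs (a j))) i
        = egs (Function.update a j (fun k => a j (k + 1)) i) := by
      intro i
      by_cases hi : i = j
      · subst hi
        simp [derivative_egs]
      · simp [hi]
    rw [Finset.prod_congr rfl fun i _ => h2 i, ← ih]
    refine Finset.sum_congr rfl fun q _ => Finset.prod_congr rfl fun i _ => ?_
    rw [Fin.card_filter_univ_succ]
    by_cases hi : i = j
    · subst hi
      simp [Fin.consEquiv]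
    · simp [Fin.consEquiv, hi, Ne.symm hi]

namespace GraphClass

variable {𝒢 : GraphClass}

/-- The series `C(z)`, with real coefficients. -/
noncomputable def serC (𝒢 : GraphClass) : PowerSeries ℝ := egs fun n => 𝒢.C.count n

/-- The series `C^•(z)`, with real coefficients. -/
noncomputable def serT (𝒢 : GraphClass) : PowerSeries ℝ := egs fun n => n * 𝒢.C.count n

/-- The series `B(z)`, with real coefficients. -/
noncomputable def serB (𝒢 : GraphClass) : PowerSeries ℝ := egs fun n => 𝒢.B.count n

theorem card_blockMarked_fin (h𝒢 : 𝒢.IsBlockStable) (n m : ℕ) (hm : 2 ≤ m) :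
    (Nat.card (𝒢.BlockMarked (Fin n) (Fin m)) : ℝ)
      = n ! * PowerSeries.coeff n (𝒢.serT ^ m) * 𝒢.B.count m := by
  have : Nontrivial (Fin m) := Fin.nontrivial_iff_two_le.2 hm
  have h := sum_prod_fibres (I := Fin m) n fun _ k => (k : ℝ) * 𝒢.C.count k
  rw [Finset.prod_const, Finset.card_univ, Fintype.card_fin] at h
  rw [serT, ← h, card_blockMarked h𝒢, Nat.card_eq_fintype_card, Fintype.card_fin]
  push_cast
  congr 1
  refine Finset.sum_congr rfl fun p _ => Finset.prod_congr rfl fun i _ => ?_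
  have : Nat.card (p ⁻¹' {i}) = (Finset.univ.filter fun x => p x = i).card := by
    rw [Nat.card_coe_set_eq, ← Set.ncard_coe_finset]
    congr 1
    ext x
    simp
  rw [this]

/-- Counting pairs of a graph and one of its blocks `b`, weighted by `|b| - 1`, in two ways. -/
theorem sub_one_mul_count (h𝒢 : 𝒢.IsBlockStable) (n : ℕ) :
    ((n - 1 : ℕ) : ℝ) * 𝒢.C.count n / n ! = ∑ m ∈ Finset.range (n + 1),
      ((m - 1 : ℕ) : ℝ) * (𝒢.B.count m / m !) * PowerSeries.coeff n (𝒢.serT ^ m) := by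
  classical
  have h := card_sub_one_mul_count (𝒢 := 𝒢) (Fin n)
  rw [Fintype.card_fin] at h
  rw [← Nat.cast_mul, h, Nat.cast_sum, Finset.sum_div]
  refine Finset.sum_congr rfl fun m _ => ?_
  by_cases hm : 2 ≤ m
  · have h1 := card_blockMarked_fin h𝒢 n m hm
    rw [card_blockMarked_eq, Fintype.card_fin] at h1
    have hm0 : (m ! : ℝ) ≠ 0 := by positivity
    have hn0 : (n ! : ℝ) ≠ 0 := by positivity
    push_cast at h1 ⊢
    field_simp
    linear_combination ((m - 1 : ℕ) : ℝ) * h1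
  · have : m - 1 = 0 := by omega
    simp [this]

end GraphClass

/-! ### The functional equation -/

open PowerSeries in
theorem coeff_pow_eq_zero {T : PowerSeries ℝ} (hT : constantCoeff T = 0) {n m : ℕ} (h : n < m) :
    coeff n (T ^ m) = 0 :=
  coeff_of_lt_order n (lt_of_lt_of_le (by exact_mod_cast h)
    (le_order_pow_of_constantCoeff_eq_zero m hT))

open PowerSeries in
/-- If `T` has no constant term, coefficients of `F(T)` are finite sums. -/
theorem coeff_subst_eq_sum {F T : PowerSeries ℝ} (hT : constantCoeff T = 0) (n N : ℕ)
    (hN : n < N) :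
    coeff n (F.subst T) = ∑ m ∈ Finset.range N, coeff m F * coeff n (T ^ m) := by
  rw [coeff_subst' (HasSubst.of_constantCoeff_zero' hT),
    finsum_eq_sum_of_support_subset (s := Finset.range N)]
  · simp
  · intro m hm
    by_contra hmN
    apply hm
    have hmN : N ≤ m := by simpa using hmN
    dsimp only
    rw [coeff_pow_eq_zero hT (hN.trans_le hmN), smul_zero]

/-- The power series `exp(b(z))`, for a power series `b` without constant term. -/
noncomputable def expOf (b : PowerSeries ℝ) : PowerSeries ℝ := (PowerSeries.exp ℝ).subst b

theorem derivative_expOf {b : PowerSeries ℝ} (hb0 : PowerSeries.constantCoeff b = 0) :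
    PowerSeries.derivative ℝ (expOf b) = PowerSeries.derivative ℝ b * expOf b := by
  rw [expOf, PowerSeries.derivative_subst (.of_constantCoeff_zero' hb0),
    PowerSeries.derivative_exp, mul_comm]

theorem constantCoeff_expOf {b : PowerSeries ℝ} (hb0 : PowerSeries.constantCoeff b = 0) :
    PowerSeries.constantCoeff (expOf b) = 1 := by
  rw [← PowerSeries.coeff_zero_eq_constantCoeff_apply, expOf, coeff_subst_eq_sum hb0 0 1 one_pos]
  simp

namespace GraphClass

open PowerSeries

variable {𝒢 : GraphClass}

theorem count_C_zero : 𝒢.C.count 0 = 0 := by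
  rw [Species.count, Nat.card_eq_zero]
  exact Or.inl ⟨fun G => G.2.2.nonempty.elim fun x => x.elim0⟩

theorem count_C_one (h𝒢 : 𝒢.IsBlockStable) : 𝒢.C.count 1 = 1 := by
  rw [Species.count, Nat.card_eq_one_iff_unique]
  refine ⟨⟨fun G G' => Subtype.ext (Subsingleton.elim _ _)⟩, ⟨⟨⊥, h𝒢.mem_iff.2 fun S hS => ?_, ?_⟩⟩⟩
  · obtain ⟨x, hx⟩ := hS.1.1
    refine Or.inr ?_
    rw [Nat.card_eq_one_iff_unique]
    exact ⟨inferInstance, ⟨⟨x, hx⟩⟩⟩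
  · exact SimpleGraph.connected_bot_iff.2 ⟨inferInstance, inferInstance⟩

theorem count_B_of_lt_two {n : ℕ} (hn : n < 2) : 𝒢.B.count n = 0 := by
  rw [Species.count, Nat.card_eq_zero]
  refine Or.inl ⟨fun G => ?_⟩
  have := (bic_of_mem_blockPart G.2).2
  rw [Fin.nontrivial_iff_two_le] at this
  omega

/-- The series `B'(z)`, with real coefficients. -/
noncomputable def serDB (𝒢 : GraphClass) : PowerSeries ℝ := egs fun n => 𝒢.B.count (n + 1)

/-- The series `exp(B'(z))`. -/
noncomputable def serE (𝒢 : GraphClass) : PowerSeries ℝ := expOf 𝒢.serDB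

theorem constantCoeff_serT : constantCoeff 𝒢.serT = 0 := by
  rw [← coeff_zero_eq_constantCoeff_apply, serT, coeff_egs]
  simp

theorem constantCoeff_serDB : constantCoeff 𝒢.serDB = 0 := by
  rw [← coeff_zero_eq_constantCoeff_apply, serDB, coeff_egs, count_B_of_lt_two (by norm_num)]
  simp

theorem hasSubst_serT : HasSubst 𝒢.serT := .of_constantCoeff_zero' constantCoeff_serT

theorem derivative_serB : derivative ℝ 𝒢.serB = 𝒢.serDB := derivative_egs _

theorem serT_eq : 𝒢.serT = X * derivative ℝ 𝒢.serC := by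
  ext n
  cases n with
  | zero => simp [constantCoeff_serT]
  | succ n =>
    rw [coeff_succ_X_mul, serC, derivative_egs, serT, coeff_egs, coeff_egs, Nat.factorial_succ]
    push_cast
    have : (n : ℝ) + 1 ≠ 0 := by positivity
    field_simp

/-- The equation `C^• - C = (z B' - B)(C^•)`. -/
theorem serT_sub_serC (h𝒢 : 𝒢.IsBlockStable) :
    𝒢.serT - 𝒢.serC = (X * 𝒢.serDB - 𝒢.serB).subst 𝒢.serT := by
  ext n
  rw [coeff_subst_eq_sum constantCoeff_serT n (n + 1) n.lt_succ_self]
  have h1 : coeff n (𝒢.serT - 𝒢.serC) = ((n - 1 : ℕ) : ℝ) * 𝒢.C.count n / n ! := by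
    rw [map_sub, serT, serC, coeff_egs, coeff_egs]
    rcases n with _ | n
    · simp [count_C_zero]
    · push_cast [Nat.add_sub_cancel]
      ring
  have h2 : ∀ m, coeff m (X * 𝒢.serDB - 𝒢.serB) = ((m - 1 : ℕ) : ℝ) * (𝒢.B.count m / m !) := by
    intro m
    rw [map_sub, serB, coeff_egs]
    rcases m with _ | m
    · simp [count_B_of_lt_two]
    · rw [coeff_succ_X_mul, serDB, coeff_egs, Nat.factorial_succ]
      push_cast [Nat.add_sub_cancel]
      have : (m : ℝ) + 1 ≠ 0 := by positivity
      field_simp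
      ring
  rw [h1, sub_one_mul_count h𝒢]
  exact Finset.sum_congr rfl fun m _ => by rw [h2]

/-- The equation `C'' = (B'(C^•))' C'`. -/
theorem derivative_derivative_serC (h𝒢 : 𝒢.IsBlockStable) :
    derivative ℝ (derivative ℝ 𝒢.serC)
      = derivative ℝ (𝒢.serDB.subst 𝒢.serT) * derivative ℝ 𝒢.serC := by
  have h := congrArg (derivative ℝ) (serT_sub_serC h𝒢)
  rw [derivative_subst hasSubst_serT, map_sub, map_sub, Derivation.leibniz, derivative_serB] at h
  simp only [smul_eq_mul, derivative_X, mul_one, add_sub_cancel_right] at h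
  rw [subst_mul hasSubst_serT, subst_X hasSubst_serT] at h
  have h2 : derivative ℝ 𝒢.serT
      = X * derivative ℝ (derivative ℝ 𝒢.serC) + derivative ℝ 𝒢.serC := by
    conv_lhs => rw [serT_eq]
    rw [Derivation.leibniz, derivative_X]
    simp
  rw [derivative_subst hasSubst_serT]
  apply mul_left_cancel₀ (X_ne_zero : (X : PowerSeries ℝ) ≠ 0)
  have h3 : X * derivative ℝ (derivative ℝ 𝒢.serC)
      = derivative ℝ 𝒢.serT - derivative ℝ 𝒢.serC := by rw [h2]; ring
  rw [h3, h]
  linear_combination (subst 𝒢.serT (derivative ℝ 𝒢.serDB) * derivative ℝ 𝒢.serT) *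
    serT_eq (𝒢 := 𝒢)

/-- The equation `C'(z) = exp(B'(C^•(z)))`. -/
theorem derivative_serC (h𝒢 : 𝒢.IsBlockStable) :
    derivative ℝ 𝒢.serC = 𝒢.serE.subst 𝒢.serT := by
  set Y := derivative ℝ 𝒢.serC with hY
  set Z := 𝒢.serE.subst 𝒢.serT with hZ
  have hZ' : derivative ℝ Z = derivative ℝ (𝒢.serDB.subst 𝒢.serT) * Z := by
    rw [hZ, derivative_subst hasSubst_serT, serE, derivative_expOf constantCoeff_serDB,
      subst_mul hasSubst_serT, derivative_subst hasSubst_serT]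
    ring
  have hZ0 : constantCoeff Z = 1 := by
    rw [← coeff_zero_eq_constantCoeff_apply, hZ,
      coeff_subst_eq_sum constantCoeff_serT 0 1 one_pos]
    simp [serE, constantCoeff_expOf constantCoeff_serDB]
  have hY0 : constantCoeff Y = 1 := by
    rw [← coeff_zero_eq_constantCoeff_apply, hY, serC, derivative_egs, coeff_egs]
    simp [count_C_one h𝒢]
  have hZne : constantCoeff Z ≠ 0 := by rw [hZ0]; exact one_ne_zero
  -- Both sides solve the same linear differential equation, so their quotient is constant.
  have hquot : Y * Z⁻¹ = 1 := by
    apply derivative.ext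
    · rw [Derivation.leibniz, derivative_inv', derivative_derivative_serC h𝒢, hZ', smul_eq_mul,
        smul_eq_mul, derivative_one]
      have h1 : Z⁻¹ ^ 2 * (derivative ℝ (𝒢.serDB.subst 𝒢.serT) * Z)
          = Z⁻¹ * derivative ℝ (𝒢.serDB.subst 𝒢.serT) * (Z * Z⁻¹) := by ring
      rw [neg_mul, h1, PowerSeries.mul_inv_cancel _ hZne]
      ring
    · simp [hY0, hZ0]
  rw [← mul_one Y, ← PowerSeries.mul_inv_cancel _ hZne, mul_comm Z, ← mul_assoc, hquot, one_mul]

/-- The equation `C^•(z) = z exp(B'(C^•(z)))`. -/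
theorem serT_functional_equation (h𝒢 : 𝒢.IsBlockStable) :
    𝒢.serT = X * 𝒢.serE.subst 𝒢.serT := by
  rw [← derivative_serC h𝒢, ← serT_eq]

end GraphClass

/-! ### Lagrange inversion -/

section Lagrange

open PowerSeries

/-- As `w Φ^n Φ'` is `w (Φ^(n+1))' / (n + 1)`, its coefficient of `w^(n+1)` is that of
`Φ^(n+1)`. -/
theorem coeff_pow_sub_derivative (Φ : PowerSeries ℝ) (n : ℕ) :
    coeff (n + 1) (Φ ^ (n + 1) - X * (Φ ^ n * derivative ℝ Φ)) = 0 := by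
  have h := coeff_derivative (R := ℝ) (Φ ^ (n + 1)) n
  rw [derivative_pow, Nat.add_sub_cancel] at h
  rw [map_sub, coeff_succ_X_mul]
  have h2 : (((n + 1 : ℕ) : PowerSeries ℝ) * Φ ^ n * derivative ℝ Φ)
      = C ((n : ℝ) + 1) * (Φ ^ n * derivative ℝ Φ) := by
    rw [map_add, map_natCast, map_one]
    push_cast
    ring
  rw [h2, coeff_C_mul] at h
  have : (n : ℝ) + 1 ≠ 0 := by positivity
  have h3 : ((n : ℝ) + 1) * (coeff n (Φ ^ n * derivative ℝ Φ) - coeff (n + 1) (Φ ^ (n + 1))) = 0 := by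
    rw [mul_sub, h]
    ring
  rcases mul_eq_zero.1 h3 with h | h
  · exact absurd h this
  · linarith

/-- Lagrange inversion in the form `[zⁿ] H(T) = [wⁿ] H Φⁿ (1 - w Φ' / Φ)`, for `T = z Φ(T)`.
Both sides vanish for constants when `n > 0`, and replacing `H = w K` by `K Φ` lowers `n` by
one on either side. -/
theorem coeff_subst_of_eq {Φ T : PowerSeries ℝ} (hT : T = X * Φ.subst T) (n : ℕ)
    (H : PowerSeries ℝ) :
    coeff (n + 1) (H.subst T)
      = coeff (n + 1) (H * (Φ ^ (n + 1) - X * (Φ ^ n * derivative ℝ Φ))) := by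
  have hT0 : constantCoeff T = 0 := by rw [hT]; simp
  have hs : HasSubst T := .of_constantCoeff_zero' hT0
  have hshift : ∀ (c : ℝ) (K : PowerSeries ℝ) (k : ℕ),
      coeff (k + 1) ((C c + X * K).subst T) = coeff k ((Φ * K).subst T) := by
    intro c K k
    rw [subst_add hs, subst_mul hs, subst_X hs, subst_mul hs, map_add]
    have h1 : coeff (k + 1) ((C c : PowerSeries ℝ).subst T) = 0 := by
      rw [coeff_subst_eq_sum hT0 (k + 1) (k + 2) (by omega), Finset.sum_eq_single 0]
      · simp
      · intro m _ hm
        simp [coeff_C, hm]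
      · simp
    have h2 : T * K.subst T = X * (Φ.subst T * K.subst T) :=
      (congrArg (fun F : PowerSeries ℝ => F * (K.subst T : PowerSeries ℝ)) hT).trans
        (mul_assoc X _ _)
    rw [h1, zero_add, h2]
    exact coeff_succ_X_mul _ _
  induction n generalizing H with
  | zero =>
    obtain ⟨K, c, rfl⟩ : ∃ K c, H = C c + X * K := ⟨_, _, by
      rw [add_comm]; exact eq_X_mul_shift_add_const H⟩
    rw [hshift, coeff_subst_eq_sum hT0 0 1 one_pos, add_mul, map_add, coeff_C_mul,
      coeff_pow_sub_derivative, mul_zero, zero_add, mul_assoc]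
    have : coeff (0 + 1) (X * (K * (Φ ^ (0 + 1) - X * (Φ ^ 0 * derivative ℝ Φ))))
      = coeff 0 (K * (Φ ^ (0 + 1) - X * (Φ ^ 0 * derivative ℝ Φ))) := coeff_succ_X_mul 0 _
    rw [this]
    simp
    ring
  | succ n ih =>
    obtain ⟨K, c, rfl⟩ : ∃ K c, H = C c + X * K := ⟨_, _, by
      rw [add_comm]; exact eq_X_mul_shift_add_const H⟩
    rw [hshift, ih, add_mul, map_add, coeff_C_mul, coeff_pow_sub_derivative, mul_zero, zero_add,
      mul_assoc X, coeff_succ_X_mul]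
    congr 1
    ring

/-- Lagrange inversion: if `T = z Φ(T)`, then `n [zⁿ] T = [wⁿ⁻¹] Φⁿ`. -/
theorem lagrange_inversion {Φ T : PowerSeries ℝ} (hT : T = X * Φ.subst T) (n : ℕ) :
    ((n : ℝ) + 1) * coeff (n + 1) T = coeff n (Φ ^ (n + 1)) := by
  have hT0 : constantCoeff T = 0 := by rw [hT]; simp
  have h := coeff_subst_of_eq hT n X
  rw [subst_X (.of_constantCoeff_zero' hT0)] at h
  have h' : coeff (n + 1) T = coeff n (Φ ^ (n + 1) - X * (Φ ^ n * derivative ℝ Φ)) := by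
    rw [h, coeff_succ_X_mul]
  rw [h']
  have hd := coeff_pow_sub_derivative Φ n
  rcases n with _ | n
  · simp
  · have hd2 := coeff_derivative (R := ℝ) (Φ ^ (n + 1 + 1)) n
    rw [derivative_pow, Nat.add_sub_cancel] at hd2
    have h2 : (((n + 1 + 1 : ℕ) : PowerSeries ℝ) * Φ ^ (n + 1) * derivative ℝ Φ)
        = C ((n : ℝ) + 2) * (Φ ^ (n + 1) * derivative ℝ Φ) := by
      rw [map_add, map_natCast, map_ofNat]
      push_cast
      ring
    rw [h2, coeff_C_mul] at hd2
    rw [map_sub, coeff_succ_X_mul]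
    push_cast
    linarith

end Lagrange

/-! ### Evaluating series with nonnegative coefficients in `[0, ∞]` -/

section Evaluation

open PowerSeries

variable {F G T b : PowerSeries ℝ} {x : ℝ≥0∞}

/-- The coefficients of `F` are nonnegative. -/
def Nonneg (F : PowerSeries ℝ) : Prop := ∀ n, 0 ≤ coeff n F

/-- The value in `[0, ∞]` at `x` of a series with nonnegative coefficients. -/
noncomputable def evE (F : PowerSeries ℝ) (x : ℝ≥0∞) : ℝ≥0∞ :=
  ∑' n, ENNReal.ofReal (coeff n F) * x ^ n

/-- The truncation of `evE F x` to terms of degree less than `N`. -/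
noncomputable def evTrunc (N : ℕ) (F : PowerSeries ℝ) (x : ℝ≥0∞) : ℝ≥0∞ :=
  ∑ n ∈ Finset.range N, ENNReal.ofReal (coeff n F) * x ^ n

theorem Nonneg.mul (hF : Nonneg F) (hG : Nonneg G) : Nonneg (F * G) := fun n => by
  rw [coeff_mul]
  exact Finset.sum_nonneg fun p _ => mul_nonneg (hF _) (hG _)

theorem Nonneg.one : Nonneg 1 := fun n => by
  rw [coeff_one]
  split_ifs <;> norm_num

theorem Nonneg.pow (hF : Nonneg F) (k : ℕ) : Nonneg (F ^ k) := by
  induction k with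
  | zero => rw [pow_zero]; exact .one
  | succ k ih => rw [pow_succ]; exact ih.mul hF

theorem Nonneg.subst (hF : Nonneg F) (hT : Nonneg T) (hT0 : constantCoeff T = 0) :
    Nonneg (F.subst T) := fun n => by
  rw [coeff_subst_eq_sum hT0 n (n + 1) n.lt_succ_self]
  exact Finset.sum_nonneg fun m _ => mul_nonneg (hF _) ((hT.pow m) _)

theorem Nonneg.exp : Nonneg (PowerSeries.exp ℝ) := fun n => by
  rw [coeff_exp]
  simp

theorem Nonneg.egs {a : ℕ → ℝ} (h : ∀ n, 0 ≤ a n) : Nonneg (egs a) := fun n => by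
  rw [coeff_egs]
  exact div_nonneg (h n) (by positivity)

theorem evE_mono {x' : ℝ≥0∞} (h : x ≤ x') : evE F x ≤ evE F x' :=
  ENNReal.tsum_le_tsum fun _ => by gcongr

theorem evTrunc_le_evE (N : ℕ) : evTrunc N F x ≤ evE F x := ENNReal.sum_le_tsum _

theorem evE_le_of_evTrunc_le {c : ℝ≥0∞} (h : ∀ N, evTrunc N F x ≤ c) : evE F x ≤ c := by
  rw [evE, ENNReal.tsum_eq_iSup_nat]
  exact iSup_le h

theorem ofReal_coeff_mul (hF : Nonneg F) (hG : Nonneg G) (n : ℕ) :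
    ENNReal.ofReal (coeff n (F * G)) * x ^ n = ∑ p ∈ Finset.HasAntidiagonal.antidiagonal n,
      (ENNReal.ofReal (coeff p.1 F) * x ^ p.1) * (ENNReal.ofReal (coeff p.2 G) * x ^ p.2) := by
  rw [coeff_mul, ENNReal.ofReal_sum_of_nonneg fun p _ => mul_nonneg (hF _) (hG _), Finset.sum_mul]
  refine Finset.sum_congr rfl fun p hp => ?_
  rw [← Finset.HasAntidiagonal.mem_antidiagonal.1 hp, ENNReal.ofReal_mul (hF _), pow_add]
  ring

/-- The Cauchy product in `[0, ∞]`. -/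
theorem tsum_mul_tsum_antidiagonal (f g : ℕ → ℝ≥0∞) :
    (∑' n, f n) * ∑' n, g n = ∑' n, ∑ p ∈ Finset.HasAntidiagonal.antidiagonal n, f p.1 * g p.2 := by
  rw [← ENNReal.tsum_mul_right]
  simp_rw [← ENNReal.tsum_mul_left]
  rw [← ENNReal.tsum_prod (f := fun i j => f i * g j),
    ← Finset.HasAntidiagonal.sigmaAntidiagonalEquivProd.tsum_eq, ENNReal.tsum_sigma']
  refine tsum_congr fun n => ?_
  rw [tsum_fintype]
  exact Finset.sum_coe_sort _ fun p : ℕ × ℕ => f p.1 * g p.2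

theorem evE_mul (hF : Nonneg F) (hG : Nonneg G) : evE (F * G) x = evE F x * evE G x := by
  rw [evE, evE, evE, tsum_mul_tsum_antidiagonal]
  exact tsum_congr fun n => ofReal_coeff_mul hF hG n

theorem evE_one : evE 1 x = 1 := by
  rw [evE, tsum_eq_single 0]
  · simp
  · intro n hn
    simp [coeff_one, hn]

theorem evE_pow (hF : Nonneg F) (k : ℕ) : evE (F ^ k) x = evE F x ^ k := by
  induction k with
  | zero => rw [pow_zero, pow_zero, evE_one]
  | succ k ih => rw [pow_succ, pow_succ, evE_mul (hF.pow k) hF, ih]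

theorem evE_X_mul (hF : Nonneg F) : evE (X * F) x = x * evE F x := by
  have hX : Nonneg (X : PowerSeries ℝ) := fun n => by
    rw [coeff_X]
    split_ifs <;> norm_num
  rw [evE_mul hX hF]
  congr 1
  rw [evE, tsum_eq_single 1]
  · simp
  · intro n hn
    simp [coeff_X, hn]

theorem evTrunc_mul_le (hF : Nonneg F) (hG : Nonneg G) (N : ℕ) :
    evTrunc N (F * G) x ≤ evTrunc N F x * evTrunc N G x := by
  rw [evTrunc, Finset.sum_congr rfl fun n _ => ofReal_coeff_mul hF hG n, evTrunc, evTrunc,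
    Finset.sum_mul_sum, ← Finset.sum_product', Finset.sum_sigma',
    ← Finset.sum_image (s := (Finset.range N).sigma fun n => Finset.HasAntidiagonal.antidiagonal n)
      (g := fun s : Σ _ : ℕ, ℕ × ℕ => s.2) (f := fun p => ENNReal.ofReal (coeff p.1 F) * x ^ p.1 *
        (ENNReal.ofReal (coeff p.2 G) * x ^ p.2))]
  · apply Finset.sum_le_sum_of_subset
    intro p hp
    obtain ⟨⟨n, q⟩, hs, rfl⟩ := Finset.mem_image.1 hp
    obtain ⟨h1, h2⟩ := Finset.mem_sigma.1 hs
    have h3 := Finset.HasAntidiagonal.mem_antidiagonal.1 h2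
    simp only [Finset.mem_range, Finset.mem_product] at h1 h3 ⊢
    omega
  · rintro ⟨n, p⟩ hn ⟨m, q⟩ hm hpq
    have h1 := Finset.HasAntidiagonal.mem_antidiagonal.1 (Finset.mem_sigma.1 hn).2
    have h2 := Finset.HasAntidiagonal.mem_antidiagonal.1 (Finset.mem_sigma.1 hm).2
    simp only at h1 h2 hpq
    subst hpq
    obtain rfl : n = m := h1.symm.trans h2
    rfl

theorem evTrunc_pow_le (hF : Nonneg F) (k N : ℕ) :
    evTrunc N (F ^ k) x ≤ evTrunc N F x ^ k := by
  induction k with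
  | zero =>
    rw [pow_zero, pow_zero]
    exact (evTrunc_le_evE N).trans evE_one.le
  | succ k ih =>
    rw [pow_succ, pow_succ]
    exact (evTrunc_mul_le (hF.pow k) hF N).trans (by gcongr)

theorem ofReal_coeff_subst (hF : Nonneg F) (hT : Nonneg T) (hT0 : constantCoeff T = 0) (n : ℕ) :
    ENNReal.ofReal (coeff n (F.subst T))
      = ∑' m, ENNReal.ofReal (coeff m F) * ENNReal.ofReal (coeff n (T ^ m)) := by
  rw [coeff_subst_eq_sum hT0 n (n + 1) n.lt_succ_self,
    ENNReal.ofReal_sum_of_nonneg fun m _ => mul_nonneg (hF _) (hT.pow m _),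
    tsum_eq_sum (s := Finset.range (n + 1))]
  · exact Finset.sum_congr rfl fun m _ => ENNReal.ofReal_mul (hF _)
  · intro m hm
    rw [coeff_pow_eq_zero hT0 (by simpa using hm)]
    simp

theorem evE_subst (hF : Nonneg F) (hT : Nonneg T) (hT0 : constantCoeff T = 0) :
    evE (F.subst T) x = evE F (evE T x) := by
  rw [evE, evE]
  simp_rw [ofReal_coeff_subst hF hT hT0, ← ENNReal.tsum_mul_right]
  rw [ENNReal.tsum_comm]
  refine tsum_congr fun m => ?_
  simp_rw [mul_assoc]
  rw [ENNReal.tsum_mul_left, ← evE_pow hT]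
  rfl

theorem evTrunc_subst_le (hF : Nonneg F) (hT : Nonneg T) (hT0 : constantCoeff T = 0) (N : ℕ) :
    evTrunc N (F.subst T) x ≤ evE F (evTrunc N T x) := by
  rw [evTrunc, evE]
  simp_rw [ofReal_coeff_subst hF hT hT0, ← ENNReal.tsum_mul_right]
  rw [← Summable.tsum_finsetSum fun _ _ => ENNReal.summable]
  refine ENNReal.tsum_le_tsum fun m => ?_
  simp_rw [mul_assoc]
  rw [← Finset.mul_sum]
  gcongr
  exact evTrunc_pow_le hT m N

theorem evTrunc_X_mul (N : ℕ) : evTrunc (N + 1) (X * F) x = x * evTrunc N F x := by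
  rw [evTrunc, Finset.sum_range_succ', evTrunc, Finset.mul_sum]
  simp only [coeff_zero_X_mul, ENNReal.ofReal_zero, zero_mul, add_zero]
  refine Finset.sum_congr rfl fun n _ => ?_
  rw [coeff_succ_X_mul, pow_succ]
  ring

theorem evE_exp (hx : x ≠ ⊤) :
    evE (PowerSeries.exp ℝ) x = ENNReal.ofReal (Real.exp x.toReal) := by
  have h := NormedSpace.expSeries_div_hasSum_exp (𝔸 := ℝ) x.toReal
  rw [← Real.exp_eq_exp_ℝ] at h
  rw [← h.tsum_eq, ENNReal.ofReal_tsum_of_nonneg (fun n => by positivity) h.summable, evE]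
  refine tsum_congr fun n => ?_
  rw [coeff_exp, mul_comm, div_eq_mul_one_div (x.toReal ^ n), ENNReal.ofReal_mul (by positivity),
    ENNReal.ofReal_pow (by positivity), ENNReal.ofReal_toReal hx]
  simp

theorem le_evE_exp : x ≤ evE (PowerSeries.exp ℝ) x := by
  refine le_trans ?_ (ENNReal.le_tsum 1)
  simp

/-- A real evaluation: `evE F x` is the sum of the real series. -/
theorem hasSum_of_evE_ne_top (hF : Nonneg F) {w : ℝ} (hw : 0 ≤ w)
    (h : evE F (ENNReal.ofReal w) ≠ ⊤) :
    HasSum (fun n => coeff n F * w ^ n) (evE F (ENNReal.ofReal w)).toReal := by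
  have h1 : ∀ n, ENNReal.ofReal (coeff n F) * ENNReal.ofReal w ^ n
      = ENNReal.ofReal (coeff n F * w ^ n) := fun n => by
    rw [ENNReal.ofReal_mul (hF n), ENNReal.ofReal_pow hw]
  have h2 : ∀ n, 0 ≤ coeff n F * w ^ n := fun n => mul_nonneg (hF n) (by positivity)
  rw [evE] at h ⊢
  simp_rw [h1] at h ⊢
  have h3 := (ENNReal.summable_toReal h).hasSum
  rw [← ENNReal.tsum_toReal_eq fun n => ENNReal.ofReal_ne_top] at h3
  simpa only [ENNReal.toReal_ofReal (h2 _)] using h3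

theorem evE_eq_ofReal (hF : Nonneg F) {w s : ℝ} (hw : 0 ≤ w)
    (h : HasSum (fun n => coeff n F * w ^ n) s) :
    evE F (ENNReal.ofReal w) = ENNReal.ofReal s := by
  rw [← h.tsum_eq, ENNReal.ofReal_tsum_of_nonneg
    (fun n => mul_nonneg (hF n) (by positivity)) h.summable, evE]
  exact tsum_congr fun n => by rw [ENNReal.ofReal_mul (hF n), ENNReal.ofReal_pow hw]

end Evaluation

/-! ### The dominant singularity of `T = z exp(b(T))` -/

section Critical

open PowerSeries

variable {F T b : PowerSeries ℝ} {τ : ℝ}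

theorem summable_pow_mul_of_lt_radius (k : ℕ) {c : ℕ → ℝ} {x : ℝ≥0}
    (hx : (x : ℝ≥0∞) < (FormalMultilinearSeries.ofScalars ℝ c).radius) :
    Summable fun n : ℕ => (n : ℝ) ^ k * (|c n| * (x : ℝ) ^ n) := by
  obtain ⟨s, hs, hsr⟩ := ENNReal.lt_iff_exists_nnreal_btwn.1 hx
  have hxs : (x : ℝ) < s := by exact_mod_cast hs
  have hs0 : (0 : ℝ) < s := lt_of_le_of_lt x.2 hxs
  obtain ⟨M, hM, h⟩ := (FormalMultilinearSeries.ofScalars ℝ c).norm_mul_pow_le_of_lt_radius hsr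
  have hq : ‖(x : ℝ) / s‖ < 1 := by
    rw [Real.norm_of_nonneg (by positivity), div_lt_one hs0]
    exact hxs
  refine Summable.of_nonneg_of_le (fun n => by positivity) (fun n => ?_)
    ((summable_pow_mul_geometric_of_norm_lt_one k hq).mul_left M)
  have h1 := h n
  rw [FormalMultilinearSeries.ofScalars_norm, Real.norm_eq_abs] at h1
  have h2 : |c n| * (x : ℝ) ^ n = |c n| * (s : ℝ) ^ n * ((x : ℝ) / s) ^ n := by
    rw [div_pow]
    field_simp
  rw [h2]
  have h3 : 0 ≤ ((x : ℝ) / s) ^ n := by positivity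
  calc (n : ℝ) ^ k * (|c n| * (s : ℝ) ^ n * ((x : ℝ) / s) ^ n)
      = (|c n| * (s : ℝ) ^ n) * ((n : ℝ) ^ k * ((x : ℝ) / s) ^ n) := by ring
    _ ≤ M * ((n : ℝ) ^ k * ((x : ℝ) / s) ^ n) := by gcongr

/-- A series with nonnegative coefficients that is finite below `R` takes the value `1` somewhere in
`(0, R]`, if it vanishes at `0` and is at least `1` at `R`. -/
theorem exists_evE_eq_one (hF : Nonneg F) (hF0 : constantCoeff F = 0) {R : ℝ≥0∞}
    (hfin : ∀ x : ℝ≥0, x < R → evE F x ≠ ⊤) (hR : 1 ≤ evE F R) :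
    ∃ τ : ℝ, 0 < τ ∧ ENNReal.ofReal τ ≤ R ∧ evE F (ENNReal.ofReal τ) = 1 := by
  have hzero : evE F 0 = 0 := by
    rw [evE, ENNReal.tsum_eq_zero]
    intro n
    rcases n with _ | n
    · simp [hF0]
    · simp
  by_cases hex : ∃ x : ℝ≥0, x < R ∧ 1 ≤ evE F x
  · obtain ⟨x, hxR, hx⟩ := hex
    have hx' : (x : ℝ≥0∞) = ENNReal.ofReal (x : ℝ) := (ENNReal.ofReal_coe_nnreal).symm
    have hs : ∀ w : ℝ, 0 ≤ w → w ≤ x →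
        HasSum (fun n => coeff n F * w ^ n) (evE F (ENNReal.ofReal w)).toReal := fun w hw hwx =>
      hasSum_of_evE_ne_top hF hw (ne_top_of_le_ne_top (hfin x hxR)
        (evE_mono (by rw [hx']; exact ENNReal.ofReal_le_ofReal hwx)))
    have hcont : ContinuousOn (fun w : ℝ => ∑' n, coeff n F * w ^ n) (Set.Icc 0 (x : ℝ)) := by
      refine continuousOn_tsum (fun n => by fun_prop) (hs x x.2 le_rfl).summable ?_
      intro n w hw
      rw [Real.norm_of_nonneg (mul_nonneg (hF n) (pow_nonneg hw.1 n))]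
      exact mul_le_mul_of_nonneg_left (pow_le_pow_left₀ hw.1 hw.2 n) (hF n)
    have h1 : (1 : ℝ) ∈ Set.Icc (∑' n, coeff n F * (0 : ℝ) ^ n) (∑' n, coeff n F * (x : ℝ) ^ n) := by
      rw [(hs 0 le_rfl x.2).tsum_eq, (hs x x.2 le_rfl).tsum_eq, ENNReal.ofReal_zero, hzero, ← hx']
      refine ⟨by simp, ?_⟩
      have := ENNReal.toReal_mono (hfin x hxR) hx
      simpa using this
    obtain ⟨τ, hτ, hτ1⟩ := intermediate_value_Icc x.2 hcont h1
    simp only at hτ1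
    have hv : evE F (ENNReal.ofReal τ) = 1 := by
      rw [(hs τ hτ.1 hτ.2).tsum_eq] at hτ1
      rw [← ENNReal.toReal_eq_one_iff]
      exact hτ1
    refine ⟨τ, lt_of_le_of_ne hτ.1 ?_, ?_, hv⟩
    · rintro rfl
      rw [ENNReal.ofReal_zero, hzero] at hv
      exact zero_ne_one hv
    · refine le_trans ?_ hxR.le
      rw [hx']
      exact ENNReal.ofReal_le_ofReal hτ.2
  · push Not at hex
    have hR0 : R ≠ 0 := by
      rintro rfl
      rw [hzero] at hR
      exact absurd hR (by norm_num)
    -- By left continuity the value at `R` is at most `1`.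
    have hle : evE F R ≤ 1 := by
      refine evE_le_of_evTrunc_le fun N => ?_
      have hc : Continuous fun x => evTrunc N F x := by
        unfold evTrunc
        refine continuous_finsetSum _ fun n _ => ?_
        exact (ENNReal.continuous_const_mul ENNReal.ofReal_ne_top).comp (ENNReal.continuous_pow n)
      have hcl : R ∈ closure (Set.Iio R) := by
        rw [closure_Iio' (⟨0, pos_iff_ne_zero.2 hR0⟩ : (Set.Iio R).Nonempty)]
        exact Set.mem_Iic.2 le_rfl
      refine (isClosed_le hc continuous_const).closure_subset_iff.2 ?_ hcl
      intro x hx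
      have hxR : x < R := hx
      lift x to ℝ≥0 using hxR.ne_top
      exact (evTrunc_le_evE N).trans (hex x hxR).le
    have heq : evE F R = 1 := le_antisymm hle hR
    have hRtop : R ≠ ⊤ := by
      rintro rfl
      have : ∃ n, coeff n F ≠ 0 := by
        by_contra hall
        push Not at hall
        rw [evE] at heq
        simp [hall] at heq
      obtain ⟨n, hn⟩ := this
      have hn0 : n ≠ 0 := by
        rintro rfl
        rw [coeff_zero_eq_constantCoeff_apply] at hn
        exact hn hF0
      have h1 := ENNReal.le_tsum (f := fun n => ENNReal.ofReal (coeff n F) * (⊤ : ℝ≥0∞) ^ n) n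
      have h2 : ENNReal.ofReal (coeff n F) ≠ 0 := by
        rw [Ne, ENNReal.ofReal_eq_zero, not_le]
        exact lt_of_le_of_ne (hF n) (Ne.symm hn)
      change _ ≤ evE F ⊤ at h1
      rw [heq, ENNReal.top_pow hn0, ENNReal.mul_top h2] at h1
      exact absurd h1 (by simp)
    refine ⟨R.toReal, ENNReal.toReal_pos hR0 hRtop, ?_, ?_⟩
    · rw [ENNReal.ofReal_toReal hRtop]
    · rw [ENNReal.ofReal_toReal hRtop, heq]

/-- The tangent at `τ` to the convex function `b` lies below it; here `τ b'(τ) = 1`. -/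
theorem tangent_le (hb : Nonneg b) (hτ : 0 < τ) {l s w : ℝ} (hw : 0 ≤ w)
    (hl : HasSum (fun n => coeff n b * τ ^ n) l)
    (h1 : HasSum (fun n : ℕ => n * coeff n b * τ ^ n) 1)
    (hs : HasSum (fun n => coeff n b * w ^ n) s) : l + (w / τ - 1) ≤ s := by
  have h2 := hl.add (h1.mul_right (w / τ - 1))
  rw [one_mul] at h2
  refine hasSum_le (fun n => ?_) h2 hs
  have h3 : (w : ℝ) ^ n = τ ^ n * (1 + (w / τ - 1)) ^ n := by
    rw [← mul_pow]
    congr 1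
    field_simp
    ring
  have h4 : 1 + (n : ℝ) * (w / τ - 1) ≤ (1 + (w / τ - 1)) ^ n := by
    apply one_add_mul_le_pow
    have : 0 ≤ w / τ := by positivity
    linarith
  rw [h3]
  have h5 : 0 ≤ coeff n b * τ ^ n := mul_nonneg (hb n) (by positivity)
  nlinarith [mul_le_mul_of_nonneg_left h4 h5]

theorem Nonneg.expOf (hb : Nonneg b) (hb0 : constantCoeff b = 0) : Nonneg (expOf b) :=
  Nonneg.exp.subst hb hb0

theorem evE_expOf (hb : Nonneg b) (hb0 : constantCoeff b = 0) {x : ℝ≥0∞} :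
    evE (expOf b) x = evE (PowerSeries.exp ℝ) (evE b x) :=
  evE_subst .exp hb hb0

theorem coeff_le_of_constantCoeff_eq_zero (hb : Nonneg b) (hb0 : constantCoeff b = 0) (n : ℕ) :
    coeff n b ≤ n * coeff n b := by
  rcases n with _ | n
  · simp [hb0]
  · have := hb (n + 1)
    push_cast
    nlinarith [mul_nonneg (Nat.cast_nonneg (α := ℝ) n) this]

variable (hb : Nonneg b) (hb0 : constantCoeff b = 0) (hT : Nonneg T)
  (heq : T = X * (expOf b).subst T) (hτ : 0 < τ)
  (h1 : HasSum (fun n : ℕ => n * coeff n b * τ ^ n) 1)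

include hb hb0 hτ h1 in
theorem summable_coeff_mul_pow : Summable fun n => coeff n b * τ ^ n :=
  Summable.of_nonneg_of_le (fun n => mul_nonneg (hb n) (by positivity))
    (fun n => mul_le_mul_of_nonneg_right (coeff_le_of_constantCoeff_eq_zero hb hb0 n)
      (by positivity)) h1.summable

include heq in
theorem constantCoeff_eq_zero_of_eq : constantCoeff T = 0 := by
  rw [heq]
  simp

include hb hb0 hT heq in
/-- Where `T` is finite, `T(x) = x exp(b(T(x)))` holds between real numbers. -/
theorem functional_equation_real {x : ℝ} (hx : 0 < x) (hfin : evE T (ENNReal.ofReal x) ≠ ⊤) :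
    ∃ w s : ℝ, 0 < w ∧ evE T (ENNReal.ofReal x) = ENNReal.ofReal w ∧
      HasSum (fun n => coeff n b * w ^ n) s ∧ w = x * Real.exp s := by
  have hT0 := constantCoeff_eq_zero_of_eq heq
  have hE : Nonneg (expOf b) := Nonneg.expOf hb hb0
  have h := congrArg (fun F => evE F (ENNReal.ofReal x)) heq
  rw [evE_X_mul (hE.subst hT hT0), evE_subst hE hT hT0, evE_expOf hb hb0] at h
  set W := evE T (ENNReal.ofReal x) with hW
  have hxne : ENNReal.ofReal x ≠ 0 := by simpa using hx
  have hbfin : evE b W ≠ ⊤ := by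
    intro htop
    have h2 : evE (PowerSeries.exp ℝ) (evE b W) = ⊤ := by
      rw [htop]
      exact top_le_iff.1 le_evE_exp
    rw [h2, ENNReal.mul_top hxne] at h
    exact hfin h
  have hWr : W = ENNReal.ofReal W.toReal := (ENNReal.ofReal_toReal hfin).symm
  rw [evE_exp hbfin, ← ENNReal.ofReal_mul hx.le] at h
  have hw : W.toReal = x * Real.exp (evE b W).toReal := by
    have := congrArg ENNReal.toReal h
    rwa [ENNReal.toReal_ofReal (by positivity)] at this
  refine ⟨W.toReal, (evE b W).toReal, ?_, hWr, ?_, hw⟩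
  · rw [hw]
    positivity
  · have := hasSum_of_evE_ne_top hb (w := W.toReal) ENNReal.toReal_nonneg (by rwa [← hWr])
    rwa [← hWr] at this

include hb hb0 hT heq hτ h1 in
/-- Where `T` is finite, `x = w exp(-b(w))` for `w = T(x)`, and this function of `w` is maximal at
`τ`. -/
theorem le_of_evE_ne_top {x : ℝ} (hx : 0 ≤ x) (hfin : evE T (ENNReal.ofReal x) ≠ ⊤) :
    x ≤ τ * Real.exp (-∑' n, coeff n b * τ ^ n) := by
  rcases hx.eq_or_lt with rfl | hx
  · positivity
  obtain ⟨w, s, hw, -, hs, hws⟩ := functional_equation_real hb hb0 hT heq hx hfin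
  have hl := (summable_coeff_mul_pow hb hb0 hτ h1).hasSum
  have ht := tangent_le hb hτ hw.le hl h1 hs
  have h2 : x = w * Real.exp (-s) := by
    rw [hws, mul_assoc, ← Real.exp_add]
    simp
  have h3 : w / τ ≤ Real.exp (w / τ - 1) := by
    have := Real.add_one_le_exp (w / τ - 1)
    linarith
  have h4 : w ≤ τ * Real.exp (w / τ - 1) := by
    rwa [div_le_iff₀' hτ] at h3
  calc x = w * Real.exp (-s) := h2
    _ ≤ τ * Real.exp (w / τ - 1) * Real.exp (-s) := by gcongr
    _ = τ * Real.exp (w / τ - 1 - s) := by rw [mul_assoc, ← Real.exp_add]; rfl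
    _ ≤ _ := by
      gcongr
      linarith

include hb hb0 hT heq hτ h1 in
/-- At `r = τ exp(-b(τ))` with `τ b'(τ) = 1` the value of `T` is `τ`. The truncations of `T(r)` are
at most `τ` by induction; conversely `r = w exp(-b(w))` has no solution other than `w = τ`. -/
theorem evE_critical :
    evE T (ENNReal.ofReal (τ * Real.exp (-∑' n, coeff n b * τ ^ n))) = ENNReal.ofReal τ := by
  set l := ∑' n, coeff n b * τ ^ n with hldef
  have hl : HasSum (fun n => coeff n b * τ ^ n) l := (summable_coeff_mul_pow hb hb0 hτ h1).hasSum
  have hT0 := constantCoeff_eq_zero_of_eq heq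
  have hE : Nonneg (expOf b) := Nonneg.expOf hb hb0
  set r := τ * Real.exp (-l) with hr
  have hr0 : 0 < r := by positivity
  have hEτ : ENNReal.ofReal r * evE (expOf b) (ENNReal.ofReal τ)
      = ENNReal.ofReal τ := by
    have hbτ := evE_eq_ofReal hb hτ.le hl
    have hl0 : 0 ≤ l := tsum_nonneg fun n => mul_nonneg (hb n) (by positivity)
    rw [evE_expOf hb hb0, hbτ, evE_exp ENNReal.ofReal_ne_top, ENNReal.toReal_ofReal hl0,
      ← ENNReal.ofReal_mul hr0.le, hr, mul_assoc, ← Real.exp_add]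
    simp
  have htrunc : ∀ N, evTrunc N T (ENNReal.ofReal r) ≤ ENNReal.ofReal τ := by
    intro N
    induction N with
    | zero => simp [evTrunc]
    | succ N ih =>
      rw [heq, evTrunc_X_mul, ← hEτ]
      gcongr
      exact (evTrunc_subst_le hE hT hT0 N).trans (evE_mono ih)
  have hle := evE_le_of_evTrunc_le htrunc
  have hfin := ne_top_of_le_ne_top ENNReal.ofReal_ne_top hle
  obtain ⟨w, s, hw, hTw, hs, hws⟩ := functional_equation_real hb hb0 hT heq hr0 hfin
  rw [hTw]
  congr 1
  by_contra hne
  have ht := tangent_le hb hτ hw.le hl h1 hs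
  have h3 : w / τ < Real.exp (w / τ - 1) := by
    have h0 : w / τ - 1 ≠ 0 := by
      intro h0
      apply hne
      field_simp at h0
      linarith
    have := Real.add_one_lt_exp h0
    linarith
  have h4 : w < τ * Real.exp (w / τ - 1) := by
    rwa [div_lt_iff₀' hτ] at h3
  have h5 : w = τ * Real.exp (s - l) := by
    rw [hws, hr, mul_assoc, ← Real.exp_add]
    congr 2
    ring
  have h6 : Real.exp (w / τ - 1) ≤ Real.exp (s - l) := Real.exp_le_exp.2 (by linarith)
  have h7 := mul_le_mul_of_nonneg_left h6 hτ.le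
  linarith

end Critical

/-! ### The local limit theorem for compound Poisson distributions -/

section LocalLimit

open Complex (I)

variable {c : ℕ → ℝ} {d : ℕ}

/-- The Taylor remainder of `e^{ix}` of order two. -/
theorem norm_exp_sub_one_sub_le (x : ℝ) :
    ‖Complex.exp (x * I) - 1 - x * I‖ ≤ 3 * x ^ 2 := by
  have hx : ‖(x : ℂ) * I‖ = |x| := by simp
  rcases le_or_gt |x| 1 with h | h
  · have := Complex.norm_exp_sub_one_sub_id_le (x := (x : ℂ) * I) (by rwa [hx])
    rw [hx, sq_abs] at this
    nlinarith [sq_nonneg x]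
  · have h1 : ‖Complex.exp (x * I) - 1 - x * I‖ ≤ 1 + 1 + |x| := by
      refine (norm_sub_le _ _).trans (add_le_add ((norm_sub_le _ _).trans ?_) hx.le)
      rw [Complex.norm_exp_ofReal_mul_I, norm_one]
    have h2 : |x| ^ 2 = x ^ 2 := sq_abs x
    nlinarith

/-- The logarithm of the characteristic function of the centred compound Poisson distribution with
mean `1` and jump rates `c k`. -/
noncomputable def logChar (c : ℕ → ℝ) (θ : ℝ) : ℂ :=
  ∑' k : ℕ, (c k : ℂ) * (Complex.exp ((k * θ : ℝ) * I) - 1 - (k * θ : ℝ) * I)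

theorem norm_logChar_term_le (hc : ∀ k, 0 ≤ c k) (k : ℕ) (θ : ℝ) :
    ‖(c k : ℂ) * (Complex.exp ((k * θ : ℝ) * I) - 1 - (k * θ : ℝ) * I)‖
      ≤ 3 * θ ^ 2 * ((k : ℝ) ^ 2 * c k) := by
  rw [norm_mul, Complex.norm_real, Real.norm_of_nonneg (hc k)]
  have := mul_le_mul_of_nonneg_left (norm_exp_sub_one_sub_le (k * θ)) (hc k)
  refine this.trans (le_of_eq ?_)
  ring

variable (hc : ∀ k, 0 ≤ c k) (hsq : Summable fun k : ℕ => (k : ℝ) ^ 2 * c k)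
include hc hsq

theorem summable_logChar (θ : ℝ) :
    Summable fun k : ℕ =>
      (c k : ℂ) * (Complex.exp ((k * θ : ℝ) * I) - 1 - (k * θ : ℝ) * I) :=
  Summable.of_norm_bounded (hsq.mul_left _) fun k => norm_logChar_term_le hc k θ

theorem continuous_logChar : Continuous (logChar c) := by
  rw [continuous_iff_continuousAt]
  intro θ
  have h : ContinuousOn (logChar c) (Set.Icc (-(|θ| + 1)) (|θ| + 1)) := by
    refine continuousOn_tsum (u := fun k : ℕ => 3 * (|θ| + 1) ^ 2 * ((k : ℝ) ^ 2 * c k))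
      (fun k => by fun_prop) (hsq.mul_left _) fun k t ht => ?_
    refine (norm_logChar_term_le hc k t).trans ?_
    have h1 : t ^ 2 ≤ (|θ| + 1) ^ 2 := sq_le_sq' ht.1 ht.2
    have h2 : 0 ≤ (k : ℝ) ^ 2 * c k := mul_nonneg (by positivity) (hc k)
    gcongr
  refine h.continuousAt (Icc_mem_nhds ?_ ?_)
  · have := neg_abs_le θ
    linarith
  · have := le_abs_self θ
    linarith

theorem re_logChar (θ : ℝ) : (logChar c θ).re = -∑' k : ℕ, c k * (1 - Real.cos (k * θ)) := by
  rw [logChar, Complex.re_tsum (summable_logChar hc hsq θ), ← tsum_neg]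
  refine tsum_congr fun k => ?_
  rw [Complex.re_ofReal_mul, Complex.sub_re, Complex.sub_re, Complex.exp_ofReal_mul_I_re]
  simp only [Complex.one_re, Complex.mul_re, Complex.ofReal_re, Complex.I_re, mul_zero,
    Complex.ofReal_im, Complex.I_im, mul_one, sub_zero]
  ring

theorem summable_one_sub_cos (θ : ℝ) : Summable fun k : ℕ => c k * (1 - Real.cos (k * θ)) := by
  have := (Complex.hasSum_re (summable_logChar hc hsq θ).hasSum).summable.neg
  refine this.congr fun k => ?_
  rw [Complex.re_ofReal_mul, Complex.sub_re, Complex.sub_re, Complex.exp_ofReal_mul_I_re]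
  simp only [Complex.one_re, Complex.mul_re, Complex.ofReal_re, Complex.I_re, mul_zero,
    Complex.ofReal_im, Complex.I_im, mul_one, sub_zero]
  ring

/-- Away from multiples of `2π / d` the characteristic function has modulus less than `1`. -/
theorem re_logChar_neg (hd0 : 0 < d)
    (hd : ∀ m : ℕ, (∀ k, c k ≠ 0 → m ∣ k) → m ∣ d) {θ : ℝ} (hθ0 : θ ≠ 0)
    (hθ : |θ| ≤ Real.pi / d) : (logChar c θ).re < 0 := by
  rw [re_logChar hc hsq, neg_lt_zero]
  have hnn : ∀ k : ℕ, 0 ≤ c k * (1 - Real.cos (k * θ)) := fun k =>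
    mul_nonneg (hc k) (by linarith [Real.cos_le_one (k * θ)])
  refine lt_of_le_of_ne (tsum_nonneg hnn) fun h0 => ?_
  have hz := (hasSum_zero_iff_of_nonneg hnn).1 (h0 ▸ (summable_one_sub_cos hc hsq θ).hasSum)
  -- The integers `k` with `k θ ∈ 2π ℤ` form a subgroup `g ℤ`, and `g` divides all jump sizes.
  let H : AddSubgroup ℤ := (AddSubgroup.zmultiples (2 * Real.pi)).comap
    ((AddMonoidHom.mulRight θ).comp (Int.castAddHom ℝ))
  have hH : ∀ k : ℤ, k ∈ H ↔ ∃ n : ℤ, (n : ℝ) * (2 * Real.pi) = k * θ := fun k => by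
    simp [H, AddSubgroup.mem_zmultiples_iff]
  obtain ⟨g, hg⟩ := Int.subgroup_cyclic H
  have hmem : ∀ k : ℤ, k ∈ H ↔ g ∣ k := fun k => by
    rw [hg, ← AddSubgroup.zmultiples_eq_closure, Int.mem_zmultiples_iff]
  have hgd : g.natAbs ∣ d := hd _ fun k hk => by
    have h1 : c k * (1 - Real.cos (k * θ)) = 0 := congrFun hz k
    have h2 : Real.cos (k * θ) = 1 := by
      have := (mul_eq_zero.1 h1).resolve_left hk
      linarith
    rw [← Int.natCast_dvd_natCast, Int.natAbs_dvd, ← hmem, hH]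
    simpa using (Real.cos_eq_one_iff _).1 h2
  obtain ⟨n, hn⟩ := (hH d).1 ((hmem d).2 (Int.natAbs_dvd.1 (Int.natCast_dvd_natCast.2 hgd)))
  have hdpos : (0 : ℝ) < d := by exact_mod_cast hd0
  rw [Int.cast_natCast] at hn
  have h3 : |(n : ℝ)| * (2 * Real.pi) ≤ Real.pi := by
    rw [← abs_of_pos (by positivity : 0 < 2 * Real.pi), ← abs_mul, hn, abs_mul, abs_of_pos hdpos]
    rwa [le_div_iff₀' hdpos] at hθ
  have h4 : |(n : ℝ)| < 1 := by nlinarith [Real.pi_pos, abs_nonneg (n : ℝ)]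
  have h5 : n = 0 := by
    rw [← Int.abs_lt_one_iff]
    exact_mod_cast h4
  rw [h5, Int.cast_zero, zero_mul] at hn
  exact (mul_ne_zero hdpos.ne' hθ0) hn.symm

/-- A Gaussian bound for the characteristic function on one period. -/
theorem exists_re_logChar_le (hd0 : 0 < d) (hne : ∃ k, k ≠ 0 ∧ c k ≠ 0)
    (hd : ∀ m : ℕ, (∀ k, c k ≠ 0 → m ∣ k) → m ∣ d) :
    ∃ κ : ℝ, 0 < κ ∧ ∀ θ : ℝ, |θ| ≤ Real.pi / d → (logChar c θ).re ≤ -κ * θ ^ 2 := by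
  obtain ⟨k, hk0, hck⟩ := hne
  have hk : (0 : ℝ) < k := by exact_mod_cast Nat.pos_of_ne_zero hk0
  have hck : 0 < c k := lt_of_le_of_ne (hc k) hck.symm
  have hdpos : (0 : ℝ) < d := by exact_mod_cast hd0
  -- Near zero a single jump size suffices.
  have hnear : ∀ θ : ℝ, |θ| ≤ Real.pi / k →
      (logChar c θ).re ≤ -(c k * (2 / Real.pi ^ 2) * k ^ 2) * θ ^ 2 := by
    intro θ hθ
    rw [re_logChar hc hsq, neg_mul, neg_le_neg_iff]
    refine le_trans ?_ ((summable_one_sub_cos hc hsq θ).le_tsum k fun j _ =>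
      mul_nonneg (hc j) (by linarith [Real.cos_le_one (j * θ)]))
    have h1 : |k * θ| ≤ Real.pi := by
      rw [abs_mul, abs_of_pos hk]
      rwa [le_div_iff₀' hk] at hθ
    have h3 : 2 / Real.pi ^ 2 * (k * θ) ^ 2 ≤ 1 - Real.cos (k * θ) := by
      have := Real.cos_le_one_sub_mul_cos_sq h1
      linarith
    have h4 := mul_le_mul_of_nonneg_left h3 hck.le
    linarith
  -- Elsewhere compactness gives a positive lower bound.
  let S : Set ℝ := Set.Icc (-(Real.pi / d)) (Real.pi / d) ∩ {θ | Real.pi / k ≤ |θ|}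
  have hS : IsCompact S := isCompact_Icc.inter_right (isClosed_le continuous_const continuous_abs)
  have hcont : Continuous fun θ => (logChar c θ).re :=
    Complex.continuous_re.comp (continuous_logChar hc hsq)
  obtain ⟨m, hm0, hm⟩ : ∃ m : ℝ, 0 < m ∧ ∀ θ ∈ S, (logChar c θ).re ≤ -m := by
    rcases S.eq_empty_or_nonempty with hS0 | hS0
    · exact ⟨1, one_pos, by simp [hS0]⟩
    · obtain ⟨θ₀, hθ₀, hmax⟩ := hS.exists_isMaxOn hS0 hcont.continuousOn
      refine ⟨-(logChar c θ₀).re, ?_, fun θ hθ => by simpa using hmax hθ⟩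
      rw [neg_pos]
      refine re_logChar_neg hc hsq hd0 hd ?_ (abs_le.2 hθ₀.1)
      rintro rfl
      have : Real.pi / k ≤ |(0 : ℝ)| := hθ₀.2
      rw [abs_zero] at this
      have : 0 < Real.pi / k := by positivity
      linarith
  refine ⟨min (c k * (2 / Real.pi ^ 2) * k ^ 2) (m / (Real.pi / d) ^ 2),
    lt_min (by positivity) (by positivity), fun θ hθ => ?_⟩
  rcases le_total |θ| (Real.pi / k) with h | h
  · refine (hnear θ h).trans ?_
    have := mul_le_mul_of_nonneg_right (min_le_left (c k * (2 / Real.pi ^ 2) * k ^ 2)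
      (m / (Real.pi / d) ^ 2)) (sq_nonneg θ)
    linarith
  · refine (hm θ ⟨abs_le.1 hθ, h⟩).trans ?_
    have h1 := mul_le_mul_of_nonneg_right (min_le_right (c k * (2 / Real.pi ^ 2) * k ^ 2)
      (m / (Real.pi / d) ^ 2)) (sq_nonneg θ)
    have h2 : m / (Real.pi / d) ^ 2 * θ ^ 2 ≤ m := by
      rw [div_mul_eq_mul_div, div_le_iff₀ (by positivity)]
      have : θ ^ 2 ≤ (Real.pi / d) ^ 2 := sq_le_sq' (abs_le.1 hθ).1 (abs_le.1 hθ).2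
      gcongr
    linarith

omit hc hsq in
theorem tendsto_mul_exp_sub (a : ℝ) :
    Tendsto (fun N : ℕ => (N : ℂ) *
      (Complex.exp ((a / √N : ℝ) * I) - 1 - (a / √N : ℝ) * I)) atTop (𝓝 (-(a : ℂ) ^ 2 / 2)) := by
  rw [tendsto_iff_norm_sub_tendsto_zero]
  have hlim : Tendsto (fun N : ℕ => |a| ^ 3 * Real.exp |a| * (√N)⁻¹) atTop (𝓝 0) := by
    rw [← mul_zero (|a| ^ 3 * Real.exp |a|)]
    exact (tendsto_inv_atTop_zero.comp
      (Real.tendsto_sqrt_atTop.comp tendsto_natCast_atTop_atTop)).const_mul _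
  refine squeeze_zero' (Eventually.of_forall fun _ => norm_nonneg _) ?_ hlim
  filter_upwards [eventually_ge_atTop 1] with N hN
  have hN1 : (1 : ℝ) ≤ N := by exact_mod_cast hN
  have hN0 : (0 : ℝ) < √N := Real.sqrt_pos.2 (by linarith)
  have hsq : √(N : ℝ) ^ 2 = N := Real.sq_sqrt (by linarith)
  have hsqC : ((√(N : ℝ) : ℝ) : ℂ) ^ 2 = (N : ℂ) := by
    rw [← Complex.ofReal_pow, hsq, Complex.ofReal_natCast]
  have hN0C : ((√(N : ℝ) : ℝ) : ℂ) ≠ 0 := by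
    rw [Ne, Complex.ofReal_eq_zero]
    exact hN0.ne'
  set z : ℂ := (a / √N : ℝ) * I with hz
  have hznorm : ‖z‖ = |a| / √N := by
    rw [hz, norm_mul, Complex.norm_I, mul_one, Complex.norm_real, Real.norm_eq_abs, abs_div,
      abs_of_pos hN0]
  have hz2 : (N : ℂ) * (z ^ 2 / 2) = -(a : ℂ) ^ 2 / 2 := by
    rw [hz, mul_pow, Complex.I_sq, Complex.ofReal_div, div_pow, hsqC]
    have : (N : ℂ) ≠ 0 := by rw [← hsqC]; exact pow_ne_zero 2 hN0C
    field_simp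
  have hrem := Complex.norm_exp_sub_sum_le_norm_mul_exp z 3
  have hsum : ∑ m ∈ Finset.range 3, z ^ m / (m ! : ℂ) = 1 + z + z ^ 2 / 2 := by
    simp [Finset.sum_range_succ, Nat.factorial]
  rw [hsum, hznorm] at hrem
  have heq : (N : ℂ) * (Complex.exp z - 1 - z) - -(a : ℂ) ^ 2 / 2
      = N * (Complex.exp z - (1 + z + z ^ 2 / 2)) := by
    rw [← hz2]
    ring
  rw [heq, norm_mul, Complex.norm_natCast]
  have hle : |a| / √N ≤ |a| := by
    apply div_le_self (abs_nonneg a)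
    rw [Real.one_le_sqrt]
    exact hN1
  calc (N : ℝ) * ‖Complex.exp z - (1 + z + z ^ 2 / 2)‖
      ≤ N * ((|a| / √N) ^ 3 * Real.exp (|a| / √N)) := by gcongr
    _ ≤ N * ((|a| / √N) ^ 3 * Real.exp |a|) := by gcongr
    _ = √(N : ℝ) ^ 2 * ((|a| / √N) ^ 3 * Real.exp |a|) := by rw [hsq]
    _ = |a| ^ 3 * Real.exp |a| * (√N)⁻¹ := by field_simp

/-- Second order expansion of `logChar` at zero. -/
theorem tendsto_mul_logChar (s : ℝ) :
    Tendsto (fun N : ℕ => (N : ℂ) * logChar c (s / √N)) atTop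
      (𝓝 ((-(∑' k : ℕ, (k : ℝ) ^ 2 * c k) / 2 * s ^ 2 : ℝ) : ℂ)) := by
  have hterm : ∀ k : ℕ, Tendsto (fun N : ℕ => (N : ℂ) * ((c k : ℂ) *
      (Complex.exp ((k * (s / √N) : ℝ) * I) - 1 - (k * (s / √N) : ℝ) * I))) atTop
      (𝓝 ((-((k : ℝ) ^ 2 * c k) / 2 * s ^ 2 : ℝ) : ℂ)) := by
    intro k
    have h := (tendsto_mul_exp_sub (k * s)).const_mul (c k : ℂ)
    convert h using 2 with N
    · rw [mul_div_assoc]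
      ring
    · push_cast
      ring
  have hlim : ((-(∑' k : ℕ, (k : ℝ) ^ 2 * c k) / 2 * s ^ 2 : ℝ) : ℂ)
      = ∑' k : ℕ, ((-((k : ℝ) ^ 2 * c k) / 2 * s ^ 2 : ℝ) : ℂ) := by
    rw [← Complex.ofReal_tsum]
    congr 1
    rw [tsum_mul_right, tsum_div_const, tsum_neg]
  rw [hlim]
  simp_rw [logChar, ← tsum_mul_left]
  refine tendsto_tsum_of_dominated_convergence (hsq.mul_left (3 * s ^ 2)) hterm ?_
  filter_upwards [eventually_ge_atTop 1] with N hN k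
  have hN0 : (0 : ℝ) < N := by exact_mod_cast hN
  rw [norm_mul, Complex.norm_natCast]
  calc (N : ℝ) * _ ≤ N * (3 * (s / √N) ^ 2 * ((k : ℝ) ^ 2 * c k)) :=
        mul_le_mul_of_nonneg_left (norm_logChar_term_le hc k _) hN0.le
    _ = 3 * s ^ 2 * ((k : ℝ) ^ 2 * c k) := by
      rw [div_pow, Real.sq_sqrt hN0.le]
      field_simp

/-- Laplace's method for the Fourier integral over one period. -/
theorem tendsto_sqrt_mul_integral (hd0 : 0 < d) (hne : ∃ k, k ≠ 0 ∧ c k ≠ 0)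
    (hd : ∀ m : ℕ, (∀ k, c k ≠ 0 → m ∣ k) → m ∣ d) :
    Tendsto (fun N : ℕ => (√N : ℂ) * ∫ θ in -(Real.pi / d)..Real.pi / d,
        Complex.exp (N * logChar c θ) * Complex.exp (θ * I)) atTop
      (𝓝 ((√(Real.pi / ((∑' k : ℕ, (k : ℝ) ^ 2 * c k) / 2)) : ℝ) : ℂ)) := by
  obtain ⟨κ, hκ, hbound⟩ := exists_re_logChar_le hc hsq hd0 hne hd
  have hdpos : (0 : ℝ) < d := by exact_mod_cast hd0
  have hpd : 0 < Real.pi / d := by positivity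
  set J : Set ℝ := Set.Ioc (-(Real.pi / d)) (Real.pi / d) with hJ
  let g : ℕ → ℝ → ℂ := fun N => J.indicator fun θ =>
    Complex.exp (N * logChar c θ) * Complex.exp (θ * I)
  have hg : ∀ N : ℕ, (√N : ℂ) * ∫ θ in -(Real.pi / d)..Real.pi / d,
      Complex.exp (N * logChar c θ) * Complex.exp (θ * I) = ∫ s, g N (s / √N) := by
    intro N
    rw [Measure.integral_comp_div, intervalIntegral.integral_of_le (by linarith),
      integral_indicator measurableSet_Ioc, abs_of_nonneg (Real.sqrt_nonneg _),
      Complex.real_smul]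
  simp_rw [hg]
  rw [← integral_gaussian, ← integral_complex_ofReal]
  refine tendsto_integral_filter_of_dominated_convergence (fun s => Real.exp (-κ * s ^ 2))
    ?_ ?_ (integrable_exp_neg_mul_sq hκ) ?_
  · refine Eventually.of_forall fun N => ?_
    refine Measurable.aestronglyMeasurable ?_
    refine Measurable.comp (g := g N) ?_ (measurable_id.div_const _)
    refine Measurable.indicator (Continuous.measurable ?_) measurableSet_Ioc
    have := continuous_logChar hc hsq
    fun_prop
  · filter_upwards [eventually_ge_atTop 1] with N hN
    refine ae_of_all _ fun s => ?_
    have hN0 : (0 : ℝ) < N := by exact_mod_cast hN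
    by_cases hs : s / √N ∈ J
    · simp only [g]
      rw [Set.indicator_of_mem hs, norm_mul, Complex.norm_exp_ofReal_mul_I, mul_one,
        Complex.norm_exp]
      apply Real.exp_le_exp.2
      have h1 := hbound (s / √N) (abs_le.2 ⟨hs.1.le, hs.2⟩)
      have h2 : ((N : ℂ) * logChar c (s / √N)).re = N * (logChar c (s / √N)).re := by
        rw [← Complex.ofReal_natCast, Complex.re_ofReal_mul]
      rw [h2]
      calc (N : ℝ) * (logChar c (s / √N)).re ≤ N * (-κ * (s / √N) ^ 2) :=
            mul_le_mul_of_nonneg_left h1 hN0.le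
        _ = -κ * s ^ 2 := by
          rw [div_pow, Real.sq_sqrt hN0.le]
          field_simp
    · simp only [g]
      rw [Set.indicator_of_notMem hs, norm_zero]
      positivity
  · refine ae_of_all _ fun s => ?_
    have hsN : Tendsto (fun N : ℕ => s / √N) atTop (𝓝 0) :=
      tendsto_const_nhds.div_atTop (Real.tendsto_sqrt_atTop.comp tendsto_natCast_atTop_atTop)
    have hJ0 : J ∈ 𝓝 (0 : ℝ) := Ioc_mem_nhds (by linarith) hpd
    have h1 : Tendsto (fun N : ℕ => Complex.exp (N * logChar c (s / √N)) *
        Complex.exp ((s / √N : ℝ) * I)) atTop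
        (𝓝 (Complex.exp ((-(∑' k : ℕ, (k : ℝ) ^ 2 * c k) / 2 * s ^ 2 : ℝ) : ℂ) *
          Complex.exp ((0 : ℝ) * I))) := by
      refine ((tendsto_mul_logChar hc hsq s).cexp).mul (Tendsto.cexp (Tendsto.mul_const _ ?_))
      exact (Complex.continuous_ofReal.tendsto 0).comp hsN
    have h2 : Complex.exp ((-(∑' k : ℕ, (k : ℝ) ^ 2 * c k) / 2 * s ^ 2 : ℝ) : ℂ) *
        Complex.exp ((0 : ℝ) * I)
        = ((Real.exp (-((∑' k : ℕ, (k : ℝ) ^ 2 * c k) / 2) * s ^ 2) : ℝ) : ℂ) := by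
      rw [Complex.ofReal_zero, zero_mul, Complex.exp_zero, mul_one, Complex.ofReal_exp, neg_div]
    rw [← h2]
    refine h1.congr' ?_
    filter_upwards [hsN.eventually hJ0] with N hN
    have hN' : s / √N ∈ J := hN
    simp only [g]
    rw [Set.indicator_of_mem hN']

omit hc hsq in
/-- Coefficients of an absolutely convergent power series as Fourier coefficients. -/
theorem coeff_eq_integral {q : ℕ → ℝ} (hq : Summable fun j => |q j|) {f : ℝ → ℂ}
    (hf : ∀ θ : ℝ, HasSum (fun j : ℕ => (q j : ℂ) * Complex.exp ((j * θ : ℝ) * I)) (f θ)) (m : ℕ) :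
    2 * Real.pi * (q m : ℂ)
      = ∫ θ in -Real.pi..Real.pi, f θ * Complex.exp (-(m * θ : ℝ) * I) := by
  have h1 : HasSum (fun j : ℕ => ∫ θ in -Real.pi..Real.pi,
      (q j : ℂ) * Complex.exp ((j * θ : ℝ) * I) * Complex.exp (-(m * θ : ℝ) * I))
      (∫ θ in -Real.pi..Real.pi, f θ * Complex.exp (-(m * θ : ℝ) * I)) := by
    refine intervalIntegral.hasSum_integral_of_dominated_convergence (fun j _ => |q j|)
      (fun j => Continuous.aestronglyMeasurable (by fun_prop)) (fun j => ae_of_all _ fun θ _ => ?_)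
      (ae_of_all _ fun _ _ => hq) (by simp) (ae_of_all _ fun θ _ => (hf θ).mul_right _)
    rw [← Complex.ofReal_neg, norm_mul, norm_mul, Complex.norm_exp_ofReal_mul_I,
      Complex.norm_exp_ofReal_mul_I, Complex.norm_real, mul_one, mul_one, Real.norm_eq_abs]
  have h2 : ∀ j : ℕ, ∫ θ in -Real.pi..Real.pi,
      (q j : ℂ) * Complex.exp ((j * θ : ℝ) * I) * Complex.exp (-(m * θ : ℝ) * I)
      = if j = m then 2 * Real.pi * (q m : ℂ) else 0 := by
    intro j
    have h3 : ∀ θ : ℝ, (q j : ℂ) * Complex.exp ((j * θ : ℝ) * I) * Complex.exp (-(m * θ : ℝ) * I)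
        = q j * Complex.exp (((j : ℂ) - m) * I * θ) := fun θ => by
      rw [mul_assoc, ← Complex.exp_add]
      congr 2
      push_cast
      ring
    simp_rw [h3]
    rw [intervalIntegral.integral_const_mul]
    split_ifs with hjm
    · subst hjm
      simp
      ring
    · have hne : ((j : ℂ) - m) * I ≠ 0 :=
        mul_ne_zero (sub_ne_zero.2 (by exact_mod_cast hjm)) Complex.I_ne_zero
      rw [integral_exp_mul_complex hne]
      have h4 : Complex.exp (((j : ℂ) - m) * I * (Real.pi : ℝ))
          = Complex.exp (((j : ℂ) - m) * I * (-Real.pi : ℝ)) := by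
        rw [Complex.exp_eq_exp_iff_exists_int]
        refine ⟨(j : ℤ) - m, ?_⟩
        push_cast
        ring
      rw [h4, sub_self, zero_div, mul_zero]
  simp_rw [h2] at h1
  exact (hasSum_ite_eq m _).unique h1

omit hsq in
theorem summable_mul_exp (hl : Summable c) (θ : ℝ) :
    Summable fun k : ℕ => (c k : ℂ) * Complex.exp ((k * θ : ℝ) * I) := by
  refine Summable.of_norm_bounded hl fun k => ?_
  rw [norm_mul, Complex.norm_exp_ofReal_mul_I, Complex.norm_real, Real.norm_of_nonneg (hc k),
    mul_one]

omit hsq in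
theorem logChar_eq {l : ℝ} (hl : HasSum c l) (h1 : HasSum (fun k : ℕ => (k : ℝ) * c k) 1) (θ : ℝ) :
    logChar c θ = (∑' k : ℕ, (c k : ℂ) * Complex.exp ((k * θ : ℝ) * I)) - l - θ * I := by
  have e1 := (summable_mul_exp hc hl.summable θ).hasSum
  have e2 : HasSum (fun k => (c k : ℂ)) (l : ℂ) := Complex.hasSum_ofReal.2 hl
  have e3 : HasSum (fun k : ℕ => (((k : ℝ) * c k : ℝ) : ℂ) * (θ * I)) (((1 : ℝ) : ℂ) * (θ * I)) :=
    (Complex.hasSum_ofReal.2 h1).mul_right _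
  rw [Complex.ofReal_one, one_mul] at e3
  rw [logChar, ← ((e1.sub e2).sub e3).tsum_eq]
  refine tsum_congr fun k => ?_
  push_cast
  ring

/-- The local limit theorem: `q N` is the distribution of the sum of `N` independent compound
Poisson variables with mean `1`, and `d` is the greatest common divisor of the jump sizes. -/
theorem local_limit {l : ℝ} (hl : HasSum c l) (h1 : HasSum (fun k : ℕ => (k : ℝ) * c k) 1)
    (hd0 : 0 < d) (hddvd : ∀ k, c k ≠ 0 → d ∣ k)
    (hd : ∀ m : ℕ, (∀ k, c k ≠ 0 → m ∣ k) → m ∣ d) {q : ℕ → ℕ → ℝ}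
    (hq : ∀ N, Summable fun j => |q N j|)
    (hqf : ∀ (N : ℕ) (θ : ℝ), HasSum (fun j : ℕ => (q N j : ℂ) * Complex.exp ((j * θ : ℝ) * I))
      (Complex.exp (N * ((∑' k : ℕ, (c k : ℂ) * Complex.exp ((k * θ : ℝ) * I)) - l)))) :
    Tendsto (fun N : ℕ => √N * q N (N - 1)) (atTopOneMod d)
      (𝓝 (d / √(2 * Real.pi * ∑' k : ℕ, (k : ℝ) ^ 2 * c k))) := by
  have hdpos : (0 : ℝ) < d := by exact_mod_cast hd0
  have hne : ∃ k, k ≠ 0 ∧ c k ≠ 0 := by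
    by_contra hall
    push Not at hall
    have h0 : (fun k : ℕ => (k : ℝ) * c k) = fun _ => 0 := by
      funext k
      by_cases hk : k = 0
      · simp [hk]
      · simp [hall k hk]
    rw [h0] at h1
    exact zero_ne_one (hasSum_zero.unique h1)
  set v : ℝ := ∑' k : ℕ, (k : ℝ) ^ 2 * c k with hv
  have hv0 : 0 < v := by
    obtain ⟨k, hk, hck⟩ := hne
    refine hsq.tsum_pos (fun j => mul_nonneg (by positivity) (hc j)) k ?_
    have hk' : (0 : ℝ) < k := by exact_mod_cast Nat.pos_of_ne_zero hk
    have hck' := lt_of_le_of_ne (hc k) hck.symm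
    positivity
  have hmain := (tendsto_sqrt_mul_integral hc hsq hd0 hne hd).const_mul
    ((d : ℂ) / (2 * Real.pi))
  -- Fourier inversion; the integrand has period `2π / d`, as `d` divides `N - 1`.
  have hint : ∀ N : ℕ, 1 ≤ N → N ≡ 1 [MOD d] → 2 * Real.pi * (q N (N - 1) : ℂ)
      = d * ∫ θ in -(Real.pi / d)..Real.pi / d,
        Complex.exp (N * logChar c θ) * Complex.exp (θ * I) := by
    intro N hN hmod
    rw [coeff_eq_integral (hq N) (hqf N)]
    set h : ℝ → ℂ := fun θ => Complex.exp (N * logChar c θ) * Complex.exp (θ * I) with hh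
    have heq : ∀ θ : ℝ, Complex.exp (N * ((∑' k : ℕ, (c k : ℂ) * Complex.exp ((k * θ : ℝ) * I)) - l))
        * Complex.exp (-((N - 1 : ℕ) * θ : ℝ) * I) = h θ := by
      intro θ
      simp only [hh]
      rw [logChar_eq hc hl h1, ← Complex.exp_add, ← Complex.exp_add]
      congr 1
      push_cast [hN]
      ring
    obtain ⟨j, hj⟩ : d ∣ N - 1 := (Nat.modEq_iff_dvd' hN).1 hmod.symm
    have hexp : ∀ (k : ℕ) (θ : ℝ), d ∣ k →
        Complex.exp ((k * (θ + 2 * Real.pi / d) : ℝ) * I) = Complex.exp ((k * θ : ℝ) * I) := by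
      rintro _ θ ⟨i, rfl⟩
      rw [Complex.exp_eq_exp_iff_exists_int]
      refine ⟨i, ?_⟩
      have : (d : ℂ) ≠ 0 := by exact_mod_cast hdpos.ne'
      push_cast
      field_simp
    have hper : Function.Periodic h (2 * Real.pi / d) := by
      intro θ
      rw [← heq, ← heq]
      congr 1
      · congr 3
        refine tsum_congr fun k => ?_
        by_cases hk : c k = 0
        · simp [hk]
        · rw [hexp k θ (hddvd k hk)]
      · rw [neg_mul, neg_mul, Complex.exp_neg, Complex.exp_neg, hexp _ θ ⟨j, hj⟩]
    have hcont : Continuous h := by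
      have := continuous_logChar hc hsq
      fun_prop
    simp_rw [heq]
    have hp1 := hper.intervalIntegral_add_zsmul_eq d (-Real.pi)
      fun a b => hcont.intervalIntegrable a b
    have hp2 := hper.intervalIntegral_add_eq (-Real.pi) (-(Real.pi / d))
    have e1 : -Real.pi + (d : ℤ) • (2 * Real.pi / d) = Real.pi := by
      rw [zsmul_eq_mul, Int.cast_natCast]
      field_simp
      ring
    have e2 : -(Real.pi / d) + 2 * Real.pi / d = Real.pi / d := by ring
    rw [e1] at hp1
    rw [e2] at hp2
    rw [hp1, hp2, zsmul_eq_mul, Int.cast_natCast]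
  have hlimC : Tendsto (fun N : ℕ => ((√N * q N (N - 1) : ℝ) : ℂ)) (atTopOneMod d)
      (𝓝 ((d / √(2 * Real.pi * v) : ℝ) : ℂ)) := by
    have hconst : (d : ℂ) / (2 * Real.pi) * ((√(Real.pi / (v / 2)) : ℝ) : ℂ)
        = ((d / √(2 * Real.pi * v) : ℝ) : ℂ) := by
      rw [← Complex.ofReal_natCast, ← Complex.ofReal_ofNat, ← Complex.ofReal_mul,
        ← Complex.ofReal_div, ← Complex.ofReal_mul]
      congr 1
      have e1 : Real.pi / (v / 2) = (2 * Real.pi) ^ 2 / (2 * Real.pi * v) := by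
        field_simp
      rw [e1, Real.sqrt_div (by positivity), Real.sqrt_sq (by positivity)]
      field_simp
    rw [← hconst]
    refine (hmain.mono_left inf_le_left).congr' ?_
    filter_upwards [mem_inf_of_left (eventually_ge_atTop 1),
      mem_inf_of_right (mem_principal_self _)] with N hN hmod
    have hpi : (Real.pi : ℂ) ≠ 0 := by exact_mod_cast Real.pi_ne_zero
    have h2 : (q N (N - 1) : ℂ) = d * (∫ θ in -(Real.pi / d)..Real.pi / d,
        Complex.exp (N * logChar c θ) * Complex.exp (θ * I)) / (2 * Real.pi) := by
      rw [← hint N hN hmod]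
      field_simp
    rw [Complex.ofReal_mul, h2]
    ring
  have := (Complex.continuous_re.tendsto _).comp hlimC
  simpa [Function.comp_def] using this

end LocalLimit

/-! ### Evaluation on a circle and the offspring distribution -/

section Circle

open PowerSeries

variable {F G b : PowerSeries ℝ} {w : ℝ} {u : ℂ}

theorem norm_coeff_mul_pow (hF : Nonneg F) (hu : ‖u‖ = w) (n : ℕ) :
    ‖((coeff n F : ℝ) : ℂ) * u ^ n‖ = coeff n F * w ^ n := by
  rw [norm_mul, norm_pow, hu, Complex.norm_real, Real.norm_of_nonneg (hF n)]

theorem summable_norm_coeff (hF : Nonneg F) (hw : 0 ≤ w) (hu : ‖u‖ = w)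
    (hfin : evE F (ENNReal.ofReal w) ≠ ⊤) :
    Summable fun n => ‖((coeff n F : ℝ) : ℂ) * u ^ n‖ := by
  simp_rw [norm_coeff_mul_pow hF hu]
  exact (hasSum_of_evE_ne_top hF hw hfin).summable

theorem hasSum_coeff_mul (hF : Nonneg F) (hG : Nonneg G) (hw : 0 ≤ w) (hu : ‖u‖ = w)
    (hFfin : evE F (ENNReal.ofReal w) ≠ ⊤) (hGfin : evE G (ENNReal.ofReal w) ≠ ⊤) :
    HasSum (fun n => ((coeff n (F * G) : ℝ) : ℂ) * u ^ n)
      ((∑' n, ((coeff n F : ℝ) : ℂ) * u ^ n) * ∑' n, ((coeff n G : ℝ) : ℂ) * u ^ n) := by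
  have h1 := summable_norm_coeff hF hw hu hFfin
  have h2 := summable_norm_coeff hG hw hu hGfin
  rw [tsum_mul_tsum_eq_tsum_sum_antidiagonal_of_summable_norm h1 h2]
  have h3 := (summable_norm_sum_mul_antidiagonal_of_summable_norm h1 h2).of_norm.hasSum
  have h4 : ∀ n, ∑ p ∈ Finset.HasAntidiagonal.antidiagonal n, (((coeff p.1 F : ℝ) : ℂ) * u ^ p.1) *
      (((coeff p.2 G : ℝ) : ℂ) * u ^ p.2) = ((coeff n (F * G) : ℝ) : ℂ) * u ^ n := by
    intro n
    rw [coeff_mul, Complex.ofReal_sum, Finset.sum_mul]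
    refine Finset.sum_congr rfl fun p hp => ?_
    rw [← Finset.HasAntidiagonal.mem_antidiagonal.1 hp, pow_add, Complex.ofReal_mul]
    ring
  simp_rw [h4] at h3 ⊢
  exact h3

theorem hasSum_coeff_pow (hb : Nonneg b) (hw : 0 ≤ w) (hu : ‖u‖ = w)
    (hfin : evE b (ENNReal.ofReal w) ≠ ⊤) (m : ℕ) :
    HasSum (fun n => ((coeff n (b ^ m) : ℝ) : ℂ) * u ^ n)
      ((∑' n, ((coeff n b : ℝ) : ℂ) * u ^ n) ^ m) := by
  induction m with
  | zero =>
    rw [pow_zero, pow_zero]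
    convert hasSum_ite_eq 0 (1 : ℂ) using 2 with n
    rw [coeff_one]
    split_ifs with h
    · simp [h]
    · simp
  | succ m ih =>
    have h := hasSum_coeff_mul (hb.pow m) hb hw hu
      (by rw [evE_pow hb]; exact ENNReal.pow_ne_top hfin) hfin
    rw [ih.tsum_eq] at h
    rwa [pow_succ, pow_succ]

/-- Composition of series on a circle of absolute convergence. -/
theorem hasSum_coeff_subst (hF : Nonneg F) (hb : Nonneg b) (hb0 : constantCoeff b = 0)
    (hw : 0 ≤ w) (hu : ‖u‖ = w) (hbfin : evE b (ENNReal.ofReal w) ≠ ⊤)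
    (hfin : evE F (evE b (ENNReal.ofReal w)) ≠ ⊤) :
    HasSum (fun n => ((coeff n (F.subst b) : ℝ) : ℂ) * u ^ n)
      (∑' m, ((coeff m F : ℝ) : ℂ) * (∑' n, ((coeff n b : ℝ) : ℂ) * u ^ n) ^ m) := by
  let a : ℕ × ℕ → ℂ := fun p =>
    ((coeff p.1 F : ℝ) : ℂ) * (((coeff p.2 (b ^ p.1) : ℝ) : ℂ) * u ^ p.2)
  have hnorm : ∀ p, ‖a p‖ = coeff p.1 F * (coeff p.2 (b ^ p.1) * w ^ p.2) := fun p => by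
    simp only [a]
    rw [norm_mul, norm_coeff_mul_pow (hb.pow _) hu, Complex.norm_real, Real.norm_of_nonneg (hF _)]
  set s := evE b (ENNReal.ofReal w) with hs
  have hinner : ∀ m, HasSum (fun n => coeff n (b ^ m) * w ^ n) (s.toReal ^ m) := fun m => by
    have := hasSum_of_evE_ne_top (hb.pow m) hw (by rw [evE_pow hb]; exact ENNReal.pow_ne_top hbfin)
    rwa [evE_pow hb, ENNReal.toReal_pow] at this
  have ha : Summable a := by
    apply Summable.of_norm
    rw [summable_prod_of_nonneg fun p => norm_nonneg _]
    simp_rw [hnorm]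
    refine ⟨fun m => (hinner m).summable.mul_left _, ?_⟩
    simp_rw [tsum_mul_left, fun m => (hinner m).tsum_eq]
    exact (hasSum_of_evE_ne_top hF ENNReal.toReal_nonneg
      (by rwa [ENNReal.ofReal_toReal hbfin])).summable
  have h1 : HasSum (fun m => ((coeff m F : ℝ) : ℂ) *
      (∑' n, ((coeff n b : ℝ) : ℂ) * u ^ n) ^ m) (∑' p, a p) :=
    ha.hasSum.prod_fiberwise fun m => (hasSum_coeff_pow hb hw hu hbfin m).mul_left _
  rw [h1.tsum_eq]
  have h2 : HasSum (a ∘ Prod.swap) (∑' p, a p) := (Equiv.prodComm ℕ ℕ).hasSum_iff.2 ha.hasSum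
  refine h2.prod_fiberwise fun n => ?_
  have h3 : ((coeff n (F.subst b) : ℝ) : ℂ) * u ^ n
      = ∑ m ∈ Finset.range (n + 1), a (m, n) := by
    rw [coeff_subst_eq_sum hb0 n (n + 1) n.lt_succ_self, Complex.ofReal_sum, Finset.sum_mul]
    refine Finset.sum_congr rfl fun m _ => ?_
    simp only [a, Complex.ofReal_mul]
    ring
  rw [h3]
  refine hasSum_sum_of_ne_finset_zero fun m hm => ?_
  simp only [Function.comp_apply, Prod.swap_prod_mk, a]
  rw [coeff_pow_eq_zero hb0 (by simpa using hm)]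
  simp

theorem expOf_pow (hb0 : constantCoeff b = 0) (N : ℕ) :
    expOf b ^ N = (rescale (N : ℝ) (PowerSeries.exp ℝ)).subst b := by
  rw [← exp_pow_eq_rescale_exp, expOf, subst_pow (.of_constantCoeff_zero' hb0)]

variable {τ l : ℝ} (hb : Nonneg b) (hb0 : constantCoeff b = 0) (hτ : 0 < τ)
  (hl : HasSum (fun n => coeff n b * τ ^ n) l)

/-- The distribution of the sum of `N` independent variables with probability generating function
`exp(b(τ z) - b(τ))`, where `l = b(τ)`. -/
noncomputable def convLaw (b : PowerSeries ℝ) (τ l : ℝ) (N j : ℕ) : ℝ :=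
  Real.exp (-(N * l)) * (coeff j (expOf b ^ N) * τ ^ j)

include hb hb0 hτ in
theorem convLaw_nonneg (N j : ℕ) : 0 ≤ convLaw b τ l N j :=
  mul_nonneg (Real.exp_pos _).le (mul_nonneg ((hb.expOf hb0).pow N j) (by positivity))

include hb hb0 hτ hl

theorem evE_expOf_eq : evE (expOf b) (ENNReal.ofReal τ) = ENNReal.ofReal (Real.exp l) := by
  have hl0 : 0 ≤ l := hl.nonneg fun n => mul_nonneg (hb n) (by positivity)
  rw [evE_expOf hb hb0, evE_eq_ofReal hb hτ.le hl, evE_exp ENNReal.ofReal_ne_top,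
    ENNReal.toReal_ofReal hl0]

theorem hasSum_convLaw (N : ℕ) : HasSum (convLaw b τ l N) 1 := by
  have hE := hb.expOf hb0
  have hfin : evE (expOf b ^ N) (ENNReal.ofReal τ) = ENNReal.ofReal (Real.exp (N * l)) := by
    rw [evE_pow hE, evE_expOf_eq hb hb0 hτ hl, ← ENNReal.ofReal_pow (Real.exp_pos _).le,
      ← Real.exp_nat_mul]
  have h := hasSum_of_evE_ne_top (hE.pow N) hτ.le (by rw [hfin]; exact ENNReal.ofReal_ne_top)
  rw [hfin, ENNReal.toReal_ofReal (Real.exp_pos _).le] at h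
  have h2 := h.mul_left (Real.exp (-(N * l)))
  rw [← Real.exp_add, neg_add_cancel, Real.exp_zero] at h2
  exact h2

/-- The generating function of `convLaw` in the closed unit disc. -/
theorem hasSum_convLaw_mul_pow (N : ℕ) {z : ℂ} (hz : ‖z‖ ≤ 1) :
    HasSum (fun j => (convLaw b τ l N j : ℂ) * z ^ j)
      (Complex.exp (N * ((∑' k, ((coeff k b * τ ^ k : ℝ) : ℂ) * z ^ k) - l))) := by
  have hu : ‖(τ : ℂ) * z‖ ≤ τ := by
    rw [norm_mul, Complex.norm_real, Real.norm_of_nonneg hτ.le]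
    exact mul_le_of_le_one_right hτ.le hz
  have hbτ := evE_eq_ofReal hb hτ.le hl
  have hbfin : evE b (ENNReal.ofReal ‖(τ : ℂ) * z‖) ≠ ⊤ :=
    ne_top_of_le_ne_top (by rw [hbτ]; exact ENNReal.ofReal_ne_top)
      (evE_mono (ENNReal.ofReal_le_ofReal hu))
  have hF : Nonneg (rescale (N : ℝ) (PowerSeries.exp ℝ)) := fun n => by
    rw [coeff_rescale]
    exact mul_nonneg (by positivity) (Nonneg.exp n)
  have hFfin : ∀ x : ℝ≥0∞, x ≠ ⊤ → evE (rescale (N : ℝ) (PowerSeries.exp ℝ)) x ≠ ⊤ := by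
    intro x hx
    have h1 : evE (rescale (N : ℝ) (PowerSeries.exp ℝ)) x = evE (PowerSeries.exp ℝ) (N * x) := by
      refine tsum_congr fun n => ?_
      rw [coeff_rescale, ENNReal.ofReal_mul (by positivity), ENNReal.ofReal_pow (by positivity),
        ENNReal.ofReal_natCast, mul_pow]
      ring
    have h2 : (N : ℝ≥0∞) * x ≠ ⊤ := ENNReal.mul_ne_top (ENNReal.natCast_ne_top N) hx
    rw [h1, evE_exp h2]
    exact ENNReal.ofReal_ne_top
  have h := hasSum_coeff_subst hF hb hb0 (norm_nonneg _) rfl hbfin (hFfin _ hbfin)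
  rw [← expOf_pow hb0] at h
  set s := ∑' n, ((coeff n b : ℝ) : ℂ) * (τ * z) ^ n with hs
  have hexp : ∑' m, ((coeff m (rescale (N : ℝ) (PowerSeries.exp ℝ)) : ℝ) : ℂ) * s ^ m
      = Complex.exp (N * s) := by
    have h1 := NormedSpace.expSeries_div_hasSum_exp (𝔸 := ℂ) (N * s)
    rw [← Complex.exp_eq_exp_ℂ] at h1
    rw [← h1.tsum_eq]
    refine tsum_congr fun m => ?_
    rw [coeff_rescale, coeff_exp, mul_pow]
    simp
    ring
  rw [hexp] at h
  have h2 := h.mul_left (Complex.exp (-(N * l)))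
  rw [← Complex.exp_add] at h2
  have hfun : (fun j => (convLaw b τ l N j : ℂ) * z ^ j) = fun j =>
      Complex.exp (-(N * l)) * (((coeff j (expOf b ^ N) : ℝ) : ℂ) * (τ * z) ^ j) := by
    funext j
    rw [convLaw]
    push_cast
    ring
  have hsum : ∑' k, ((coeff k b * τ ^ k : ℝ) : ℂ) * z ^ k = s := by
    refine tsum_congr fun k => ?_
    push_cast
    ring
  have harg : (N : ℂ) * (s - l) = -(N * l) + N * s := by ring
  rw [hfun, hsum, harg]
  exact h2

omit hb hτ hl in
/-- The recursion `k ξ_k = ∑ i c_i ξ_j` over `i + j = k` for compound Poisson distributions. -/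
theorem mul_convLaw_one (k : ℕ) : k * convLaw b τ l 1 k
    = ∑ p ∈ Finset.HasAntidiagonal.antidiagonal k,
      (p.1 * (coeff p.1 b * τ ^ p.1)) * convLaw b τ l 1 p.2 := by
  have h1 : ∀ (H : PowerSeries ℝ) (n : ℕ), coeff n (X * derivative ℝ H) = n * coeff n H := by
    intro H n
    rcases n with _ | n
    · simp
    · rw [coeff_succ_X_mul, coeff_derivative]
      push_cast
      ring
  have h2 : X * derivative ℝ (expOf b) = (X * derivative ℝ b) * expOf b := by
    rw [derivative_expOf hb0, mul_assoc]
  have h3 := congrArg (coeff k) h2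
  rw [h1, coeff_mul] at h3
  simp only [convLaw, pow_one]
  calc (k : ℝ) * (Real.exp (-((1 : ℕ) * l)) * (coeff k (expOf b) * τ ^ k))
      = Real.exp (-((1 : ℕ) * l)) * τ ^ k * (k * coeff k (expOf b)) := by ring
    _ = _ := by
      rw [h3, Finset.mul_sum]
      refine Finset.sum_congr rfl fun p hp => ?_
      rw [h1, ← Finset.HasAntidiagonal.mem_antidiagonal.1 hp, pow_add]
      ring

end Circle

/-! ### Moments and span of compound Poisson distributions -/

theorem hasSum_antidiagonal_mul {f g : ℕ → ℝ} {x y : ℝ} (hf0 : ∀ n, 0 ≤ f n) (hg0 : ∀ n, 0 ≤ g n)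
    (hf : HasSum f x) (hg : HasSum g y) :
    HasSum (fun n => ∑ p ∈ Finset.HasAntidiagonal.antidiagonal n, f p.1 * g p.2) (x * y) := by
  have hf1 : Summable fun n => ‖f n‖ := by
    simpa only [Real.norm_of_nonneg (hf0 _)] using hf.summable
  have hg1 : Summable fun n => ‖g n‖ := by
    simpa only [Real.norm_of_nonneg (hg0 _)] using hg.summable
  rw [← hf.tsum_eq, ← hg.tsum_eq, tsum_mul_tsum_eq_tsum_sum_antidiagonal_of_summable_norm hf1 hg1]
  exact (summable_norm_sum_mul_antidiagonal_of_summable_norm hf1 hg1).of_norm.hasSum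

/- The recursion `hrec` characterises the compound Poisson distributions `p` with jump rates `c`. -/

section CompoundPoisson

variable {c p : ℕ → ℝ} (hc : ∀ k, 0 ≤ c k) (hp : ∀ k, 0 ≤ p k)
  (hrec : ∀ k : ℕ, k * p k
    = ∑ q ∈ Finset.HasAntidiagonal.antidiagonal k, (q.1 * c q.1) * p q.2)

include hc hp hrec

theorem hasSum_mean (hp1 : HasSum p 1) (hc1 : HasSum (fun k : ℕ => k * c k) 1) :
    HasSum (fun k : ℕ => k * p k) 1 := by
  have h := hasSum_antidiagonal_mul (fun k => mul_nonneg k.cast_nonneg (hc k)) hp hc1 hp1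
  rw [mul_one] at h
  simpa only [hrec] using h

/-- The variance is the sum of the squared jump sizes, weighted by the jump rates. -/
theorem hasSum_variance (hp1 : HasSum p 1) (hc1 : HasSum (fun k : ℕ => k * c k) 1) {s : ℝ}
    (hc2 : HasSum (fun k : ℕ => (k : ℝ) ^ 2 * c k) s) :
    HasSum (fun k : ℕ => ((k : ℝ) - 1) ^ 2 * p k) s := by
  have hm := hasSum_mean hc hp hrec hp1 hc1
  have h1 := hasSum_antidiagonal_mul (fun k => mul_nonneg (sq_nonneg (k : ℝ)) (hc k)) hp hc2 hp1
  have h2 := hasSum_antidiagonal_mul (fun k : ℕ => mul_nonneg k.cast_nonneg (hc k))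
    (fun k : ℕ => mul_nonneg k.cast_nonneg (hp k)) hc1 hm
  have h3 : ∀ k : ℕ, (∑ q ∈ Finset.HasAntidiagonal.antidiagonal k, (q.1 : ℝ) ^ 2 * c q.1 * p q.2)
      + ∑ q ∈ Finset.HasAntidiagonal.antidiagonal k, (q.1 * c q.1) * (q.2 * p q.2)
      = (k : ℝ) ^ 2 * p k := by
    intro k
    rw [sq, mul_assoc, hrec, Finset.mul_sum, ← Finset.sum_add_distrib]
    refine Finset.sum_congr rfl fun q hq => ?_
    rw [← Finset.HasAntidiagonal.mem_antidiagonal.1 hq]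
    push_cast
    ring
  have h4 := h1.add h2
  simp_rw [h3] at h4
  have h5 := (h4.sub (hm.mul_left 2)).add hp1
  have h6 : s * 1 + 1 * 1 - 2 * 1 + 1 = s := by ring
  rw [h6] at h5
  have h7 : (fun k : ℕ => ((k : ℝ) - 1) ^ 2 * p k)
      = fun k : ℕ => (k : ℝ) ^ 2 * p k - 2 * (k * p k) + p k := by
    funext k
    ring
  rwa [h7]

theorem ne_zero_of_jump_ne_zero (hp0 : p 0 ≠ 0) (hc0 : c 0 = 0) {k : ℕ} (hk : c k ≠ 0) :
    p k ≠ 0 := by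
  have hk0 : k ≠ 0 := fun h => hk (h ▸ hc0)
  have h1 : (k * c k) * p 0 ≤ k * p k := by
    rw [hrec k]
    exact Finset.single_le_sum (f := fun q : ℕ × ℕ => (q.1 * c q.1) * p q.2)
      (fun q _ => mul_nonneg (mul_nonneg q.1.cast_nonneg (hc _)) (hp _))
      (Finset.HasAntidiagonal.mem_antidiagonal.2 (add_zero k) : (k, 0) ∈ _)
  have h2 : 0 < (k * c k) * p 0 :=
    mul_pos (mul_pos (by positivity) ((hc k).lt_of_ne' hk)) ((hp 0).lt_of_ne' hp0)
  intro h3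
  rw [h3, mul_zero] at h1
  exact absurd h1 (not_le.2 h2)

omit hc hp in
theorem dvd_of_forall_jump_dvd {m : ℕ} (hm : ∀ k, c k ≠ 0 → m ∣ k) (k : ℕ) (hk : p k ≠ 0) :
    m ∣ k := by
  induction k using Nat.strong_induction_on with
  | _ k ih =>
    rcases eq_or_ne k 0 with rfl | hk0
    · exact dvd_zero m
    have h1 : (k : ℝ) * p k ≠ 0 := mul_ne_zero (by exact_mod_cast hk0) hk
    rw [hrec] at h1
    obtain ⟨q, hq, hq0⟩ := Finset.exists_ne_zero_of_sum_ne_zero h1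
    rw [Finset.HasAntidiagonal.mem_antidiagonal] at hq
    have hq1 := left_ne_zero_of_mul hq0
    have h2 : q.1 ≠ 0 := fun h => hq1 (by simp [h])
    rw [← hq]
    exact dvd_add (hm _ (right_ne_zero_of_mul hq1)) (ih q.2 (by lia) (right_ne_zero_of_mul hq0))

/-- The span is the greatest common divisor of the jump sizes: as `0` is in the support, it is the
greatest common divisor of the support. -/
theorem span_spec (hp0 : p 0 ≠ 0) (hc0 : c 0 = 0) (hex : ∃ k, c k ≠ 0) {ξ : PMF ℕ}
    (hξ : ∀ k, k ∈ ξ.support ↔ p k ≠ 0) :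
    0 < span ξ ∧ (∀ k, c k ≠ 0 → span ξ ∣ k) ∧ ∀ m, (∀ k, c k ≠ 0 → m ∣ k) → m ∣ span ξ := by
  have hS : {m : ℕ | ∀ k ∈ ξ.support, ∀ l ∈ ξ.support, (m : ℤ) ∣ (k : ℤ) - (l : ℤ)}
      = {m : ℕ | ∀ k, c k ≠ 0 → m ∣ k} := by
    ext m
    simp only [Set.mem_ofPred_eq]
    constructor
    · intro h k hk
      have := h k ((hξ k).2 (ne_zero_of_jump_ne_zero hc hp hrec hp0 hc0 hk)) 0 ((hξ 0).2 hp0)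
      rw [Nat.cast_zero, sub_zero] at this
      exact_mod_cast this
    · intro h k hk l hl
      have := dvd_of_forall_jump_dvd hrec h
      exact dvd_sub (Int.natCast_dvd_natCast.2 (this k ((hξ k).1 hk)))
        (Int.natCast_dvd_natCast.2 (this l ((hξ l).1 hl)))
  obtain ⟨k₀, hk₀⟩ := hex
  have hk₀pos : 0 < k₀ := Nat.pos_of_ne_zero fun h => hk₀ (h ▸ hc0)
  have hbdd : BddAbove {m : ℕ | ∀ k, c k ≠ 0 → m ∣ k} :=
    ⟨k₀, fun m hm => Nat.le_of_dvd hk₀pos (hm k₀ hk₀)⟩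
  have h1 : 1 ∈ {m : ℕ | ∀ k, c k ≠ 0 → m ∣ k} := fun k _ => one_dvd k
  have hmem := Nat.sSup_mem ⟨1, h1⟩ hbdd
  rw [span, hS]
  refine ⟨le_csSup hbdd h1, hmem, fun m hm => ?_⟩
  -- The least common multiple of `m` and the maximum is again a common divisor.
  have h2 := le_csSup hbdd (show m.lcm _ ∈ _ from fun k hk => Nat.lcm_dvd (hm k hk) (hmem k hk))
  have h3 := h2.antisymm (Nat.le_of_dvd (Nat.lcm_pos (Nat.pos_of_dvd_of_pos (hm k₀ hk₀) hk₀pos)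
    (le_csSup hbdd h1)) (Nat.dvd_lcm_right _ _))
  exact h3 ▸ Nat.dvd_lcm_left _ _

end CompoundPoisson

theorem evariance_eq_ofReal {ξ : PMF ℕ} {s : ℝ}
    (h1 : HasSum (fun k : ℕ => k * (ξ k).toReal) 1)
    (h2 : HasSum (fun k : ℕ => ((k : ℝ) - 1) ^ 2 * (ξ k).toReal) s) :
    ProbabilityTheory.evariance (fun k : ℕ => (k : ℝ)) ξ.toMeasure = ENNReal.ofReal s := by
  have hξ : ∀ k, ξ.toMeasure {k} = ENNReal.ofReal (ξ k).toReal := fun k => by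
    rw [PMF.toMeasure_apply_singleton _ _ (measurableSet_singleton k),
      ENNReal.ofReal_toReal (ξ.apply_ne_top k)]
  have hint : Integrable (fun k : ℕ => (k : ℝ)) ξ.toMeasure := by
    refine ⟨by fun_prop, ?_⟩
    rw [HasFiniteIntegral, lintegral_countable']
    have : ∀ k : ℕ, ‖(k : ℝ)‖ₑ * ξ.toMeasure {k} = ENNReal.ofReal (k * (ξ k).toReal) := fun k => by
      rw [hξ, Real.enorm_of_nonneg k.cast_nonneg, ENNReal.ofReal_mul k.cast_nonneg]
    simp_rw [this]
    rw [← ENNReal.ofReal_tsum_of_nonneg (fun k => by positivity) h1.summable]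
    exact ENNReal.ofReal_lt_top
  have hmean : ∫ k : ℕ, (k : ℝ) ∂ξ.toMeasure = 1 := by
    rw [PMF.integral_eq_tsum _ _ hint, ← h1.tsum_eq]
    exact tsum_congr fun k => by rw [smul_eq_mul, mul_comm]
  rw [ProbabilityTheory.evariance, hmean, lintegral_countable', ← h2.tsum_eq,
    ENNReal.ofReal_tsum_of_nonneg (fun k => by positivity) h2.summable]
  refine tsum_congr fun k => ?_
  rw [hξ, ENNReal.ofReal_mul (sq_nonneg _), ← sq_abs, ENNReal.ofReal_pow (abs_nonneg _),
    Real.enorm_eq_ofReal_abs]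

/-! ### Boltzmann distributions -/

namespace Species

variable (F : Species)

theorem count_pointed (n : ℕ) : F.pointed.count n = n * F.count n := by
  rw [count, show F.pointed.obj (Fin n) = (Fin n × F.obj (Fin n)) from rfl, Nat.card_prod,
    Nat.card_eq_fintype_card, Fintype.card_fin, count]

theorem count_derived (n : ℕ) : F.derived.count n = F.count (n + 1) := by
  rw [count, show F.derived.obj (Fin n) = F.obj (Option (Fin n)) from rfl, card_obj]
  simp

theorem coe_coeff_egf (n : ℕ) :
    ((PowerSeries.coeff n F.egf : ℝ≥0) : ℝ) = PowerSeries.coeff n (egs (F.count ·)) := by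
  rw [coeff_egs, egf, PowerSeries.coeff_mk]
  push_cast
  rfl

theorem eval_eq (x : ℝ≥0∞) : F.eval x = evE (egs (F.count ·)) x := by
  refine tsum_congr fun n => ?_
  rw [← coe_coeff_egf, ENNReal.ofReal_coe_nnreal]

theorem lintegral_boltzmann (x : ℝ≥0∞) (g : ℕ → ℝ≥0∞) :
    ∫⁻ γ, g γ.size ∂(F.boltzmann x)
      = (∑' n, g n * (((PowerSeries.coeff n F.egf : ℝ≥0) : ℝ≥0∞) * x ^ n)) / F.eval x := by
  rw [boltzmann, lintegral_sum_measure]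
  have h1 : ∀ γ : F.Labelled, ∫⁻ γ', g γ'.size
      ∂((x ^ γ.size / (F.eval x * (γ.size ! : ℝ≥0∞))) • Measure.dirac γ)
      = x ^ γ.size / (F.eval x * (γ.size ! : ℝ≥0∞)) * g γ.size := fun γ => by
    rw [lintegral_smul_measure, lintegral_dirac' _ (measurable_from_top), smul_eq_mul]
  simp_rw [h1]
  rw [ENNReal.div_eq_inv_mul, ← ENNReal.tsum_mul_left]
  refine (ENNReal.tsum_sigma fun n (a : F.obj (Fin n)) =>
    x ^ n / (F.eval x * (n ! : ℝ≥0∞)) * g n).trans (tsum_congr fun n => ?_)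
  have := F.finite_obj (Fin n)
  have hfac : (n ! : ℝ≥0∞) ≠ 0 := by exact_mod_cast n.factorial_ne_zero
  rw [ENNReal.tsum_const, ENat.card_eq_coe_natCard, ← count, egf, PowerSeries.coeff_mk,
    ENNReal.coe_div (by exact_mod_cast n.factorial_ne_zero), ENNReal.coe_natCast,
    ENNReal.coe_natCast, ENNReal.div_eq_inv_mul, ENNReal.div_eq_inv_mul,
    ENNReal.mul_inv (Or.inr (ENNReal.natCast_ne_top _)) (Or.inr hfac)]
  push_cast
  ring

variable {F} {x : ℝ≥0∞}

theorem isProbabilityMeasure_boltzmann (h0 : F.eval x ≠ 0) (h1 : F.eval x ≠ ⊤) :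
    IsProbabilityMeasure (F.boltzmann x) := by
  constructor
  have h := F.lintegral_boltzmann x fun _ => 1
  simp only [one_mul, lintegral_one] at h
  rw [h]
  exact ENNReal.div_self h0 h1

theorem boltzmann_size_eq (F : Species) (x : ℝ≥0∞) (n : ℕ) : F.boltzmann x {γ | γ.size = n}
    = ((PowerSeries.coeff n F.egf : ℝ≥0) : ℝ≥0∞) * x ^ n / F.eval x := by
  have h := F.lintegral_boltzmann x fun k => if k = n then 1 else 0
  have h1 : ∫⁻ γ : F.Labelled, (if γ.size = n then 1 else 0 : ℝ≥0∞) ∂(F.boltzmann x)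
      = F.boltzmann x {γ | γ.size = n} := by
    rw [← lintegral_indicator_one (MeasurableSpace.measurableSet_top)]
    exact lintegral_congr fun γ => by simp [Set.indicator_apply]
  rw [← h1, h]
  simp

theorem boltzmannMeanSize_eq (F : Species) (x : ℝ≥0∞) : F.boltzmannMeanSize x
    = (∑' n : ℕ, (n : ℝ≥0∞) * (((PowerSeries.coeff n F.egf : ℝ≥0) : ℝ≥0∞) * x ^ n)) / F.eval x :=
  F.lintegral_boltzmann x fun n => n

end Species

/-! ### The critical point of a block-stable class -/

namespace GraphClass

open PowerSeries

variable {𝒢 : GraphClass}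

theorem nonneg_serT : Nonneg 𝒢.serT := .egs fun n => by positivity

theorem nonneg_serDB : Nonneg 𝒢.serDB := .egs fun n => by positivity

theorem eval_C_pointed (x : ℝ≥0∞) : 𝒢.C.pointed.eval x = evE 𝒢.serT x := by
  rw [Species.eval_eq, serT]
  simp_rw [Species.count_pointed, Nat.cast_mul]

theorem eval_B_derived (x : ℝ≥0∞) : 𝒢.B.derived.eval x = evE 𝒢.serDB x := by
  rw [Species.eval_eq, serDB]
  simp_rw [Species.count_derived]

theorem coeff_egf_B_derived_pointed (n : ℕ) :
    ((coeff n 𝒢.B.derived.pointed.egf : ℝ≥0) : ℝ) = n * coeff n 𝒢.serDB := by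
  rw [Species.coe_coeff_egf, coeff_egs, Species.count_pointed, Species.count_derived, serDB,
    coeff_egs]
  push_cast
  ring

/-- Below the radius of convergence of `B` the derived series converge as well. -/
theorem eval_B_derived_pointed_ne_top {x : ℝ≥0} (hx : x < 𝒢.rhoB) :
    𝒢.B.derived.pointed.eval x ≠ ⊤ := by
  have h := (summable_nat_add_iff 1).2 (summable_pow_mul_of_lt_radius 2 hx)
  rcases eq_or_ne x 0 with rfl | hx0
  · rw [Species.eval, tsum_eq_single 0]
    · simp
    · intro n hn
      simp [hn]
  have hx0 : (0 : ℝ) < x := by exact_mod_cast hx0.bot_lt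
  have h1 : Summable fun n : ℕ => (n : ℝ) * coeff n 𝒢.serDB * (x : ℝ) ^ n := by
    refine Summable.of_nonneg_of_le (fun n => mul_nonneg (mul_nonneg n.cast_nonneg
      (nonneg_serDB n)) (by positivity)) (fun n => ?_) (h.mul_right (x : ℝ)⁻¹)
    rw [Species.coe_coeff_egf, coeff_egs, serDB, coeff_egs, abs_of_nonneg (by positivity),
      Nat.factorial_succ]
    have h2 : ((n + 1 : ℕ) : ℝ) ^ 2 * (𝒢.B.count (n + 1) / ((n + 1) * n ! : ℕ) * x ^ (n + 1))
        * (x : ℝ)⁻¹ = ((n : ℝ) + 1) * (𝒢.B.count (n + 1) / n !) * x ^ n := by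
      push_cast
      field_simp
      ring
    rw [h2]
    gcongr
    simp
  have h2 : ∀ n : ℕ, ((coeff n 𝒢.B.derived.pointed.egf : ℝ≥0) : ℝ≥0∞) * (x : ℝ≥0∞) ^ n
      = ENNReal.ofReal ((n : ℝ) * coeff n 𝒢.serDB * (x : ℝ) ^ n) := fun n => by
    rw [← coeff_egf_B_derived_pointed, ← NNReal.coe_pow, ← NNReal.coe_mul,
      ENNReal.ofReal_coe_nnreal, ENNReal.coe_mul, ENNReal.coe_pow]
  rw [Species.eval]
  simp_rw [h2]
  rw [← ENNReal.ofReal_tsum_of_nonneg (fun n => mul_nonneg (mul_nonneg n.cast_nonneg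
      (nonneg_serDB n)) (by positivity)) h1]
  exact ENNReal.ofReal_ne_top

/-- The critical point `τ`, where `τ B''(τ) = 1`. -/
theorem exists_critical (hcrit : 1 ≤ 𝒢.B.derived.pointed.eval 𝒢.rhoB) :
    ∃ τ : ℝ, 0 < τ ∧ HasSum (fun n : ℕ => n * coeff n 𝒢.serDB * τ ^ n) 1 := by
  set F := egs (fun n => 𝒢.B.derived.pointed.count n) with hF
  have hFn : Nonneg F := .egs fun n => by positivity
  obtain ⟨τ, hτ, -, h⟩ := exists_evE_eq_one hFn (by
      rw [← coeff_zero_eq_constantCoeff_apply, hF, coeff_egs, Species.count_pointed]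
      simp) (R := 𝒢.rhoB) (fun x hx => by
      rw [← Species.eval_eq]
      exact eval_B_derived_pointed_ne_top hx) (by rwa [← Species.eval_eq])
  refine ⟨τ, hτ, ?_⟩
  have h1 := hasSum_of_evE_ne_top hFn hτ.le (by rw [h]; exact ENNReal.one_ne_top)
  rw [h, ENNReal.toReal_one] at h1
  simpa only [hF, ← Species.coe_coeff_egf, coeff_egf_B_derived_pointed] using h1

section Critical

variable (h𝒢 : 𝒢.IsBlockStable) {τ l : ℝ} (hτ : 0 < τ)
  (h1 : HasSum (fun n : ℕ => n * coeff n 𝒢.serDB * τ ^ n) 1)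
  (hl : HasSum (fun n => coeff n 𝒢.serDB * τ ^ n) l)

include h𝒢 hτ h1 hl

theorem evE_serT_critical :
    evE 𝒢.serT (ENNReal.ofReal (τ * Real.exp (-l))) = ENNReal.ofReal τ := by
  rw [← hl.tsum_eq]
  exact evE_critical nonneg_serDB constantCoeff_serDB nonneg_serT (serT_functional_equation h𝒢)
    hτ h1

theorem hasSum_serT_critical :
    HasSum (fun n => coeff n 𝒢.serT * (τ * Real.exp (-l)) ^ n) τ := by
  have h := evE_serT_critical h𝒢 hτ h1 hl
  have h2 := hasSum_of_evE_ne_top (nonneg_serT (𝒢 := 𝒢)) (by positivity : 0 ≤ τ * Real.exp (-l))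
    (by rw [h]; exact ENNReal.ofReal_ne_top)
  rwa [h, ENNReal.toReal_ofReal hτ.le] at h2

/-- The radius of convergence is the critical value `r = τ exp(-B'(τ))`: the series `C^•` is finite
at `r`, and nowhere beyond. -/
theorem rho_eq : 𝒢.rho = ENNReal.ofReal (τ * Real.exp (-l)) := by
  have hcoeff : ∀ n, ((coeff n 𝒢.C.egf : ℝ≥0) : ℝ) = 𝒢.C.count n / n ! := fun n => by
    rw [Species.coe_coeff_egf, coeff_egs]
  apply le_antisymm
  · refine ENNReal.le_of_forall_nnreal_lt fun x hx => ?_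
    have h2 := summable_pow_mul_of_lt_radius 1 hx
    have h3 : (fun n : ℕ => (n : ℝ) ^ 1 * (|((coeff n 𝒢.C.egf : ℝ≥0) : ℝ)| * (x : ℝ) ^ n))
        = fun n => coeff n 𝒢.serT * (x : ℝ) ^ n := by
      funext n
      rw [hcoeff, serT, coeff_egs, abs_of_nonneg (by positivity)]
      ring
    rw [h3] at h2
    have h4 := evE_eq_ofReal nonneg_serT x.2 h2.hasSum
    have h5 := le_of_evE_ne_top nonneg_serDB constantCoeff_serDB nonneg_serT
      (serT_functional_equation h𝒢) hτ h1 x.2 (by rw [h4]; exact ENNReal.ofReal_ne_top)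
    rw [hl.tsum_eq] at h5
    rw [← ENNReal.ofReal_coe_nnreal]
    exact ENNReal.ofReal_le_ofReal h5
  · have h2 := hasSum_serT_critical h𝒢 hτ h1 hl
    have hr0 : 0 ≤ τ * Real.exp (-l) := by positivity
    refine FormalMultilinearSeries.le_radius_of_bound _ τ (r := (τ * Real.exp (-l)).toNNReal)
      fun n => ?_
    rw [FormalMultilinearSeries.ofScalars_norm, hcoeff, Real.coe_toNNReal _ hr0,
      Real.norm_of_nonneg (by positivity)]
    refine le_trans ?_ (le_hasSum h2 n fun m _ => mul_nonneg (nonneg_serT m) (by positivity))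
    rw [serT, coeff_egs]
    gcongr
    rcases n with _ | n
    · simp [count_C_zero]
    · push_cast
      exact le_mul_of_one_le_left (Nat.cast_nonneg _) (by simp)

theorem y_eq : 𝒢.y = ENNReal.ofReal τ := by
  rw [y, eval_C_pointed, rho_eq h𝒢 hτ h1 hl, evE_serT_critical h𝒢 hτ h1 hl]

theorem lam_eq : 𝒢.lam = ENNReal.ofReal l := by
  rw [lam, eval_B_derived, y_eq h𝒢 hτ h1 hl, evE_eq_ofReal nonneg_serDB hτ.le hl]

/-- The condition `B'''(y) < ∞`, expressed as a finite second moment of the jump rates. -/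
theorem summable_sq_mul (hvar : 𝒢.B.derived.derived.derived.eval 𝒢.y < ⊤) :
    Summable fun n : ℕ => (n : ℝ) ^ 2 * (coeff n 𝒢.serDB * τ ^ n) := by
  rw [y_eq h𝒢 hτ h1 hl, Species.eval_eq] at hvar
  have h2 := (hasSum_of_evE_ne_top (.egs fun n => by positivity) hτ.le hvar.ne).summable
  have h3 := (h2.mul_right (τ ^ 2)).add ((summable_nat_add_iff 2).2 h1.summable)
  refine (summable_nat_add_iff 2).1 (h3.congr fun n => ?_)
  rw [coeff_egs, Species.count_derived, Species.count_derived, Species.count_derived, serDB,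
    coeff_egs, Nat.factorial_succ, Nat.factorial_succ]
  push_cast
  field_simp
  ring

theorem eval_B_derived_pointed_y : 𝒢.B.derived.pointed.eval 𝒢.y = 1 := by
  rw [y_eq h𝒢 hτ h1 hl, Species.eval_eq, evE_eq_ofReal (.egs fun n => by positivity) hτ.le
    (s := 1), ENNReal.ofReal_one]
  simpa only [← Species.coe_coeff_egf, coeff_egf_B_derived_pointed] using h1

theorem boltzmannMeanSize_B {s : ℝ}
    (hs : HasSum (fun n : ℕ => (n : ℝ) ^ 2 * (coeff n 𝒢.serDB * τ ^ n)) s) :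
    𝒢.B.derived.pointed.boltzmannMeanSize 𝒢.y = ENNReal.ofReal s := by
  rw [Species.boltzmannMeanSize_eq, eval_B_derived_pointed_y h𝒢 hτ h1 hl, div_one,
    y_eq h𝒢 hτ h1 hl, ← hs.tsum_eq, ENNReal.ofReal_tsum_of_nonneg
      (fun n => mul_nonneg (by positivity) (mul_nonneg (nonneg_serDB n) (by positivity)))
      hs.summable]
  refine tsum_congr fun n => ?_
  rw [← ENNReal.ofReal_coe_nnreal, coeff_egf_B_derived_pointed, ← ENNReal.ofReal_pow hτ.le,
    ← ENNReal.ofReal_natCast, ← ENNReal.ofReal_mul (mul_nonneg n.cast_nonneg (nonneg_serDB n)),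
    ← ENNReal.ofReal_mul n.cast_nonneg]
  congr 1
  ring

theorem boltzmann_C_size (n : ℕ) :
    (𝒢.C.pointed.boltzmann 𝒢.rho {γ | γ.size = n}).toReal
      = coeff n 𝒢.serT * (τ * Real.exp (-l)) ^ n / τ := by
  rw [Species.boltzmann_size_eq, eval_C_pointed, rho_eq h𝒢 hτ h1 hl,
    evE_serT_critical h𝒢 hτ h1 hl, ENNReal.toReal_div, ENNReal.toReal_mul, ENNReal.toReal_pow,
    ENNReal.toReal_ofReal hτ.le, ENNReal.toReal_ofReal (by positivity), ENNReal.coe_toReal,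
    Species.coe_coeff_egf, coeff_egs, serT, coeff_egs, Species.count_pointed, Nat.cast_mul]

omit h1 hl in
/-- Lagrange inversion, in probabilistic form: `ℙ(|ΓC^•(ρ)| = n) = ℙ(S_n = n - 1) / n`. -/
theorem coeff_serT_mul_pow {n : ℕ} (hn : n ≠ 0) :
    coeff n 𝒢.serT * (τ * Real.exp (-l)) ^ n / τ = convLaw 𝒢.serDB τ l n (n - 1) / n := by
  obtain ⟨n, rfl⟩ := Nat.exists_eq_succ_of_ne_zero hn
  have h := lagrange_inversion (serT_functional_equation h𝒢) n
  rw [convLaw, Nat.succ_sub_one, Nat.succ_eq_add_one, ← serE, ← h, mul_pow, ← Real.exp_nat_mul,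
    pow_succ, mul_neg]
  push_cast
  field_simp

theorem isOffspringLaw {ξ : PMF ℕ} (hξ : ∀ k, (ξ k).toReal = convLaw 𝒢.serDB τ l 1 k) :
    𝒢.IsOffspringLaw ξ := by
  intro z hz
  have hl0 : 0 ≤ l := hl.nonneg fun n => mul_nonneg (nonneg_serDB n) (by positivity)
  have hz1 : (z : ℝ) ≤ 1 := by exact_mod_cast hz
  have h2 : Summable fun n => coeff n 𝒢.serDB * (τ * z) ^ n :=
    Summable.of_nonneg_of_le (fun n => mul_nonneg (nonneg_serDB n) (by positivity)) (fun n =>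
      mul_le_mul_of_nonneg_left (pow_le_pow_left₀ (by positivity)
        (mul_le_of_le_one_right hτ.le hz1) n) (nonneg_serDB n)) hl.summable
  have h3 : (𝒢.B.derived.eval (𝒢.y * z)).toReal = ∑' n, coeff n 𝒢.serDB * (τ * z) ^ n := by
    rw [eval_B_derived, y_eq h𝒢 hτ h1 hl, ← ENNReal.ofReal_coe_nnreal, ← ENNReal.ofReal_mul hτ.le,
      evE_eq_ofReal nonneg_serDB (by positivity) h2.hasSum, ENNReal.toReal_ofReal
      (tsum_nonneg fun n => mul_nonneg (nonneg_serDB n) (by positivity))]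
  have h4 := hasSum_convLaw_mul_pow nonneg_serDB constantCoeff_serDB hτ hl 1 (z := ((z : ℝ) : ℂ))
    (by rw [Complex.norm_real, Real.norm_of_nonneg z.coe_nonneg]; exact hz1)
  rw [h3, lam_eq h𝒢 hτ h1 hl, ENNReal.toReal_ofReal hl0]
  simp_rw [hξ, mul_pow]
  rw [← Complex.hasSum_ofReal]
  simp_rw [← mul_assoc]
  push_cast at h4 ⊢
  rwa [one_mul] at h4

omit h𝒢 in
theorem tendsto_convLaw {d : ℕ}
    (hsq : Summable fun n : ℕ => (n : ℝ) ^ 2 * (coeff n 𝒢.serDB * τ ^ n))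
    (hd0 : 0 < d) (hddvd : ∀ k, coeff k 𝒢.serDB * τ ^ k ≠ 0 → d ∣ k)
    (hd : ∀ m : ℕ, (∀ k, coeff k 𝒢.serDB * τ ^ k ≠ 0 → m ∣ k) → m ∣ d) :
    Tendsto (fun N : ℕ => √N * convLaw 𝒢.serDB τ l N (N - 1)) (atTopOneMod d)
      (𝓝 (d / √(2 * Real.pi * ∑' n : ℕ, (n : ℝ) ^ 2 * (coeff n 𝒢.serDB * τ ^ n)))) := by
  refine local_limit (fun k => mul_nonneg (nonneg_serDB k) (by positivity)) hsq hl
    (by simpa only [mul_assoc] using h1) hd0 hddvd hd (fun N => ?_) (fun N θ => ?_)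
  · have := (hasSum_convLaw nonneg_serDB constantCoeff_serDB hτ hl N).summable
    exact this.abs
  · have h := hasSum_convLaw_mul_pow nonneg_serDB constantCoeff_serDB hτ hl N
      (z := Complex.exp ((θ : ℂ) * Complex.I)) (Complex.norm_exp_ofReal_mul_I θ).le
    have hpow : ∀ j : ℕ, Complex.exp ((θ : ℂ) * Complex.I) ^ j
        = Complex.exp ((j * θ : ℝ) * Complex.I) := fun j => by
      rw [← Complex.exp_nat_mul]
      push_cast
      ring_nf
    simpa only [hpow] using h

end Critical

end GraphClass

/-- Multiplying a limit relation for `√n q_n` by a power of `n`. -/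
theorem isEquivalent_of_tendsto_sqrt_mul {L : Filter ℕ} (hL : L ≤ atTop) {q : ℕ → ℝ} {κ : ℝ}
    (hκ : κ ≠ 0) (h : Tendsto (fun n : ℕ => √n * q n) L (𝓝 κ)) :
    (fun n : ℕ => q n / n) ~[L] fun n : ℕ => κ * (n : ℝ) ^ (-(3 / 2) : ℝ) := by
  have h1 := ((isEquivalent_const_iff_tendsto hκ).2 h).mul
    (IsEquivalent.refl (u := fun n : ℕ => (n : ℝ) ^ (-(3 / 2) : ℝ)) (l := L))
  refine h1.congr_left ?_
  filter_upwards [hL (eventually_gt_atTop 0)] with n hn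
  have hn : (0 : ℝ) < n := by exact_mod_cast hn
  simp only [Pi.mul_apply]
  rw [mul_right_comm, Real.sqrt_eq_rpow, ← Real.rpow_add hn]
  norm_num
  rw [Real.rpow_neg_one]
  ring

end BlockStable

theorem corollary3 (𝒢 : BlockStable.GraphClass)
    (hstable : 𝒢.IsBlockStable)
    (hanalytic : 𝒢.C.IsAnalytic)
    (hcrit : 1 ≤ 𝒢.B.derived.pointed.eval 𝒢.rhoB)
    (hvar : 𝒢.B.derived.derived.derived.eval 𝒢.y < ⊤) :
    -- the quantities in the statement are well defined
    𝒢.rho < ⊤ ∧ 𝒢.y < ⊤ ∧ 𝒢.lam < ⊤ ∧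
    IsProbabilityMeasure (𝒢.C.pointed.boltzmann 𝒢.rho) ∧
    IsProbabilityMeasure (𝒢.B.derived.pointed.boltzmann 𝒢.y) ∧
    𝒢.B.derived.pointed.boltzmannMeanSize 𝒢.y < ⊤ ∧
    -- the offspring distribution, its variance, and the two asymptotic formulas
    ∃ ξ : PMF ℕ, 𝒢.IsOffspringLaw ξ ∧
      ProbabilityTheory.evariance (fun k : ℕ => (k : ℝ)) ξ.toMeasure
        = 𝒢.B.derived.pointed.boltzmannMeanSize 𝒢.y ∧
      (fun n : ℕ => (𝒢.C.pointed.boltzmann 𝒢.rho {γ | γ.size = n}).toReal)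
        ~[BlockStable.atTopOneMod (BlockStable.span ξ)]
        (fun n : ℕ => (BlockStable.span ξ : ℝ) /
            √(2 * Real.pi * (𝒢.B.derived.pointed.boltzmannMeanSize 𝒢.y).toReal)
          * (n : ℝ) ^ (-(3 / 2) : ℝ)) ∧
      (fun n : ℕ => (𝒢.C.count n : ℝ))
        ~[BlockStable.atTopOneMod (BlockStable.span ξ)]
        (fun n : ℕ => 𝒢.y.toReal * (BlockStable.span ξ : ℝ) /
            √(2 * Real.pi * (𝒢.B.derived.pointed.boltzmannMeanSize 𝒢.y).toReal)
          * (n : ℝ) ^ (-(5 / 2) : ℝ) * (𝒢.rho.toReal ^ n)⁻¹ * (n ! : ℝ)) := by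
  open BlockStable BlockStable.GraphClass PowerSeries in
  obtain ⟨τ, hτ, h1⟩ := exists_critical hcrit
  have hb := nonneg_serDB (𝒢 := 𝒢)
  have hb0 := constantCoeff_serDB (𝒢 := 𝒢)
  obtain ⟨l, hl⟩ := summable_coeff_mul_pow hb hb0 hτ h1
  have hrho := rho_eq hstable hτ h1 hl
  have hy := y_eq hstable hτ h1 hl
  have hlam := lam_eq hstable hτ h1 hl
  have hsq := summable_sq_mul hstable hτ h1 hl hvar
  obtain ⟨s, hs⟩ := hsq
  have hmean := boltzmannMeanSize_B hstable hτ h1 hl hs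
  have hcnn : ∀ k, 0 ≤ coeff k 𝒢.serDB * τ ^ k := fun k => mul_nonneg (hb k) (by positivity)
  have hpnn : ∀ k, 0 ≤ convLaw 𝒢.serDB τ l 1 k := convLaw_nonneg hb hb0 hτ 1
  have hrec := mul_convLaw_one (τ := τ) (l := l) hb0
  have hp1 := hasSum_convLaw hb hb0 hτ hl 1
  have hc1 : HasSum (fun k : ℕ => k * (coeff k 𝒢.serDB * τ ^ k)) 1 := by
    simpa only [mul_assoc] using h1
  have hp0 : convLaw 𝒢.serDB τ l 1 0 ≠ 0 := by
    simp [convLaw, constantCoeff_expOf hb0]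
  have hc0 : coeff 0 𝒢.serDB * τ ^ 0 = 0 := by simp [hb0]
  have hex : ∃ k, coeff k 𝒢.serDB * τ ^ k ≠ 0 := by
    by_contra! hall
    simp_rw [hall, mul_zero] at hc1
    exact zero_ne_one (hasSum_zero.unique hc1)
  -- The offspring distribution.
  obtain ⟨ξ, hξ⟩ : ∃ ξ : PMF ℕ, ∀ k, ξ k = ENNReal.ofReal (convLaw 𝒢.serDB τ l 1 k) := by
    refine ⟨⟨fun k => ENNReal.ofReal (convLaw 𝒢.serDB τ l 1 k), ?_⟩, fun k => rfl⟩
    rw [ENNReal.summable.hasSum_iff, ← ENNReal.ofReal_tsum_of_nonneg hpnn hp1.summable,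
      hp1.tsum_eq, ENNReal.ofReal_one]
  have hξr : ∀ k, (ξ k).toReal = convLaw 𝒢.serDB τ l 1 k := fun k => by
    rw [hξ, ENNReal.toReal_ofReal (hpnn k)]
  have hsupp : ∀ k, k ∈ ξ.support ↔ convLaw 𝒢.serDB τ l 1 k ≠ 0 := fun k => by
    rw [PMF.mem_support_iff, ← hξr, Ne, Ne, ENNReal.toReal_eq_zero_iff,
      or_iff_left (ξ.apply_ne_top k)]
  obtain ⟨hd0, hddvd, hd⟩ := span_spec hcnn hpnn hrec hp0 hc0 hex hsupp
  have hlim := tendsto_convLaw hτ h1 hl hs.summable hd0 hddvd hd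
  rw [hs.tsum_eq] at hlim
  -- The variance is at least the mean of the jump sizes, which is one.
  have hspos : 0 < s := lt_of_lt_of_le one_pos (hasSum_le (fun k => by
    rw [sq, mul_assoc]
    rcases k with _ | k
    · simp
    · exact le_mul_of_one_le_left (mul_nonneg (Nat.cast_nonneg _) (hcnn _)) (by simp)) hc1 hs)
  have hκ : (span ξ : ℝ) / √(2 * Real.pi * s) ≠ 0 := by positivity
  have hprob := isEquivalent_of_tendsto_sqrt_mul inf_le_left hκ hlim
  have hne : ∀ᶠ n in atTopOneMod (span ξ), n ≠ 0 :=
    (inf_le_left : atTopOneMod (span ξ) ≤ atTop) (eventually_ne_atTop 0)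
  have hr0 : 0 < τ * Real.exp (-l) := by positivity
  have hyt : 𝒢.C.pointed.eval 𝒢.rho = ENNReal.ofReal τ := hy
  refine ⟨hrho ▸ ENNReal.ofReal_lt_top, hy ▸ ENNReal.ofReal_lt_top, hlam ▸ ENNReal.ofReal_lt_top,
    Species.isProbabilityMeasure_boltzmann (by rw [hyt]; simpa using hτ)
      (by rw [hyt]; exact ENNReal.ofReal_ne_top),
    Species.isProbabilityMeasure_boltzmann
      (by rw [eval_B_derived_pointed_y hstable hτ h1 hl]; exact one_ne_zero)
      (by rw [eval_B_derived_pointed_y hstable hτ h1 hl]; exact ENNReal.one_ne_top),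
    hmean ▸ ENNReal.ofReal_lt_top, ξ, isOffspringLaw hstable hτ h1 hl hξr, ?_, ?_, ?_⟩
  · rw [hmean]
    refine evariance_eq_ofReal ?_ ?_
    · simpa only [hξr] using hasSum_mean hcnn hpnn hrec hp1 hc1
    · simpa only [hξr] using hasSum_variance hcnn hpnn hrec hp1 hc1 hs
  · rw [hmean, ENNReal.toReal_ofReal hspos.le]
    refine hprob.congr_left ?_
    filter_upwards [hne] with n hn
    rw [boltzmann_C_size hstable hτ h1 hl, coeff_serT_mul_pow hstable hτ hn]
  · rw [hmean, ENNReal.toReal_ofReal hspos.le, hy, ENNReal.toReal_ofReal hτ.le, hrho,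
      ENNReal.toReal_ofReal hr0.le]
    -- Since `[zⁿ] C^• = n |𝒞_n| / n!`, the count is the probability times `y n! / (n ρⁿ)`.
    have h2 := hprob.mul (IsEquivalent.refl (l := atTopOneMod (span ξ)) (u := fun n : ℕ =>
      τ * (n : ℝ)⁻¹ * ((τ * Real.exp (-l)) ^ n)⁻¹ * (n ! : ℝ)))
    refine (h2.congr_left ?_).congr_right ?_
    · filter_upwards [hne] with n hn
      have hn' : (n : ℝ) ≠ 0 := by exact_mod_cast hn
      simp only [Pi.mul_apply]
      rw [← coeff_serT_mul_pow hstable hτ hn, serT, coeff_egs]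
      field_simp
    · filter_upwards [hne] with n hn
      have hn' : (0 : ℝ) < n := by positivity
      have h3 : (n : ℝ) ^ (-(5 / 2) : ℝ) = (n : ℝ) ^ (-(3 / 2) : ℝ) * (n : ℝ)⁻¹ := by
        rw [← Real.rpow_neg_one, ← Real.rpow_add hn']
        norm_num
      simp only [Pi.mul_apply]
      rw [h3]
      ring
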